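/- **Setting.** Fix $n>0$. A Temperley-Lieb diagram on $n$ strands is a planar diagram without crossings (closed circles are allowed) in a rectangle with $n$ end points on the top and $n$ on the bottom; $1$ is the diagram of $n$ vertical strands, and $e_i$ ($0<i<n$) is the diagram in which the $i$-th and $(i+1)$-st points are connected on the top and on the bottom and all other strands are vertical. Bar-Natan's category $\mathrm{Cob}(n)$ has as objects the formally $q$-graded diagrams $q^iD$ ($i\in\mathbb Z$). Its morphisms $q^iD\to q^jE$ are the $\mathbb Z[\alpha]$-linear combinations of isotopy classes of dotted orientable cobordisms in $\mathbb R^3$ from $D$ to $E$, fixed over the end points, modulo the local relations: a sphere with $0,1,2,3$ dots equals $0,1,0,\alpha$ respectively, and a neck (circle times interval) equals the sum of the two ways of cutting it into two disks and putting one dot on one of them. Composition is gluing in the time direction. A cobordism $S$ with $d$ dots has degree $\chi(S)-2d-n+(j-i)$, and $\alpha$ has degree $-4$. $\mathrm{Mat}(\mathrm{Cob}(n))$ is the additive category of formal finite direct sums of objects of $\mathrm{Cob}(n)$ and matrices of morphisms, and $\mathrm{Kom}(n)$ is the category of bounded below chain complexes over it, whose differentials $d_k:P_k\to P_{k+1}$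 raise the homological degree by one. The operations $-\otimes e_i$ and $e_i\otimes-$ glue $e_i$ (times an interval) to the bottom, respectively to the top, of all diagrams (and cobordisms). A complex $(P_*,d_*)\in\mathrm{Kom}(n)$ is a **universal projector** if 1. $P_k=0$ for $k<0$; for $k>0$ all summands $q^iD$ of $P_k$ have $i\ge 0$; and every $d_k$ is a matrix of morphisms of degree zero; 2. $P_0\cong 1$ by an isomorphism of degree zero, and for $k>0$ there is no object $D$ of $\mathrm{Mat}(\mathrm{Cob}(n))$ with $P_k\cong 1\oplus D$ (by an isomorphism of any degree); 3. $P_*\otimes e_i$ and $e_i\otimes P_*$ are contractible, i.e. homotopy equivalent to the zero complex, for all $0<i<n$. **Theorem.** For each $n>0$ there exists a chain complex $C\in\mathrm{Kom}(n)$ that is a universal projector. -/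

import Mathlib

namespace BarNatan

open CategoryTheory
open scoped CategoryTheory.Limits ZeroObject

/-! ### Planar tangle diagrams -/

/-- The elementary pieces of a planar tangle diagram without crossings, read from top to bottom.
`create i` inserts an arc whose two (lower) end points are at the positions `i` and `i + 1` of the
next level; `join i` connects the points at the positions `i` and `i + 1` by an arc.  All other
strands run vertically.  Positions are counted from `0`, from left to right. -/
inductive Letter : Type
  | create (i : ℕ)
  | join (i : ℕ)

/-- `l.Step a b`: the piece `l` has `a` points on its upper and `b` points on its lower side. -/
def Letter.Step : Letter → ℕ → ℕ → Prop
  | .create i, a, b => i ≤ a ∧ b = a + 2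
  | .join i, a, b => i ≤ b ∧ a = b + 2

/-- The number of points below a piece that has `a` points above it. -/
def Letter.next : Letter → ℕ → ℕ
  | .create _, a => a + 2
  | .join _, a => a - 2

/-- `IsTangle a w b`: the pieces of `w`, stacked below each other, form a diagram with `a` points
on the top and `b` points on the bottom. -/
def IsTangle : ℕ → List Letter → ℕ → Prop
  | a, [], b => a = b
  | a, l :: w, b => ∃ c, l.Step a c ∧ IsTangle c w b

theorem IsTangle.append {a b c : ℕ} {u v : List Letter} (hu : IsTangle a u b)
    (hv : IsTangle b v c) : IsTangle a (u ++ v) c := by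
  induction u generalizing a with
  | nil => cases hu; exact hv
  | cons l u ih =>
    obtain ⟨d, hd, h⟩ := hu
    exact ⟨d, hd, ih h⟩

/-- A planar tangle diagram without crossings (closed circles are allowed) with `a` end points on
the top and `b` end points on the bottom, in general position with respect to the height.
`Tangle n n` is the type of Temperley-Lieb diagrams on `n` strands. -/
@[ext]
structure Tangle (a b : ℕ) : Type where
  /-- the elementary pieces, from top to bottom -/
  word : List Letter
  isTangle : IsTangle a word b

namespace Tangle

/-- The diagram consisting of `a` vertical strands. -/
def one (a : ℕ) : Tangle a a := ⟨[], rfl⟩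

/-- The vertical composition of diagrams: `D.stack E` is `D` on top of `E`. -/
def stack {a b c : ℕ} (D : Tangle a b) (E : Tangle b c) : Tangle a c :=
  ⟨D.word ++ E.word, D.isTangle.append E.isTangle⟩

theorem stack_assoc {a b c d : ℕ} (D : Tangle a b) (E : Tangle b c) (F : Tangle c d) :
    (D.stack E).stack F = D.stack (E.stack F) :=
  Tangle.ext (List.append_assoc _ _ _)

/-- The diagram of a single arc created between `a` vertical strands. -/
def createArc (a i : ℕ) (h : i ≤ a) : Tangle a (a + 2) := ⟨[.create i], a + 2, ⟨h, rfl⟩, rfl⟩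

/-- The diagram of a single arc joining two of `a + 2` strands. -/
def joinArc (a i : ℕ) (h : i ≤ a) : Tangle (a + 2) a := ⟨[.join i], a, ⟨h, rfl⟩, rfl⟩

/-- The diagram consisting of `a` vertical strands and one small circle, which is placed to the
right of the first `i` strands. -/
def circle (a i : ℕ) (h : i ≤ a) : Tangle a a := (createArc a i h).stack (joinArc a i h)

/-- The generator `e_i` of the Temperley-Lieb algebra, `0 < i < n`: the `i`-th and the `i + 1`-st
point (counted from `1`) are connected on the top and on the bottom, all other strands are
vertical. -/
def turnback (n i : ℕ) (h₀ : 0 < i) (h : i < n) : Tangle n n :=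
  ⟨[.join (i - 1), .create (i - 1)],
    n - 2, ⟨by omega, by omega⟩, n, ⟨by omega, by omega⟩, rfl⟩

end Tangle

/-- The number of points of the diagram `w` on the level `t`, that is, right below its first `t`
pieces; there are `a` points on the level `0`, and there are none below the last piece. -/
def widthAt : ℕ → List Letter → ℕ → ℕ
  | a, _, 0 => a
  | _, [], _ + 1 => 0
  | a, l :: w, t + 1 => widthAt (l.next a) w t

theorem Letter.Step.next_eq {l : Letter} {a b : ℕ} (h : l.Step a b) : l.next a = b := by
  cases l <;> simp only [Letter.Step, Letter.next] at * <;> omega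

theorem widthAt_append {a b : ℕ} {u : List Letter} (hu : IsTangle a u b) (w : List Letter)
    (t : ℕ) : widthAt a (u ++ w) (u.length + t) = widthAt b w t := by
  induction u generalizing a with
  | nil => cases hu; simp
  | cons l u ih =>
    obtain ⟨d, hd, h⟩ := hu
    have e : (l :: u).length + t = (u.length + t) + 1 := by simp only [List.length_cons]; omega
    rw [e, List.cons_append]
    simp only [widthAt]
    rw [hd.next_eq]
    exact ih h

/-- Two points of the diagram, given as (level, position), are neighbours on an arc of the piece
`l` that lies between the levels `t` and `t + 1`. -/
inductive Letter.Adj : Letter → ℕ → ℕ × ℕ → ℕ × ℕ → Prop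
  | create_arc (i t : ℕ) : Letter.Adj (.create i) t (t + 1, i) (t + 1, i + 1)
  | create_left (i t j : ℕ) (h : j < i) : Letter.Adj (.create i) t (t, j) (t + 1, j)
  | create_right (i t j : ℕ) (h : i ≤ j) : Letter.Adj (.create i) t (t, j) (t + 1, j + 2)
  | join_arc (i t : ℕ) : Letter.Adj (.join i) t (t, i) (t, i + 1)
  | join_left (i t j : ℕ) (h : j < i) : Letter.Adj (.join i) t (t, j) (t + 1, j)
  | join_right (i t j : ℕ) (h : i ≤ j) : Letter.Adj (.join i) t (t, j + 2) (t + 1, j)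

/-- The points of the diagram `D` on all its levels, written as (level, position). -/
def Tangle.Point {a b : ℕ} (D : Tangle a b) : Type :=
  {p : ℕ × ℕ // p.2 < widthAt a D.word p.1}

/-- Two points of `D` are neighbours on a strand of `D`.  The connected components of `D` are the
classes of the equivalence relation generated by this one. -/
def Tangle.Adj {a b : ℕ} (D : Tangle a b) (p q : D.Point) : Prop :=
  ∃ (t : ℕ) (l : Letter), D.word[t]? = some l ∧ l.Adj t p.1 q.1

/-! ### Elementary cobordisms -/

/-- The elementary planar isotopies of diagrams: straightening a strand, and exchanging the heights
of two distant arcs. -/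
inductive PlanarIsotopy : List Letter → List Letter → Prop
  | zigzag_left (i : ℕ) : PlanarIsotopy [.create i, .join (i + 1)] []
  | zigzag_right (i : ℕ) : PlanarIsotopy [.create (i + 1), .join i] []
  | create_create (i j : ℕ) (h : i ≤ j) :
      PlanarIsotopy [.create i, .create (j + 2)] [.create j, .create i]
  | join_join (i j : ℕ) (h : i ≤ j) :
      PlanarIsotopy [.join i, .join j] [.join (j + 2), .join i]
  | create_join (i j : ℕ) (h : i ≤ j) :
      PlanarIsotopy [.create i, .join (j + 2)] [.join j, .create i]
  | join_create (i j : ℕ) (h : i ≤ j) :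
      PlanarIsotopy [.join i, .create j] [.create (j + 2), .join i]

/-- The elementary local changes of a diagram with time, i.e. the elementary dotted cobordisms.
`Local a s t` are those which replace the part `s` of the diagram by `t`, where `a` is the number
of points above `s`:
* `birth`, `death`: a disk that bounds a new, respectively an old, small circle;
* `saddle`: two adjacent vertical strands are changed to a pair of turnbacks by a saddle, and
  `saddleInv` is the same surface, upside down in time;
* `dot`: a dot is put on the sheet over the `j`-th strand, the diagram does not change;
* `isotopy`, `isotopyInv`: the trace of a planar isotopy. -/
inductive Local (a : ℕ) : List Letter → List Letter → Type
  | birth (i : ℕ) (h : i ≤ a) : Local a [] [.create i, .join i]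
  | death (i : ℕ) (h : i ≤ a) : Local a [.create i, .join i] []
  | saddle (i : ℕ) (h : i + 2 ≤ a) : Local a [] [.join i, .create i]
  | saddleInv (i : ℕ) (h : i + 2 ≤ a) : Local a [.join i, .create i] []
  | dot (j : ℕ) (h : j < a) : Local a [] []
  | isotopy {s t : List Letter} (h : PlanarIsotopy s t) : Local a s t
  | isotopyInv {s t : List Letter} (h : PlanarIsotopy s t) : Local a t s

/-- An elementary cobordism from the diagram `D` to the diagram `E`: the part `s` of `D`, between
an upper part `u` and a lower part `v`, is changed to `t` by an elementary local change. -/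
structure Move {m n : ℕ} (D E : Tangle m n) : Type where
  {a b : ℕ}
  u : Tangle m a
  s : Tangle a b
  t : Tangle a b
  v : Tangle b n
  loc : Local a s.word t.word
  src : D = u.stack (s.stack v)
  tgt : E = u.stack (t.stack v)

instance (m n : ℕ) : Quiver (Tangle m n) := ⟨fun D E => Move D E⟩

/-- A dotted cobordism in `ℝ³` from `D` to `E` in general position with respect to time: a finite
sequence of elementary cobordisms. -/
abbrev Movie {m n : ℕ} (D E : Tangle m n) : Type := Quiver.Path D E

/-! ### The underlying surface of a cobordism -/

/-- A dotted surface between two `1`-manifolds with sets of points `X` and `Y`, decomposed into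
connected pieces.  The type of pieces is `V`, and pieces related by `adj` are adjacent.  `src x`
and `tgt y` are the pieces which contain the boundary points `x` and `y`.  A mark `(p, χ, d)`
says that `χ` is a contribution to the Euler characteristic (relative to the source `1`-manifold)
and that `d` dots are placed at the component of the piece `p`. -/
structure Surface (X Y : Type) where
  V : Type
  adj : V → V → Prop
  src : X → V
  tgt : Y → V
  marks : List (V × ℤ × ℕ)

namespace Surface

variable {X Y Z : Type}

/-- The adjacency of pieces in a union of surfaces along a common part of their boundaries. -/
inductive GlueAdj (S : Surface X Y) (T : Surface Y Z) : S.V ⊕ T.V → S.V ⊕ T.V → Prop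
  | left {p q : S.V} (h : S.adj p q) : GlueAdj S T (.inl p) (.inl q)
  | right {p q : T.V} (h : T.adj p q) : GlueAdj S T (.inr p) (.inr q)
  | glue (y : Y) : GlueAdj S T (.inl (S.tgt y)) (.inr (T.src y))

/-- The union of two surfaces along a common part of their boundaries.  The relative Euler
characteristic `χ(S) - χ(source)` is additive. -/
def glue (S : Surface X Y) (T : Surface Y Z) : Surface X Z where
  V := S.V ⊕ T.V
  adj := GlueAdj S T
  src x := .inl (S.src x)
  tgt z := .inr (T.tgt z)
  marks := S.marks.map (fun m => (.inl m.1, m.2)) ++ T.marks.map (fun m => (.inr m.1, m.2))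

/-- The connected components of a surface: the classes of the equivalence relation which is
generated by the adjacency of pieces. -/
def Component (S : Surface X Y) : Type := Quot S.adj

/-- The component of a piece. -/
def component (S : Surface X Y) (p : S.V) : S.Component := Quot.mk _ p

open scoped Classical in
/-- The Euler characteristic of a component, minus the Euler characteristic of the part of the
source `1`-manifold that it contains. -/
noncomputable def euler (S : Surface X Y) (c : S.Component) : ℤ :=
  (S.marks.map fun m => if S.component m.1 = c then m.2.1 else 0).sum

open scoped Classical in
/-- The number of dots on a component. -/
noncomputable def dots (S : Surface X Y) (c : S.Component) : ℕ :=
  (S.marks.map fun m => if S.component m.1 = c then m.2.2 else 0).sum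

/-- Two dotted surfaces with the same boundary are homeomorphic relative to their boundary.  By the
classification of compact orientable surfaces, this means that there is a bijection between their
components which is compatible with the inclusions of the boundary and preserves the Euler
characteristic and the number of dots of the components. -/
def Homeomorphic (S T : Surface X Y) : Prop :=
  ∃ φ : S.Component ≃ T.Component,
    (∀ x, φ (S.component (S.src x)) = T.component (T.src x)) ∧
    (∀ y, φ (S.component (S.tgt y)) = T.component (T.tgt y)) ∧
    (∀ c, T.euler (φ c) = S.euler c) ∧
    (∀ c, T.dots (φ c) = S.dots c)

end Surface

namespace Move

variable {m n : ℕ} {D E : Tangle m n}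

/-- A point of `D` and a point of `E` lie on the same vertical line of the trace of an elementary
cobordism outside of the place of the local change. -/
inductive Track (M : Move D E) : D.Point → E.Point → Prop
  | above (p : D.Point) (q : E.Point) (h : p.1.1 ≤ M.u.word.length) (hpq : q.1 = p.1) :
      Track M p q
  | below (p : D.Point) (q : E.Point) (k j : ℕ)
      (hp : p.1 = (M.u.word.length + M.s.word.length + k, j))
      (hq : q.1 = (M.u.word.length + M.t.word.length + k, j)) : Track M p q

/-- The adjacency of pieces in an elementary cobordism: strands of `D`, strands of `E`, and the
sheets between them. -/
inductive Adj (M : Move D E) : D.Point ⊕ E.Point → D.Point ⊕ E.Point → Prop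
  | src {p q : D.Point} (h : D.Adj p q) : Adj M (.inl p) (.inl q)
  | tgt {p q : E.Point} (h : E.Adj p q) : Adj M (.inr p) (.inr q)
  | sheet {p : D.Point} {q : E.Point} (h : M.Track p q) : Adj M (.inl p) (.inr q)

theorem width_src (M : Move D E) (k : ℕ) : widthAt m D.word (M.u.word.length + k) =
    widthAt M.a (M.s.word ++ M.v.word) k := by
  have h : D.word = M.u.word ++ (M.s.word ++ M.v.word) := congrArg Tangle.word M.src
  rw [h, widthAt_append M.u.isTangle]

theorem width_tgt (M : Move D E) (k : ℕ) : widthAt m E.word (M.u.word.length + k) =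
    widthAt M.a (M.t.word ++ M.v.word) k := by
  have h : E.word = M.u.word ++ (M.t.word ++ M.v.word) := congrArg Tangle.word M.tgt
  rw [h, widthAt_append M.u.isTangle]

/-- The point of `D` at the position `j` right above the place of the local change. -/
def srcTop (M : Move D E) (j : ℕ) (h : j < M.a) : D.Point :=
  ⟨(M.u.word.length, j), by
    have := M.width_src 0
    simp only [Nat.add_zero, widthAt] at this
    simpa only [this] using h⟩

/-- A point of `D` in the middle of the circle which is going to die. -/
def srcMid (M : Move D E) (i : ℕ) (h : i ≤ M.a) (hs : M.s.word = [.create i, .join i]) :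
    D.Point :=
  ⟨(M.u.word.length + 1, i), by
    have := M.width_src 1
    simp only [hs, List.cons_append, widthAt, Letter.next] at this
    simp only [this]; omega⟩

/-- A point of `E` in the middle of the circle which was born. -/
def tgtMid (M : Move D E) (i : ℕ) (h : i ≤ M.a) (ht : M.t.word = [.create i, .join i]) :
    E.Point :=
  ⟨(M.u.word.length + 1, i), by
    have := M.width_tgt 1
    simp only [ht, List.cons_append, widthAt, Letter.next] at this
    simp only [this]; omega⟩

/-- The contributions of an elementary cobordism to the relative Euler characteristic (`1` for the
disk of a birth or a death, `-1` for a saddle) and to the number of dots. -/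
def marksAux (M : Move D E) : ∀ {s t : List Letter}, Local M.a s t → M.s.word = s → M.t.word = t →
    List ((D.Point ⊕ E.Point) × ℤ × ℕ)
  | _, _, .birth i h, _, ht => [(.inr (M.tgtMid i h ht), 1, 0)]
  | _, _, .death i h, hs, _ => [(.inl (M.srcMid i h hs), 1, 0)]
  | _, _, .saddle i h, _, _ => [(.inl (M.srcTop i (by omega)), -1, 0)]
  | _, _, .saddleInv i h, _, _ => [(.inl (M.srcTop i (by omega)), -1, 0)]
  | _, _, .dot j h, _, _ => [(.inl (M.srcTop j h), 0, 1)]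
  | _, _, .isotopy _, _, _ => []
  | _, _, .isotopyInv _, _, _ => []

/-- The surface of an elementary cobordism. -/
def surface (M : Move D E) : Surface D.Point E.Point where
  V := D.Point ⊕ E.Point
  adj := M.Adj
  src := .inl
  tgt := .inr
  marks := M.marksAux M.loc rfl rfl

end Move

/-- The product of a diagram with an interval. -/
def Tangle.cylinder {m n : ℕ} (D : Tangle m n) : Surface D.Point D.Point where
  V := D.Point
  adj := D.Adj
  src := id
  tgt := id
  marks := []

/-- The surface of a cobordism. -/
def Movie.surface {m n : ℕ} {D : Tangle m n} :
    ∀ {E : Tangle m n}, Movie D E → Surface D.Point E.Point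
  | _, .nil => D.cylinder
  | _, .cons p M => (Movie.surface p).glue (Move.surface M)

/-- The topological degree of a cobordism `S : D → E` between Temperley-Lieb diagrams on `n`
strands, which is `χ(S) - n`, where each dot counts as `-2`.  (Note that `χ(D) = n`.) -/
def Movie.degree {m n : ℕ} {D E : Tangle m n} (p : Movie D E) : ℤ :=
  ((Movie.surface p).marks.map fun x => x.2.1 - 2 * (x.2.2 : ℤ)).sum

/-! ### Gluing of cobordisms with the product of a diagram with an interval -/

/-- Stacking a diagram `F`, times an interval, on top of an elementary cobordism. -/
def Move.whiskerLeft {k m n : ℕ} (F : Tangle k m) {D E : Tangle m n} (M : Move D E) :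
    Move (F.stack D) (F.stack E) where
  u := F.stack M.u
  s := M.s
  t := M.t
  v := M.v
  loc := M.loc
  src := by rw [Tangle.stack_assoc, ← M.src]
  tgt := by rw [Tangle.stack_assoc, ← M.tgt]

/-- Stacking a diagram `F`, times an interval, below an elementary cobordism. -/
def Move.whiskerRight {m n k : ℕ} {D E : Tangle m n} (M : Move D E) (F : Tangle n k) :
    Move (D.stack F) (E.stack F) where
  u := M.u
  s := M.s
  t := M.t
  v := M.v.stack F
  loc := M.loc
  src := by rw [← Tangle.stack_assoc M.s, ← Tangle.stack_assoc M.u, ← M.src]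
  tgt := by rw [← Tangle.stack_assoc M.t, ← Tangle.stack_assoc M.u, ← M.tgt]

/-! ### The category of cobordisms modulo the local relations -/

/-- The ground ring `ℤ[α]`. -/
abbrev Ground : Type := Polynomial ℤ

/-- The parameter `α`. -/
noncomputable abbrev α : Ground := Polynomial.X

/-- The category of diagrams and formal linear combinations of cobordisms. -/
abbrev Formal (m n : ℕ) : Type := Free Ground (Paths (Tangle m n))

/-- A diagram as an object of the category of formal linear combinations. -/
abbrev Formal.of {m n : ℕ} (D : Tangle m n) : Formal m n := D

/-- A multiple of a cobordism as a morphism in the category of formal linear combinations. -/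
noncomputable def formal {m n : ℕ} {D E : Tangle m n} (p : Movie D E) (r : Ground) :
    Formal.of D ⟶ Formal.of E := Finsupp.single p r

/-- Stacking `F` on top, on the category of formal linear combinations of cobordisms. -/
noncomputable def formalWhiskerLeft {k m : ℕ} (F : Tangle k m) (n : ℕ) :
    Formal m n ⥤ Formal k n :=
  Free.lift Ground (Paths.lift
    { obj := fun D : Tangle m n => Formal.of (F.stack D)
      map := fun M => formal (Quiver.Hom.toPath (Move.whiskerLeft F M)) 1 })

/-- Stacking `F` below, on the category of formal linear combinations of cobordisms. -/
noncomputable def formalWhiskerRight (m : ℕ) {n k : ℕ} (F : Tangle n k) :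
    Formal m n ⥤ Formal m k :=
  Free.lift Ground (Paths.lift
    { obj := fun D : Tangle m n => Formal.of (D.stack F)
      map := fun M => formal (Quiver.Hom.toPath (Move.whiskerRight M F)) 1 })

instance {k m : ℕ} (F : Tangle k m) (n : ℕ) : (formalWhiskerLeft F n).Additive :=
  inferInstanceAs (Free.lift Ground _).Additive

instance (m : ℕ) {n k : ℕ} (F : Tangle n k) : (formalWhiskerRight m F).Additive :=
  inferInstanceAs (Free.lift Ground _).Additive

section LocalMoves

variable {m n a : ℕ} (u : Tangle m a) (v : Tangle a n) (i : ℕ) (h : i ≤ a)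

/-- The birth of a small circle between `u` and `v`. -/
def birth : Movie (u.stack v) (u.stack ((Tangle.circle a i h).stack v)) :=
  Quiver.Hom.toPath (V := Tangle m n)
    { u := u, s := .one a, t := .circle a i h, v := v, loc := .birth i h, src := rfl, tgt := rfl }

/-- The death of a small circle between `u` and `v`. -/
def death : Movie (u.stack ((Tangle.circle a i h).stack v)) (u.stack v) :=
  Quiver.Hom.toPath (V := Tangle m n)
    { u := u, s := .circle a i h, t := .one a, v := v, loc := .death i h, src := rfl, tgt := rfl }

/-- The product of a diagram with an interval, with one dot over a small circle between `u` and
`v`. -/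
def dot : Movie (u.stack ((Tangle.circle a i h).stack v))
    (u.stack ((Tangle.circle a i h).stack v)) :=
  Quiver.Hom.toPath (V := Tangle m n)
    { u := u.stack (.createArc a i h), s := .one _, t := .one _, v := (Tangle.joinArc a i h).stack v
      loc := .dot i (by omega)
      src := Tangle.ext (by simp [Tangle.stack, Tangle.circle, Tangle.one])
      tgt := Tangle.ext (by simp [Tangle.stack, Tangle.circle, Tangle.one]) }

end LocalMoves

/-- The relations between linear combinations of cobordisms: the smallest equivalence relation
which is compatible with addition, composition and stacking and satisfies the following.
* `homeo`: Two cobordisms which are homeomorphic relative to their boundary are equal.  In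
  particular isotopic ones are.  Conversely, the neck relation, applied to compressing disks in the
  ball, writes every cobordism as a combination of unions of disks with at most one dot each, and
  these are determined up to isotopy by their boundaries and dots.  So modulo the other relations
  `homeo` identifies no more than isotopy does.
* `sphere`, `sphere_dot`, `sphere_dot_dot`, `sphere_dot_dot_dot`: A sphere with `0`, `1`, `2`, `3`
  dots is `0`, `1`, `0`, `α`.
* `neck`: A neck, i.e. the product of a circle with an interval, is cut into two disks, and the sum
  is taken over the two ways of putting a dot on one of them. -/
inductive Rel : ∀ {m n : ℕ} {D E : Formal m n}, (D ⟶ E) → (D ⟶ E) → Prop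
  | homeo {m n : ℕ} {D E : Tangle m n} (p q : Movie D E)
      (h : (Movie.surface p).Homeomorphic (Movie.surface q)) : Rel (formal p 1) (formal q 1)
  | sphere {m n a : ℕ} (u : Tangle m a) (v : Tangle a n) (i : ℕ) (h : i ≤ a) :
      Rel (formal ((birth u v i h).comp (death u v i h)) 1) 0
  | sphere_dot {m n a : ℕ} (u : Tangle m a) (v : Tangle a n) (i : ℕ) (h : i ≤ a) :
      Rel (formal (((birth u v i h).comp (dot u v i h)).comp (death u v i h)) 1) (formal .nil 1)
  | sphere_dot_dot {m n a : ℕ} (u : Tangle m a) (v : Tangle a n) (i : ℕ) (h : i ≤ a) :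
      Rel (formal ((((birth u v i h).comp (dot u v i h)).comp (dot u v i h)).comp
        (death u v i h)) 1) 0
  | sphere_dot_dot_dot {m n a : ℕ} (u : Tangle m a) (v : Tangle a n) (i : ℕ) (h : i ≤ a) :
      Rel (formal (((((birth u v i h).comp (dot u v i h)).comp (dot u v i h)).comp
        (dot u v i h)).comp (death u v i h)) 1) (formal .nil α)
  | neck {m n a : ℕ} (u : Tangle m a) (v : Tangle a n) (i : ℕ) (h : i ≤ a) :
      Rel (formal .nil 1)
        (formal (((dot u v i h).comp (death u v i h)).comp (birth u v i h)) 1 +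
          formal (((death u v i h).comp (birth u v i h)).comp (dot u v i h)) 1)
  | refl {m n : ℕ} {D E : Formal m n} (f : D ⟶ E) : Rel f f
  | symm {m n : ℕ} {D E : Formal m n} {f g : D ⟶ E} : Rel f g → Rel g f
  | trans {m n : ℕ} {D E : Formal m n} {f g h : D ⟶ E} : Rel f g → Rel g h → Rel f h
  | add {m n : ℕ} {D E : Formal m n} {f f' g g' : D ⟶ E} :
      Rel f f' → Rel g g' → Rel (f + g) (f' + g')
  | smul {m n : ℕ} {D E : Formal m n} (r : Ground) {f g : D ⟶ E} : Rel f g → Rel (r • f) (r • g)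
  | comp {m n : ℕ} {D E F : Formal m n} {f f' : D ⟶ E} {g g' : E ⟶ F} :
      Rel f f' → Rel g g' → Rel (f ≫ g) (f' ≫ g')
  | whiskerLeft {k m n : ℕ} (F : Tangle k m) {D E : Formal m n} {f g : D ⟶ E} :
      Rel f g → Rel ((formalWhiskerLeft F n).map f) ((formalWhiskerLeft F n).map g)
  | whiskerRight {m n k : ℕ} (F : Tangle n k) {D E : Formal m n} {f g : D ⟶ E} :
      Rel f g → Rel ((formalWhiskerRight m F).map f) ((formalWhiskerRight m F).map g)

/-- The relations, as a relation on the morphisms of a category. -/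
def rel (m n : ℕ) : HomRel (Formal m n) := fun _ _ f g => Rel f g

instance (m n : ℕ) : Congruence (rel m n) where
  equivalence := ⟨Rel.refl, Rel.symm, Rel.trans⟩
  comp_left _ _ _ h := Rel.comp (Rel.refl _) h
  comp_right _ h := Rel.comp h (Rel.refl _)

/-- The category of diagrams without `q`-grading and of dotted cobordisms modulo the local
relations. -/
abbrev UngradedCob (m n : ℕ) : Type := Quotient (rel m n)

noncomputable instance (m n : ℕ) : Preadditive (UngradedCob m n) :=
  CategoryTheory.Quotient.preadditive _ fun _ _ _ _ _ _ h h' => Rel.add h h'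

instance (m n : ℕ) : (Quotient.functor (rel m n)).Additive := ⟨rfl⟩

/-- Stacking `F` on top, on cobordisms modulo the local relations. -/
noncomputable def ungradedWhiskerLeft {k m : ℕ} (F : Tangle k m) (n : ℕ) :
    UngradedCob m n ⥤ UngradedCob k n :=
  CategoryTheory.Quotient.lift _ (formalWhiskerLeft F n ⋙ Quotient.functor (rel k n))
    fun _ _ _ _ h => CategoryTheory.Quotient.sound _ (Rel.whiskerLeft F h)

/-- Stacking `F` below, on cobordisms modulo the local relations. -/
noncomputable def ungradedWhiskerRight (m : ℕ) {n k : ℕ} (F : Tangle n k) :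
    UngradedCob m n ⥤ UngradedCob m k :=
  CategoryTheory.Quotient.lift _ (formalWhiskerRight m F ⋙ Quotient.functor (rel m k))
    fun _ _ _ _ h => CategoryTheory.Quotient.sound _ (Rel.whiskerRight F h)

instance {k m : ℕ} (F : Tangle k m) (n : ℕ) : (ungradedWhiskerLeft F n).Additive where
  map_add {X Y f g} := by
    obtain ⟨f, rfl⟩ := (Quotient.functor (rel m n)).map_surjective f
    obtain ⟨g, rfl⟩ := (Quotient.functor (rel m n)).map_surjective g
    rw [← Functor.map_add]
    exact (formalWhiskerLeft F n ⋙ Quotient.functor (rel k n)).map_add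

instance (m : ℕ) {n k : ℕ} (F : Tangle n k) : (ungradedWhiskerRight m F).Additive where
  map_add {X Y f g} := by
    obtain ⟨f, rfl⟩ := (Quotient.functor (rel m n)).map_surjective f
    obtain ⟨g, rfl⟩ := (Quotient.functor (rel m n)).map_surjective g
    rw [← Functor.map_add]
    exact (formalWhiskerRight m F ⋙ Quotient.functor (rel m k)).map_add

/-! ### Bar-Natan's category with `q`-grading -/

/-- A formally `q`-graded Temperley-Lieb diagram `q ^ shift · diagram` on `n` strands. -/
structure GradedDiagram (n : ℕ) : Type where
  shift : ℤ
  diagram : Tangle n n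

/-- Bar-Natan's category `Cob(n)`: the objects are the formally `q`-graded Temperley-Lieb diagrams
on `n` strands, and the morphisms from `q ^ i D` to `q ^ j E` are the `ℤ[α]`-linear combinations of
dotted cobordisms (of all degrees) from `D` to `E`, modulo the local relations. -/
abbrev Cob (n : ℕ) : Type :=
  InducedCategory (UngradedCob n n)
    fun X : GradedDiagram n => (Quotient.functor (rel n n)).obj X.diagram

namespace Cob

variable {n : ℕ}

/-- The diagram `q ^ i D` as an object of `Cob(n)`. -/
def of (i : ℤ) (D : Tangle n n) : Cob n := (⟨i, D⟩ : GradedDiagram n)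

/-- The exponent `i` of an object `q ^ i D`. -/
def shift (X : Cob n) : ℤ := GradedDiagram.shift X

/-- The diagram `D` of an object `q ^ i D`. -/
def diagram (X : Cob n) : Tangle n n := GradedDiagram.diagram X

/-- A multiple of a cobordism as a morphism of `Cob(n)`. -/
noncomputable def ofMovie {X Y : Cob n} (p : Movie X.diagram Y.diagram) (r : Ground) : X ⟶ Y :=
  InducedCategory.homMk ((Quotient.functor (rel n n)).map (formal p r))

/-- A morphism of `Cob(n)` from `q ^ i D` to `q ^ j E` is homogeneous of degree `d` if it is a sum
of multiples `c α ^ k S`, `c ∈ ℤ`, of cobordisms `S` with `deg_t(S) + (j - i) - 4 k = d`.  Here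
the degree of `α` is `-4`, which is the topological degree of a sphere with three dots. -/
def IsHomogeneous {X Y : Cob n} (d : ℤ) (f : X ⟶ Y) : Prop :=
  f ∈ AddSubgroup.closure {g : X ⟶ Y | ∃ (p : Movie X.diagram Y.diagram) (k : ℕ),
    p.degree + (Y.shift - X.shift) - 4 * (k : ℤ) = d ∧ g = ofMovie p (α ^ k)}

/-- The functor `D ⊗ -` on `Cob(n)`: gluing with the diagram `D` on the top. -/
noncomputable def tensorLeft (D : Tangle n n) : Cob n ⥤ Cob n where
  obj X := of X.shift (D.stack X.diagram)
  map f := InducedCategory.homMk ((ungradedWhiskerLeft D n).map f.hom)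
  map_id _ := InducedCategory.hom_ext ((ungradedWhiskerLeft D n).map_id _)
  map_comp f g := InducedCategory.hom_ext ((ungradedWhiskerLeft D n).map_comp f.hom g.hom)

/-- The functor `- ⊗ D` on `Cob(n)`: gluing with the diagram `D` on the bottom. -/
noncomputable def tensorRight (D : Tangle n n) : Cob n ⥤ Cob n where
  obj X := of X.shift (X.diagram.stack D)
  map f := InducedCategory.homMk ((ungradedWhiskerRight n D).map f.hom)
  map_id _ := InducedCategory.hom_ext ((ungradedWhiskerRight n D).map_id _)
  map_comp f g := InducedCategory.hom_ext ((ungradedWhiskerRight n D).map_comp f.hom g.hom)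

instance (D : Tangle n n) : (tensorLeft D).Additive where
  map_add := InducedCategory.hom_ext (ungradedWhiskerLeft D n).map_add

instance (D : Tangle n n) : (tensorRight D).Additive where
  map_add := InducedCategory.hom_ext (ungradedWhiskerRight n D).map_add

end Cob

instance {C D : Type} [Category.{0} C] [Preadditive C] [Category.{0} D] [Preadditive D]
    (F : C ⥤ D) [F.Additive] : F.mapMat_.Additive where
  map_add := Mat_.hom_ext _ _ fun _ _ => F.map_add

/-! ### Chain complexes and universal projectors -/

/-- The category `Kom(n)` of chain complexes of finite direct sums of objects of `Cob(n)` which are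
bounded below.  The differential raises the homological degree by one. -/
abbrev Kom (n : ℕ) : Type 1 := CochainComplex.Plus (Mat_ (Cob n))

instance (n : ℕ) : Limits.HasBinaryBiproducts (Mat_ (Cob n)) :=
  Limits.hasBinaryBiproducts_of_finite_biproducts _

/-- A matrix of morphisms of degree zero. -/
def IsDegreeZero {n : ℕ} {A B : Mat_ (Cob n)} (f : A ⟶ B) : Prop :=
  ∀ (i : A.ι) (j : B.ι), Cob.IsHomogeneous 0 (f i j)

/-- The identity diagram `q ^ 0 1` as an object of `Mat(Cob(n))`. -/
noncomputable def identityDiagram (n : ℕ) : Mat_ (Cob n) := (Mat_.embedding (Cob n)).obj (Cob.of 0 (.one n))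

namespace Kom

variable {n : ℕ}

/-- The complex `D ⊗ P`, where the diagram `D` is placed in homological degree zero. -/
noncomputable def tensorLeft (D : Tangle n n) (P : Kom n) : CochainComplex (Mat_ (Cob n)) ℤ :=
  ((Cob.tensorLeft D).mapMat_.mapHomologicalComplex _).obj P.obj

/-- The complex `P ⊗ D`, where the diagram `D` is placed in homological degree zero. -/
noncomputable def tensorRight (P : Kom n) (D : Tangle n n) : CochainComplex (Mat_ (Cob n)) ℤ :=
  ((Cob.tensorRight D).mapMat_.mapHomologicalComplex _).obj P.obj

end Kom

/-- A complex is contractible if it is homotopy equivalent to the zero complex. -/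
def IsContractible {n : ℕ} (K : CochainComplex (Mat_ (Cob n)) ℤ) : Prop :=
  Nonempty (HomotopyEquiv K 0)

/-- Universal projectors on `n` strands. -/
structure IsUniversalProjector {n : ℕ} (P : Kom n) : Prop where
  /-- `P_k = 0` for `k < 0`. -/
  isZero : ∀ k : ℤ, k < 0 → Limits.IsZero (P.obj.X k)
  /-- All summands of `P_k` are of the form `q ^ i D` with `i ≥ 0`, for `k > 0`. -/
  shift_nonneg : ∀ k : ℤ, 0 < k → ∀ j : (P.obj.X k).ι, 0 ≤ ((P.obj.X k).X j).shift
  /-- The differential consists of maps of degree zero. -/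
  d_degree : ∀ k : ℤ, IsDegreeZero (P.obj.d k (k + 1))
  /-- `P_0` is isomorphic to the identity diagram, by an isomorphism of degree zero. -/
  zero_iso : ∃ φ : P.obj.X 0 ≅ identityDiagram n, IsDegreeZero φ.hom ∧ IsDegreeZero φ.inv
  /-- The identity diagram, with any `q`-grading, is not a direct summand of `P_k` for `k > 0`.
  (The isomorphism is not required to be of degree zero.) -/
  not_iso : ∀ k : ℤ, 0 < k → ∀ D : Mat_ (Cob n), IsEmpty (P.obj.X k ≅ identityDiagram n ⊞ D)
  /-- `P ⊗ e_i` is contractible. -/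
  turnback_right : ∀ (i : ℕ) (h₀ : 0 < i) (h : i < n),
    IsContractible (P.tensorRight (.turnback n i h₀ h))
  /-- `e_i ⊗ P` is contractible. -/
  turnback_left : ∀ (i : ℕ) (h₀ : 0 < i) (h : i < n),
    IsContractible (P.tensorLeft (.turnback n i h₀ h))

end BarNatan

/-!
The projector is the Amitsur complex of the algebra `T = ⊕ q e_i`.  The diagram `e_i` is an algebra
for vertical stacking: its unit `1 ⟶ q e_i` is a saddle (of degree zero because of the shift by
`q`), and its multiplication `e_i e_i ⟶ e_i` is the death of the circle in the middle.  With
`η : 1 ⟶ T`, the direct sum of the units, put `P_k = T ^ k` and let `d_k : T ^ k ⟶ T ^ (k + 1)` be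
the alternating sum of the maps that insert `η` in one of the `k + 1` possible places; recursively,
`d_0 = η` and `d_(k + 1) = η ⊗ 1 - 1 ⊗ d_k`.

* Only a *unit* `η : 1 ⟶ T ⊗ -`, natural in the diagram, is needed to define the complex
  (`Pointing.iterComplex`).  Naturality says that distant elementary cobordisms commute
  (`homeomorphic_interchange`).
* `e_i ⊗ P` is contractible since the multiplication of `e_i` is a natural retraction of the unit
  `e_i ⊗ - ⟶ e_i ⊗ T ⊗ -` (`Pointing.nonempty_homotopyEquiv_zero_of_retraction`), and `P ⊗ e_i` is
  contractible since `T ⊗ -` commutes with `- ⊗ e_i` and the unit `e_i ⟶ T ⊗ e_i` has a retraction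
  (`Pointing.nonempty_homotopyEquiv_zero_of_commute`).  Both of these are the unit laws of `e_i`: a
  saddle followed by the death of the circle that it creates is isotopic to the identity
  (`homeomorphic_saddleAbove_mergeMove`, `homeomorphic_saddleBelow_mergeMove`).
* For `k > 0` every summand of `T ^ k` has a turnback on the top.  If the identity diagram were a
  summand of `T ^ k`, the identity cobordism would be a sum of cobordisms that factor through such
  diagrams.  That this is impossible (`sum_comp_ne_id`) is seen from an invariant.  At `α = 1` the
  Frobenius algebra `ℤ[x] / (x ^ 2 - α)` behind the local relations becomes, over a field in which
  `2` is invertible, a product of two copies of the field.  So the value of a surface is a sum over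
  the colorings of its components by two colors, in which a component with Euler characteristic
  `χ` and `d` dots contributes `(1 / 2) ^ (χ / 2)` or `(- 1 / 2) ^ (χ / 2) * (- 1) ^ d`.  The field
  with `17` elements has square roots of `1 / 2` and `- 1 / 2`, so that `χ` may be replaced by
  the relative Euler characteristic, which is additive under gluing.  The resulting state sums
  satisfy the local relations (`Rel.formalStateMatrix_eq`).  If neighboring strands of the identity
  diagram have different colors, there is no compatible coloring of a diagram with a turnback on the
  top, whereas the state sum of the identity is `1`.
-/

namespace BarNatan

open CategoryTheory
open scoped CategoryTheory.Limits ZeroObject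

/-! ### The complex of iterates of a pointed endofunctor -/

section Iterates

universe v u v' u'

variable {C : Type u} [Category.{v} C] [Preadditive C]

theorem nonempty_homotopyEquiv_zero [Limits.HasZeroObject C] {K : CochainComplex C ℤ}
    (h : ∀ k : ℤ, K.X (k + 1) ⟶ K.X k)
    (H : ∀ k : ℤ, K.d (k + 1) (k + 1 + 1) ≫ h (k + 1) + h k ≫ K.d k (k + 1) = 𝟙 _) :
    Nonempty (HomotopyEquiv K 0) := by
  have ho : Homotopy (𝟙 K) 0 :=
    { hom := fun i j => if e : j + 1 = i then eqToHom (by rw [e]) ≫ h j else 0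
      zero := fun i j hij => dif_neg hij
      comm := fun i => by
        obtain ⟨k, rfl⟩ : ∃ k, i = k + 1 := ⟨i - 1, by ring⟩
        rw [dNext_eq _ (show (ComplexShape.up ℤ).Rel (k + 1) (k + 1 + 1) from rfl),
          prevD_eq _ (show (ComplexShape.up ℤ).Rel k (k + 1) from rfl)]
        simp [H] }
  exact ⟨{
    hom := 0
    inv := 0
    homotopyHomInvId := (Homotopy.ofEq (by simp)).trans ho.symm
    homotopyInvHomId := Homotopy.ofEq ((Limits.isZero_zero _).eq_of_src _ _) }⟩

/-- A unit for an endofunctor `T`: a natural transformation from the identity to `T`. -/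
structure Pointing (T : C ⥤ C) where
  app (X : C) : X ⟶ T.obj X
  naturality {X Y : C} (f : X ⟶ Y) : f ≫ app Y = app X ≫ T.map f

variable {T : C ⥤ C} (η : Pointing T)

/-- The differential of the complex of iterates of `T` that follows `d`. -/
def Pointing.next {Y : C} (d : Y ⟶ T.obj Y) : T.obj Y ⟶ T.obj (T.obj Y) :=
  η.app (T.obj Y) - T.map d

theorem Pointing.app_comp_next (Y : C) : η.app Y ≫ η.next (η.app Y) = 0 := by
  rw [next, Preadditive.comp_sub, η.naturality, sub_self]

theorem Pointing.next_comp_next [T.Additive] {Y : C} {d : Y ⟶ T.obj Y} (h : d ≫ η.next d = 0) :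
    η.next d ≫ η.next (η.next d) = 0 := by
  have e : η.next (η.next d) = η.app _ - T.map (η.next d) := rfl
  have e' : η.app (T.obj Y) - η.next d = T.map d := sub_sub_cancel _ _
  rw [e, Preadditive.comp_sub, η.naturality, ← Preadditive.sub_comp, e', ← T.map_comp, h,
    T.map_zero]

variable (X : C)

variable (T) in
/-- The iterates `X`, `T X`, `T (T X)`, … of an endofunctor. -/
def iterObj : ℕ → C
  | 0 => X
  | k + 1 => T.obj (iterObj k)

/-- The alternating sum of the maps `T ^ k X ⟶ T ^ (k + 1) X` which insert the unit into one of
the `k + 1` possible places. -/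
def Pointing.iterD : ∀ k : ℕ, iterObj T X k ⟶ T.obj (iterObj T X k)
  | 0 => η.app X
  | k + 1 => η.next (iterD k)

theorem Pointing.iterD_comp [T.Additive] : ∀ k : ℕ, η.iterD X k ≫ η.iterD X (k + 1) = 0
  | 0 => η.app_comp_next X
  | k + 1 => η.next_comp_next (iterD_comp k)

variable [Limits.HasZeroObject C]

variable (T) in
/-- The iterates of `T`, extended by zero to negative degrees. -/
noncomputable def iterX : ℤ → C
  | .ofNat k => iterObj T X k
  | .negSucc _ => 0

/-- The differential of the complex of iterates in all degrees. -/
noncomputable def Pointing.iterDiff : ∀ k : ℤ, iterX T X k ⟶ iterX T X (k + 1)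
  | .ofNat k => η.iterD X k
  | .negSucc _ => 0

/-- The complex `X ⟶ T X ⟶ T (T X) ⟶ …` with `X` in degree `0`.  If `T = A ⊗ -` for an algebra `A`
with unit `η`, this is the Amitsur complex. -/
noncomputable def Pointing.iterComplex [T.Additive] : CochainComplex C ℤ :=
  CochainComplex.of (iterX T X) (η.iterDiff X) fun k => by
    match k with
    | .ofNat k => exact η.iterD_comp X k
    | .negSucc _ => exact Limits.zero_comp

theorem Pointing.iterComplex_d [T.Additive] (k : ℤ) :
    (η.iterComplex X).d k (k + 1) = η.iterDiff X k :=
  CochainComplex.of_d (iterX T X) (η.iterDiff X) k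

variable {D : Type u'} [Category.{v'} D] [Preadditive D] [Limits.HasZeroObject D]

/-- The image of the complex of iterates under `G` is contractible if there are homotopies `h`
between the identity and zero in non-negative degrees. -/
theorem Pointing.nonempty_homotopyEquiv_zero [T.Additive] (G : C ⥤ D) [G.Additive]
    (h : ∀ k : ℕ, G.obj (T.obj (iterObj T X k)) ⟶ G.obj (iterObj T X k))
    (H₀ : G.map (η.iterD X 0) ≫ h 0 = 𝟙 _)
    (H : ∀ k, (G.map (η.iterD X (k + 1)) ≫ h (k + 1) :
      G.obj (T.obj (iterObj T X k)) ⟶ G.obj (T.obj (iterObj T X k))) +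
        h k ≫ G.map (η.iterD X k) = 𝟙 _) :
    Nonempty (HomotopyEquiv
      ((G.mapHomologicalComplex _).obj (η.iterComplex X)) 0) := by
  refine BarNatan.nonempty_homotopyEquiv_zero (fun k => match k with
    | .ofNat k => h k
    | .negSucc k => 0) fun k => ?_
  rw [Functor.mapHomologicalComplex_obj_d, Functor.mapHomologicalComplex_obj_d,
    iterComplex_d, iterComplex_d]
  match k with
  | .ofNat k => exact H k
  | .negSucc 0 =>
    refine Eq.trans ?_ H₀
    refine (congrArg₂ _ rfl ?_).trans (add_zero _)
    exact Limits.zero_comp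
  | .negSucc (k + 1) =>
    exact (G.map_isZero (Limits.isZero_zero C)).eq_of_src _ _

/-- If `G η : G ⟶ T ⋙ G` has a natural retraction, the homotopies are its components. -/
theorem Pointing.nonempty_homotopyEquiv_zero_of_retraction [T.Additive] (G : C ⥤ D) [G.Additive]
    (μ : ∀ Y, G.obj (T.obj Y) ⟶ G.obj Y)
    (μ_nat : ∀ {Y Z : C} (f : Y ⟶ Z), G.map (T.map f) ≫ μ Z = μ Y ≫ G.map f)
    (hμ : ∀ Y, G.map (η.app Y) ≫ μ Y = 𝟙 _) :
    Nonempty (HomotopyEquiv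
      ((G.mapHomologicalComplex _).obj (η.iterComplex X)) 0) := by
  refine η.nonempty_homotopyEquiv_zero X G (fun k => μ (iterObj T X k)) (hμ _) fun k => ?_
  have key : ∀ {Y : C} (d : Y ⟶ T.obj Y),
      G.map (η.next d) ≫ μ (T.obj Y) + μ Y ≫ G.map d = 𝟙 _ := fun d => by
    rw [next, G.map_sub, Preadditive.sub_comp, hμ, μ_nat, sub_add_cancel]
  exact key _

/-- If `G` commutes with `T` and `η`, then `G (T ^ k X) ≅ T ^ k (G X)`.  If moreover the unit
`G X ⟶ T (G X)` has a retraction, its images under the powers of `T`, with alternating signs, are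
the homotopies. -/
theorem Pointing.nonempty_homotopyEquiv_zero_of_commute [T.Additive] (G : C ⥤ C) [G.Additive]
    (γ : ∀ Y, G.obj (T.obj Y) ≅ T.obj (G.obj Y))
    (γ_nat : ∀ {Y Z : C} (f : Y ⟶ Z),
      G.map (T.map f) ≫ (γ Z).hom = (γ Y).hom ≫ T.map (G.map f))
    (hγ : ∀ Y, G.map (η.app Y) ≫ (γ Y).hom = η.app (G.obj Y))
    (a : T.obj (G.obj X) ⟶ G.obj X) (ha : η.app (G.obj X) ≫ a = 𝟙 _) :
    Nonempty (HomotopyEquiv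
      ((G.mapHomologicalComplex _).obj (η.iterComplex X)) 0) := by
  -- `next' h` is `- T h`, up to the isomorphisms `γ`.
  let next' : ∀ {Y : C}, (G.obj (T.obj Y) ⟶ G.obj Y) →
      (G.obj (T.obj (T.obj Y)) ⟶ G.obj (T.obj Y)) :=
    fun {Y} h => - ((γ (T.obj Y)).hom ≫ T.map h ≫ (γ Y).inv)
  have key : ∀ {Y : C} (d : Y ⟶ T.obj Y) (h : G.obj (T.obj Y) ⟶ G.obj Y),
      G.map (η.next d) ≫ next' h =
        (γ Y).hom ≫ T.map (G.map d ≫ h) ≫ (γ Y).inv - h ≫ G.map (η.app Y) := fun {Y} d h => by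
    have e : G.map (η.app Y) = η.app (G.obj Y) ≫ (γ Y).inv := by
      rw [← hγ, Category.assoc, Iso.hom_inv_id, Category.comp_id]
    have e₁ : G.map (η.app (T.obj Y)) ≫ next' h = - (h ≫ G.map (η.app Y)) := by
      rw [Preadditive.comp_neg, reassoc_of% hγ, e, ← reassoc_of% η.naturality]
    have e₂ : G.map (T.map d) ≫ next' h =
        - ((γ Y).hom ≫ T.map (G.map d ≫ h) ≫ (γ Y).inv) := by
      rw [Preadditive.comp_neg, reassoc_of% γ_nat, T.map_comp, Category.assoc]
    rw [next, G.map_sub, Preadditive.sub_comp, e₁, e₂]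
    abel
  have start : ∀ (h : G.obj (T.obj X) ⟶ G.obj X), G.map (η.app X) ≫ h = 𝟙 _ →
      G.map (η.next (η.app X)) ≫ next' h + h ≫ G.map (η.app X) = 𝟙 _ := fun h hh => by
    rw [key, hh, T.map_id, Category.id_comp, Iso.hom_inv_id, sub_add_cancel]
  have step : ∀ {Y : C} (d : Y ⟶ T.obj Y) (h : G.obj (T.obj Y) ⟶ G.obj Y),
      G.map (η.next d) ≫ next' h + h ≫ G.map d = 𝟙 _ →
      G.map (η.next (η.next d)) ≫ next' (next' h) + next' h ≫ G.map (η.next d) = 𝟙 _ :=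
    fun {Y} d h hh => by
      have e : T.map (G.map d) ≫ (γ (T.obj Y)).inv = (γ Y).inv ≫ G.map (T.map d) := by
        rw [Iso.comp_inv_eq, Category.assoc, γ_nat, Iso.inv_hom_id_assoc]
      have e₁ : (γ (T.obj Y)).hom ≫ T.map (h ≫ G.map d) ≫ (γ (T.obj Y)).inv =
          - (next' h ≫ G.map (T.map d)) := by
        rw [T.map_comp, Category.assoc, e, Preadditive.neg_comp, neg_neg, Category.assoc,
          Category.assoc]
      rw [key, eq_sub_of_add_eq hh, T.map_sub, T.map_id, Preadditive.sub_comp,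
        Preadditive.comp_sub, Category.id_comp, Iso.hom_inv_id, e₁,
        show G.map (η.next d) = _ - _ from G.map_sub, Preadditive.comp_sub]
      abel
  let h : ∀ k : ℕ, G.obj (T.obj (iterObj T X k)) ⟶ G.obj (iterObj T X k) := fun k =>
    Nat.rec ((γ X).hom ≫ a) (fun _ hk => next' hk) k
  have h₀ : G.map (η.app X) ≫ (γ X).hom ≫ a = 𝟙 _ := by
    rw [reassoc_of% hγ X, ha]
  refine η.nonempty_homotopyEquiv_zero X G h h₀ fun k => ?_
  induction k with
  | zero => exact start _ h₀
  | succ k ih => exact step _ _ ih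

end Iterates

/-! ### Colorings of diagrams and of elementary cobordisms -/

theorem widthAt_append_left (a : ℕ) (u w : List Letter) (t : ℕ) (h : t ≤ u.length) :
    widthAt a (u ++ w) t = widthAt a u t := by
  induction u generalizing a t with
  | nil =>
    obtain rfl : t = 0 := by simpa using h
    simp [widthAt]
  | cons l u ih =>
    cases t with
    | zero => simp [widthAt]
    | succ t => exact ih _ _ (by simpa using h)

theorem widthAt_of_length_lt (a : ℕ) (u : List Letter) (t : ℕ) (h : u.length < t) :
    widthAt a u t = 0 := by
  induction u generalizing a t with
  | nil =>
    cases t with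
    | zero => simp at h
    | succ t => rfl
  | cons l u ih =>
    cases t with
    | zero => simp at h
    | succ t => exact ih _ _ (by simpa using h)

theorem IsTangle.widthAt_length {a b : ℕ} {u : List Letter} (hu : IsTangle a u b) :
    widthAt a u u.length = b := by
  have := widthAt_append hu [] 0
  simpa [widthAt] using this

theorem Letter.Adj.level {l : Letter} {t : ℕ} {p q : ℕ × ℕ} (h : l.Adj t p q) :
    t ≤ p.1 ∧ p.1 ≤ t + 1 ∧ t ≤ q.1 ∧ q.1 ≤ t + 1 := by
  cases h <;> simp

theorem Letter.adj_add {l : Letter} {s t i j i' j' : ℕ} :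
    l.Adj (s + t) (s + i, j) (s + i', j') ↔ l.Adj t (i, j) (i', j') := by
  constructor
  · intro h
    generalize hr : s + t = r at h
    generalize hp : (s + i, j) = p at h
    generalize hq : (s + i', j') = q at h
    cases h <;> simp only [Prod.mk.injEq] at hp hq <;> obtain ⟨hi, rfl⟩ := hp <;>
      obtain ⟨hi', rfl⟩ := hq <;> subst hr <;>
      simp only [Nat.add_assoc, Nat.add_left_cancel_iff] at hi hi' <;> subst hi hi' <;>
      constructor <;> assumption
  · intro h
    cases h <;> constructor <;> assumption

namespace Tangle

variable {a b c : ℕ}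

theorem Point.ext {D : Tangle a b} {p q : D.Point} (h : p.1 = q.1) : p = q := Subtype.ext h

theorem Point.level_le {D : Tangle a b} (p : D.Point) : p.1.1 ≤ D.word.length := by
  by_contra h
  have := p.2
  rw [widthAt_of_length_lt _ _ _ (not_le.1 h)] at this
  exact absurd this (Nat.not_lt_zero _)

instance (D : Tangle a b) : Finite D.Point := by
  let f : (Σ t : Fin (D.word.length + 1), Fin (widthAt a D.word t)) → D.Point :=
    fun p => ⟨(p.1, p.2), p.2.2⟩
  exact Finite.of_surjective f fun p =>
    ⟨⟨⟨p.1.1, Nat.lt_succ_of_le p.level_le⟩, ⟨p.1.2, p.2⟩⟩, rfl⟩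

/-- The end points on the top of a diagram. -/
def top (D : Tangle a b) (j : ℕ) (h : j < a) : D.Point := ⟨(0, j), by simpa [widthAt] using h⟩

/-- The end points on the bottom of a diagram. -/
def bot (D : Tangle a b) (j : ℕ) (h : j < b) : D.Point :=
  ⟨(D.word.length, j), by simpa only [D.isTangle.widthAt_length] using h⟩

variable (D : Tangle a b) (E : Tangle b c)

theorem length_stack : (D.stack E).word.length = D.word.length + E.word.length :=
  List.length_append

/-- The points of the upper part of a diagram. -/
def inl (p : D.Point) : (D.stack E).Point :=
  ⟨p.1, by
    have := p.2
    rwa [← widthAt_append_left a D.word E.word _ p.level_le] at this⟩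

/-- The points of the lower part of a diagram. -/
def inr (p : E.Point) : (D.stack E).Point :=
  ⟨(D.word.length + p.1.1, p.1.2), by
    have := p.2
    rwa [← widthAt_append D.isTangle] at this⟩

/-- A point of `D.stack E` which is not below `D`, as a point of `D`. -/
def toLeft (p : (D.stack E).Point) (h : p.1.1 ≤ D.word.length) : D.Point :=
  ⟨p.1, by
    have := p.2
    exact this.trans_eq (widthAt_append_left a D.word E.word _ h)⟩

/-- A point of `D.stack E` which is not above `E`, as a point of `E`. -/
def toRight (p : (D.stack E).Point) (h : D.word.length ≤ p.1.1) : E.Point :=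
  ⟨(p.1.1 - D.word.length, p.1.2), by
    have := p.2
    obtain ⟨t, ht⟩ := Nat.exists_eq_add_of_le h
    rw [ht, Nat.add_sub_cancel_left]
    rw [ht] at this
    exact this.trans_eq (widthAt_append D.isTangle _ _)⟩

theorem inr_toRight (p : (D.stack E).Point) (h : D.word.length ≤ p.1.1) :
    D.inr E (D.toRight E p h) = p :=
  Point.ext (Prod.ext (Nat.add_sub_of_le h) rfl)

theorem adj_inl {p q : D.Point} (h : D.Adj p q) : (D.stack E).Adj (D.inl E p) (D.inl E q) := by
  obtain ⟨t, l, hl, h⟩ := h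
  refine ⟨t, l, ?_, h⟩
  have ht : t < D.word.length := (List.getElem?_eq_some_iff.1 hl).1
  change (D.word ++ E.word)[t]? = _
  rw [List.getElem?_append_left ht, hl]

theorem adj_inr {p q : E.Point} (h : E.Adj p q) : (D.stack E).Adj (D.inr E p) (D.inr E q) := by
  obtain ⟨t, l, hl, h⟩ := h
  refine ⟨D.word.length + t, l, ?_, Letter.adj_add.2 h⟩
  change (D.word ++ E.word)[_]? = _
  rw [List.getElem?_append_right (Nat.le_add_right _ _), Nat.add_sub_cancel_left, hl]

/-- Every arc of `D.stack E` is an arc of `D` or an arc of `E`. -/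
theorem adj_stack {p q : (D.stack E).Point} (h : (D.stack E).Adj p q) :
    (∃ p' q', D.Adj p' q' ∧ D.inl E p' = p ∧ D.inl E q' = q) ∨
      ∃ p' q', E.Adj p' q' ∧ D.inr E p' = p ∧ D.inr E q' = q := by
  obtain ⟨t, l, hl, h⟩ := h
  have hlev := h.level
  change (D.word ++ E.word)[t]? = _ at hl
  rcases lt_or_ge t D.word.length with ht | ht
  · rw [List.getElem?_append_left ht] at hl
    exact .inl ⟨D.toLeft E p (by omega), D.toLeft E q (by omega), ⟨t, l, hl, h⟩, rfl, rfl⟩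
  · rw [List.getElem?_append_right ht] at hl
    obtain ⟨s, rfl⟩ := Nat.exists_eq_add_of_le ht
    rw [Nat.add_sub_cancel_left] at hl
    obtain ⟨p', rfl⟩ : ∃ p', D.inr E p' = p := ⟨_, D.inr_toRight E p (by omega)⟩
    obtain ⟨q', rfl⟩ : ∃ q', D.inr E q' = q := ⟨_, D.inr_toRight E q (by omega)⟩
    exact .inr ⟨p', q', ⟨s, l, hl, Letter.adj_add.1 h⟩, rfl, rfl⟩

variable {K : Type*}

/-- A coloring of a diagram: a function on its points which is constant on its connected
components. -/
def IsColoring {a b : ℕ} (D : Tangle a b) (x : D.Point → K) : Prop := ∀ p q, D.Adj p q → x p = x q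

theorem isColoring_stack {x : (D.stack E).Point → K} :
    (D.stack E).IsColoring x ↔ D.IsColoring (x ∘ D.inl E) ∧ E.IsColoring (x ∘ D.inr E) := by
  refine ⟨fun h => ⟨fun p q hpq => h _ _ (D.adj_inl E hpq), fun p q hpq => h _ _ (D.adj_inr E hpq)⟩,
    fun h p q hpq => ?_⟩
  rcases D.adj_stack E hpq with ⟨p', q', h', rfl, rfl⟩ | ⟨p', q', h', rfl, rfl⟩
  · exact h.1 _ _ h'
  · exact h.2 _ _ h'

/-- The function on the points of `D.stack E` with given restrictions to `D` and `E`.  On the common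
level the values of `x` are taken, so the restriction to `E` is `y` only if `x` and `y` agree
there. -/
def glueColoring (x : D.Point → K) (y : E.Point → K) (p : (D.stack E).Point) : K :=
  if h : p.1.1 ≤ D.word.length then x (D.toLeft E p h) else y (D.toRight E p (not_le.1 h).le)

theorem glueColoring_inl (x : D.Point → K) (y : E.Point → K) :
    D.glueColoring E x y ∘ D.inl E = x := by
  funext p
  exact dif_pos p.level_le

theorem glueColoring_inr (x : D.Point → K) (y : E.Point → K)
    (h : ∀ j hj, x (D.bot j hj) = y (E.top j hj)) :
    D.glueColoring E x y ∘ D.inr E = y := by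
  funext p
  obtain ⟨⟨t, j⟩, hp⟩ := p
  cases t with
  | zero =>
    have hj : j < b := by simpa [widthAt] using hp
    exact (dif_pos (le_refl D.word.length)).trans (h j hj)
  | succ t =>
    refine (dif_neg (by change ¬ (D.word.length + (t + 1) ≤ _); omega)).trans (congrArg y ?_)
    exact Point.ext (Prod.ext (Nat.add_sub_cancel_left ..) rfl)

theorem stack_ext {x y : (D.stack E).Point → K} (hl : x ∘ D.inl E = y ∘ D.inl E)
    (hr : x ∘ D.inr E = y ∘ D.inr E) : x = y := by
  funext p
  rcases le_total p.1.1 D.word.length with h | h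
  · exact congrFun hl (D.toLeft E p h)
  · rw [← D.inr_toRight E p h]
    exact congrFun hr (D.toRight E p h)

end Tangle

namespace Move

variable {K : Type*} {k m n : ℕ} {D E : Tangle m n}

/-- Colorings of the source and the target of an elementary cobordism which extend to a coloring of
the cobordism, i.e. to a function which is constant on its connected components. -/
def Compat (M : Move D E) (x : D.Point → K) (y : E.Point → K) : Prop :=
  D.IsColoring x ∧ E.IsColoring y ∧ ∀ p q, M.Track p q → x p = y q

theorem length_src (M : Move D E) :
    D.word.length = M.u.word.length + (M.s.word.length + M.v.word.length) := by
  conv_lhs => rw [M.src, Tangle.length_stack, Tangle.length_stack]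

theorem length_tgt (M : Move D E) :
    E.word.length = M.u.word.length + (M.t.word.length + M.v.word.length) := by
  conv_lhs => rw [M.tgt, Tangle.length_stack, Tangle.length_stack]

theorem compat_iff (M : Move D E) (x : D.Point → K) (y : E.Point → K) :
    M.Compat x y ↔ ∀ p q, M.Adj p q → Sum.elim x y p = Sum.elim x y q := by
  constructor
  · rintro ⟨hx, hy, hxy⟩ p q (h | h | h)
    · exact hx _ _ h
    · exact hy _ _ h
    · exact hxy _ _ h
  · exact fun h => ⟨fun p q hpq => h _ _ (.src hpq), fun p q hpq => h _ _ (.tgt hpq),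
      fun p q hpq => h _ _ (.sheet hpq)⟩

theorem Compat.top {M : Move D E} {x : D.Point → K} {y : E.Point → K} (h : M.Compat x y)
    (j : ℕ) (hj : j < m) : x (D.top j hj) = y (E.top j hj) :=
  h.2.2 _ _ (.above _ _ (Nat.zero_le _) rfl)

theorem Compat.bot {M : Move D E} {x : D.Point → K} {y : E.Point → K} (h : M.Compat x y)
    (j : ℕ) (hj : j < n) : x (D.bot j hj) = y (E.bot j hj) :=
  h.2.2 _ _ (.below _ _ M.v.word.length j
    (Prod.ext (M.length_src.trans (Nat.add_assoc ..).symm) rfl)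
    (Prod.ext (M.length_tgt.trans (Nat.add_assoc ..).symm) rfl))

/-- A coloring of the source and the target of `F` times an interval on top of `M` consists of
colorings for `M` and one coloring of `F`. -/
theorem compat_whiskerLeft (F : Tangle k m) (M : Move D E) (x : (F.stack D).Point → K)
    (y : (F.stack E).Point → K) :
    (M.whiskerLeft F).Compat x y ↔ M.Compat (x ∘ F.inr D) (y ∘ F.inr E) ∧
      F.IsColoring (x ∘ F.inl D) ∧ x ∘ F.inl D = y ∘ F.inl E := by
  have hlen : (M.whiskerLeft F).u.word.length = F.word.length + M.u.word.length :=
    F.length_stack M.u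
  constructor
  · rintro ⟨hx, hy, h⟩
    rw [Tangle.isColoring_stack] at hx hy
    refine ⟨⟨hx.2, hy.2, fun p q hpq => h _ _ ?_⟩, hx.1, funext fun p => h _ _ ?_⟩
    · cases hpq with
      | above hp e =>
        exact .above _ _ (by rw [hlen]; exact Nat.add_le_add_left hp _)
          (by change (_ + q.1.1, q.1.2) = (_ + p.1.1, p.1.2); rw [e])
      | below k j hp hq =>
        refine .below _ _ k j (Prod.ext ?_ ?_) (Prod.ext ?_ ?_)
        · change _ + p.1.1 = _ + M.s.word.length + k
          rw [hlen, hp]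
          simp only [Nat.add_assoc]
        · exact (congrArg Prod.snd hp : p.1.2 = j)
        · change _ + q.1.1 = _ + M.t.word.length + k
          rw [hlen, hq]
          simp only [Nat.add_assoc]
        · exact (congrArg Prod.snd hq : q.1.2 = j)
    · exact .above _ _ (by rw [hlen]; exact p.level_le.trans (Nat.le_add_right _ _)) rfl
  · rintro ⟨⟨hx, hy, h⟩, hF, e⟩
    refine ⟨(F.isColoring_stack D).2 ⟨hF, hx⟩, (F.isColoring_stack E).2 ⟨e ▸ hF, hy⟩,
      fun p q hpq => ?_⟩
    cases hpq with
    | above hp e' =>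
      rcases le_total p.1.1 F.word.length with hl | hl
      · have := congrFun e (F.toLeft D p hl)
        refine this.trans (congrArg y (Tangle.Point.ext e'.symm))
      · have e₁ := F.inr_toRight D p hl
        have e₂ := F.inr_toRight E q (by rw [e']; exact hl)
        rw [← e₁, ← e₂]
        refine h _ _ (.above _ _ ?_ ?_)
        · change p.1.1 - _ ≤ _
          omega
        · change (q.1.1 - _, q.1.2) = (p.1.1 - _, p.1.2)
          rw [e']
    | below k j hp hq =>
      change p.1 = (_ + M.s.word.length + k, j) at hp
      change q.1 = (_ + M.t.word.length + k, j) at hq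
      rw [hlen] at hp hq
      have e₁ := F.inr_toRight D p
        (by rw [hp]; simp only [Nat.add_assoc]; exact Nat.le_add_right _ _)
      have e₂ := F.inr_toRight E q
        (by rw [hq]; simp only [Nat.add_assoc]; exact Nat.le_add_right _ _)
      rw [← e₁, ← e₂]
      refine h _ _ (.below _ _ k j ?_ ?_)
      · change (p.1.1 - _, p.1.2) = _
        rw [hp]
        exact Prod.ext (by simp only [Nat.add_assoc, Nat.add_sub_cancel_left]) rfl
      · change (q.1.1 - _, q.1.2) = _
        rw [hq]
        exact Prod.ext (by simp only [Nat.add_assoc, Nat.add_sub_cancel_left]) rfl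

theorem compat_whiskerRight (F : Tangle n k) (M : Move D E) (x : (D.stack F).Point → K)
    (y : (E.stack F).Point → K) :
    (M.whiskerRight F).Compat x y ↔ M.Compat (x ∘ D.inl F) (y ∘ E.inl F) ∧
      F.IsColoring (x ∘ D.inr F) ∧ x ∘ D.inr F = y ∘ E.inr F := by
  have hD := M.length_src
  have hE := M.length_tgt
  constructor
  · rintro ⟨hx, hy, h⟩
    rw [Tangle.isColoring_stack] at hx hy
    refine ⟨⟨hx.1, hy.1, fun p q hpq => h _ _ ?_⟩, hx.2, funext fun p => h _ _ ?_⟩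
    · cases hpq with
      | above hp e => exact .above _ _ hp e
      | below k j hp hq => exact .below _ _ k j hp hq
    · refine .below _ _ (M.v.word.length + p.1.1) p.1.2 (Prod.ext ?_ rfl) (Prod.ext ?_ rfl)
      · change D.word.length + p.1.1 = M.u.word.length + M.s.word.length + _
        omega
      · change E.word.length + p.1.1 = M.u.word.length + M.t.word.length + _
        omega
  · rintro ⟨⟨hx, hy, h⟩, hF, e⟩
    refine ⟨(D.isColoring_stack F).2 ⟨hx, hF⟩, (E.isColoring_stack F).2 ⟨hy, e ▸ hF⟩,
      fun p q hpq => ?_⟩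
    cases hpq with
    | above hp e' =>
      change p.1.1 ≤ M.u.word.length at hp
      exact h (D.toLeft F p (by omega)) (E.toLeft F q (by rw [e']; omega)) (.above _ _ hp e')
    | below k j hp hq =>
      change p.1 = (M.u.word.length + M.s.word.length + k, j) at hp
      change q.1 = (M.u.word.length + M.t.word.length + k, j) at hq
      have hp' := congrArg Prod.fst hp
      have hq' := congrArg Prod.fst hq
      simp only at hp' hq'
      rcases le_total k M.v.word.length with hk | hk
      · exact h (D.toLeft F p (by omega)) (E.toLeft F q (by omega)) (.below _ _ k j hp hq)
      · have e₁ := D.inr_toRight F p (by omega)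
        have e₂ := E.inr_toRight F q (by omega)
        refine (congrArg x e₁).symm.trans (Eq.trans ?_ (congrArg y e₂))
        refine (congrFun e _).trans (congrArg y (congrArg _ (Tangle.Point.ext (Prod.ext ?_ ?_))))
        · change p.1.1 - _ = q.1.1 - _
          omega
        · change p.1.2 = q.1.2
          rw [hp, hq]

end Move

/-! ### Homeomorphisms between surfaces -/

namespace Surface

variable {X Y Z : Type} {K : Type*}

/-- A coloring of a surface: a function on its pieces which is constant on its connected
components. -/
def IsColoring (S : Surface X Y) (f : S.V → K) : Prop := ∀ p q, S.adj p q → f p = f q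

theorem isColoring_component (S : Surface X Y) : S.IsColoring S.component :=
  fun _ _ h => Quot.sound h

/-- A coloring as a function on the set of components. -/
def IsColoring.lift {S : Surface X Y} {f : S.V → K} (hf : S.IsColoring f) : S.Component → K :=
  Quot.lift f hf

theorem IsColoring.lift_component {S : Surface X Y} {f : S.V → K} (hf : S.IsColoring f) (p : S.V) :
    hf.lift (S.component p) = f p := rfl

/-- A criterion for surfaces without closed components: the components of each of them give
a coloring of the other one, which is standard on the boundary. -/
theorem Homeomorphic.of_isColoring {S T : Surface X Y} {f : S.V → T.Component}
    {g : T.V → S.Component} (hf : S.IsColoring f) (hg : T.IsColoring g)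
    (f_src : ∀ x, f (S.src x) = T.component (T.src x))
    (f_tgt : ∀ y, f (S.tgt y) = T.component (T.tgt y))
    (g_src : ∀ x, g (T.src x) = S.component (S.src x))
    (g_tgt : ∀ y, g (T.tgt y) = S.component (S.tgt y))
    (hS : ∀ p, (∃ x, S.component p = S.component (S.src x)) ∨
      ∃ y, S.component p = S.component (S.tgt y))
    (hT : ∀ p, (∃ x, T.component p = T.component (T.src x)) ∨
      ∃ y, T.component p = T.component (T.tgt y))
    (h_euler : ∀ p, T.euler (f p) = S.euler (S.component p))
    (h_dots : ∀ p, T.dots (f p) = S.dots (S.component p)) : S.Homeomorphic T := by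
  refine ⟨⟨hf.lift, hg.lift, fun c => ?_, fun c => ?_⟩, f_src, f_tgt, fun c => ?_, fun c => ?_⟩
  · obtain ⟨p, rfl⟩ := Quot.exists_rep c
    change hg.lift (hf.lift (S.component p)) = S.component p
    rcases hS p with ⟨x, h⟩ | ⟨x, h⟩
    · rw [h, hf.lift_component, f_src, hg.lift_component, g_src]
    · rw [h, hf.lift_component, f_tgt, hg.lift_component, g_tgt]
  · obtain ⟨p, rfl⟩ := Quot.exists_rep c
    change hf.lift (hg.lift (T.component p)) = T.component p
    rcases hT p with ⟨x, h⟩ | ⟨x, h⟩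
    · rw [h, hg.lift_component, g_src, hf.lift_component, f_src]
    · rw [h, hg.lift_component, g_tgt, hf.lift_component, f_tgt]
  · obtain ⟨p, rfl⟩ := Quot.exists_rep c
    exact h_euler p
  · obtain ⟨p, rfl⟩ := Quot.exists_rep c
    exact h_dots p

open scoped Classical in
theorem sum_ite_of_perm {α β R : Type*} [AddCommMonoid R] {l : List (α × ℤ × ℕ)}
    {l' : List (β × ℤ × ℕ)} {φ : α → β} (hφ : Function.Injective φ)
    (h : (l.map fun m => (φ m.1, m.2)).Perm l') (w : ℤ × ℕ → R) (a : α) :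
    (l'.map fun m => if m.1 = φ a then w m.2 else 0).sum =
      (l.map fun m => if m.1 = a then w m.2 else 0).sum := by
  rw [← (h.map _).sum_eq, List.map_map]
  refine congrArg List.sum (List.map_congr_left fun m _ => ?_)
  simp only [Function.comp, hφ.eq_iff]

/-- A criterion for surfaces without closed components whose marks correspond to each other. -/
theorem Homeomorphic.of_perm {S T : Surface X Y} {f : S.V → T.Component}
    {g : T.V → S.Component} (hf : S.IsColoring f) (hg : T.IsColoring g)
    (f_src : ∀ x, f (S.src x) = T.component (T.src x))
    (f_tgt : ∀ y, f (S.tgt y) = T.component (T.tgt y))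
    (g_src : ∀ x, g (T.src x) = S.component (S.src x))
    (g_tgt : ∀ y, g (T.tgt y) = S.component (S.tgt y))
    (hS : ∀ p, (∃ x, S.component p = S.component (S.src x)) ∨
      ∃ y, S.component p = S.component (S.tgt y))
    (hT : ∀ p, (∃ x, T.component p = T.component (T.src x)) ∨
      ∃ y, T.component p = T.component (T.tgt y))
    (h : (S.marks.map fun m => (f m.1, m.2)).Perm (T.marks.map fun m => (T.component m.1, m.2))) :
    S.Homeomorphic T := by
  have inj : Function.Injective hf.lift := by
    refine Function.LeftInverse.injective (g := hg.lift) fun c => ?_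
    obtain ⟨p, rfl⟩ := Quot.exists_rep c
    change hg.lift (hf.lift (S.component p)) = S.component p
    rcases hS p with ⟨x, h⟩ | ⟨x, h⟩
    · rw [h, hf.lift_component, f_src, hg.lift_component, g_src]
    · rw [h, hf.lift_component, f_tgt, hg.lift_component, g_tgt]
  have h' : ((S.marks.map fun m => (S.component m.1, m.2)).map fun m =>
      (hf.lift m.1, m.2)).Perm (T.marks.map fun m => (T.component m.1, m.2)) := by
    rwa [List.map_map]
  refine .of_isColoring hf hg f_src f_tgt g_src g_tgt hS hT (fun p => ?_) (fun p => ?_)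
  · have := sum_ite_of_perm inj h' (fun w => w.1) (S.component p)
    simp only [List.map_map] at this
    exact this
  · have := sum_ite_of_perm inj h' (fun w => w.2) (S.component p)
    simp only [List.map_map] at this
    exact this

theorem isColoring_glue {S : Surface X Y} {T : Surface Y Z} {f : S.V → K} {g : T.V → K} :
    (S.glue T).IsColoring (Sum.elim f g) ↔
      S.IsColoring f ∧ T.IsColoring g ∧ ∀ y, f (S.tgt y) = g (T.src y) := by
  constructor
  · exact fun h => ⟨fun p q hpq => h _ _ (.left hpq), fun p q hpq => h _ _ (.right hpq),
      fun y => h _ _ (.glue y)⟩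
  · rintro ⟨hf, hg, h⟩ p q (hpq | hpq | y)
    · exact hf _ _ hpq
    · exact hg _ _ hpq
    · exact h y

theorem marks_glue (S : Surface X Y) (T : Surface Y Z) (f : S.V → K) (g : T.V → K) :
    ((S.glue T).marks.map fun m => (Sum.elim f g m.1, m.2)) =
      (S.marks.map fun m => (f m.1, m.2)) ++ T.marks.map fun m => (g m.1, m.2) := by
  simp only [glue, List.map_append, List.map_map]
  rfl

end Surface

/-! ### Cobordisms that consist of two elementary ones -/

section TwoSteps

variable {m n : ℕ} {D₀ D₁ D₂ : Tangle m n} (M : Move D₀ D₁) (N : Move D₁ D₂)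

/-- The composition of two elementary cobordisms. -/
def twoSteps : Movie D₀ D₂ := (Quiver.Path.nil.cons M).cons N

/-- The components of the surface of two elementary cobordisms, as a coloring of the source. -/
def color₀ (p : D₀.Point) : (Movie.surface (twoSteps M N)).Component :=
  (Movie.surface (twoSteps M N)).component (.inl (.inl p))

/-- The components of the surface, as a coloring of the intermediate diagram. -/
def color₁ (p : D₁.Point) : (Movie.surface (twoSteps M N)).Component :=
  (Movie.surface (twoSteps M N)).component (.inr (.inl p))

/-- The components of the surface, as a coloring of the target. -/
def color₂ (p : D₂.Point) : (Movie.surface (twoSteps M N)).Component :=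
  (Movie.surface (twoSteps M N)).component (.inr (.inr p))

/-- The coloring of the surface of two elementary cobordisms given by colorings of the three
diagrams. -/
def extend₂ {K : Type*} (x₀ : D₀.Point → K) (x₁ : D₁.Point → K) (x₂ : D₂.Point → K) :
    (Movie.surface (twoSteps M N)).V → K :=
  Sum.elim (Sum.elim x₀ (Sum.elim x₀ x₁)) (Sum.elim x₁ x₂)

variable {M N}

theorem Move.Compat.isColoring {K : Type*} {x : D₀.Point → K} {y : D₁.Point → K}
    (h : M.Compat x y) : M.surface.IsColoring (Sum.elim x y) :=
  (M.compat_iff x y).1 h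

theorem isColoring_extend₂ {K : Type*} {x₀ : D₀.Point → K} {x₁ : D₁.Point → K}
    {x₂ : D₂.Point → K} (hM : M.Compat x₀ x₁) (hN : N.Compat x₁ x₂) :
    (Movie.surface (twoSteps M N)).IsColoring (extend₂ M N x₀ x₁ x₂) :=
  Surface.isColoring_glue.2 ⟨Surface.isColoring_glue.2 ⟨hM.1, hM.isColoring, fun _ => rfl⟩,
    hN.isColoring, fun _ => rfl⟩

variable (M N)

theorem component_eq_extend₂ (p : (Movie.surface (twoSteps M N)).V) :
    (Movie.surface (twoSteps M N)).component p =
      extend₂ M N (color₀ M N) (color₁ M N) (color₂ M N) p := by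
  rcases p with (p | p | p) | p | p
  · rfl
  · exact (Quot.sound (.left (.glue p))).symm
  · exact Quot.sound (.glue p)
  · rfl
  · rfl

theorem compat_color₀₁ : M.Compat (color₀ M N) (color₁ M N) := by
  rw [M.compat_iff]
  intro p q h
  have := (Movie.surface (twoSteps M N)).isColoring_component (.inl (.inr p)) (.inl (.inr q))
    (.left (.right h))
  exact (component_eq_extend₂ ..).symm.trans (this.trans (component_eq_extend₂ ..))

theorem compat_color₁₂ : N.Compat (color₁ M N) (color₂ M N) := by
  rw [N.compat_iff]
  intro p q h
  have := (Movie.surface (twoSteps M N)).isColoring_component (.inr p) (.inr q) (.right h)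
  exact (component_eq_extend₂ ..).symm.trans (this.trans (component_eq_extend₂ ..))

/-- There are no closed components if every point of the intermediate diagram is connected to the
boundary. -/
theorem component_boundary₂
    (h : ∀ p, (∃ q, color₁ M N p = color₀ M N q) ∨ ∃ q, color₁ M N p = color₂ M N q)
    (p : (Movie.surface (twoSteps M N)).V) :
    (∃ x, (Movie.surface (twoSteps M N)).component p = color₀ M N x) ∨
      ∃ y, (Movie.surface (twoSteps M N)).component p = color₂ M N y := by
  rw [component_eq_extend₂]
  rcases p with (p | p | p) | p | p
  · exact .inl ⟨p, rfl⟩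
  · exact .inl ⟨p, rfl⟩
  · exact h p
  · exact h p
  · exact .inr ⟨p, rfl⟩

theorem marks_twoSteps {K : Type*} (x₀ : D₀.Point → K) (x₁ : D₁.Point → K) (x₂ : D₂.Point → K) :
    ((Movie.surface (twoSteps M N)).marks.map fun m => (extend₂ M N x₀ x₁ x₂ m.1, m.2)) =
      (M.surface.marks.map fun m => (Sum.elim x₀ x₁ m.1, m.2)) ++
        N.surface.marks.map fun m => (Sum.elim x₁ x₂ m.1, m.2) := by
  refine (Surface.marks_glue _ _ _ _).trans (congrArg (· ++ _) ?_)
  exact Surface.marks_glue D₀.cylinder M.surface _ _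

end TwoSteps

namespace Move

variable {k m n : ℕ} {D E : Tangle m n} {K : Type*}

theorem marks_whiskerLeft (F : Tangle k m) (M : Move D E) (x : (F.stack D).Point → K)
    (y : (F.stack E).Point → K) :
    ((M.whiskerLeft F).surface.marks.map fun m => (Sum.elim x y m.1, m.2)) =
      M.surface.marks.map fun m => (Sum.elim (x ∘ F.inr D) (y ∘ F.inr E) m.1, m.2) := by
  have aux : ∀ {s t : List Letter} (l : Local M.a s t) (hs : M.s.word = s) (ht : M.t.word = t),
      (((M.whiskerLeft F).marksAux l hs ht).map fun m => (Sum.elim x y m.1, m.2)) =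
        (M.marksAux l hs ht).map fun m =>
          (Sum.elim (x ∘ F.inr D) (y ∘ F.inr E) m.1, m.2) := by
    intro s t l hs ht
    have hlen : (M.whiskerLeft F).u.word.length = F.word.length + M.u.word.length :=
      F.length_stack M.u
    have h₁ : ∀ j h, (M.whiskerLeft F).srcTop j h = F.inr D (M.srcTop j h) :=
      fun j h => Tangle.Point.ext (Prod.ext hlen rfl)
    have h₂ : ∀ i h hs, (M.whiskerLeft F).srcMid i h hs = F.inr D (M.srcMid i h hs) :=
      fun j h _ => Tangle.Point.ext (Prod.ext (congrArg (· + 1) hlen) rfl)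
    have h₃ : ∀ i h ht, (M.whiskerLeft F).tgtMid i h ht = F.inr E (M.tgtMid i h ht) :=
      fun j h _ => Tangle.Point.ext (Prod.ext (congrArg (· + 1) hlen) rfl)
    cases l with
    | birth i h => exact congrArg (fun p => [(y p, (1 : ℤ), 0)]) (h₃ i h ht)
    | death i h => exact congrArg (fun p => [(x p, (1 : ℤ), 0)]) (h₂ i h hs)
    | saddle i h => exact congrArg (fun p => [(x p, (-1 : ℤ), 0)]) (h₁ i _)
    | saddleInv i h => exact congrArg (fun p => [(x p, (-1 : ℤ), 0)]) (h₁ i _)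
    | dot j h => exact congrArg (fun p => [(x p, (0 : ℤ), 1)]) (h₁ j h)
    | isotopy h => rfl
    | isotopyInv h => rfl
  exact aux M.loc rfl rfl

theorem marks_whiskerRight (F : Tangle n k) (M : Move D E) (x : (D.stack F).Point → K)
    (y : (E.stack F).Point → K) :
    ((M.whiskerRight F).surface.marks.map fun m => (Sum.elim x y m.1, m.2)) =
      M.surface.marks.map fun m => (Sum.elim (x ∘ D.inl F) (y ∘ E.inl F) m.1, m.2) := by
  have aux : ∀ {s t : List Letter} (l : Local M.a s t) (hs : M.s.word = s) (ht : M.t.word = t),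
      (((M.whiskerRight F).marksAux l hs ht).map fun m => (Sum.elim x y m.1, m.2)) =
        (M.marksAux l hs ht).map fun m =>
          (Sum.elim (x ∘ D.inl F) (y ∘ E.inl F) m.1, m.2) := by
    intro s t l hs ht
    cases l <;> rfl
  exact aux M.loc rfl rfl

end Move

/-! ### Distant elementary cobordisms commute -/

section Interchange

variable {a b c : ℕ} {D D' : Tangle a b} {E E' : Tangle b c} (M : Move D D') (N : Move E E')

/-- The colorings of the two boundary diagrams which extend to a coloring of the surface do not
depend on the order of `M` and `N`. -/
theorem exists_interchange {K : Type*} {y₀ : (D.stack E).Point → K} {y₁ : (D.stack E').Point → K}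
    {y₂ : (D'.stack E').Point → K} (h : (N.whiskerLeft D).Compat y₀ y₁)
    (h' : (M.whiskerRight E').Compat y₁ y₂) :
    ∃ x₁ : (D'.stack E).Point → K, (M.whiskerRight E).Compat y₀ x₁ ∧
      (N.whiskerLeft D').Compat x₁ y₂ := by
  rw [Move.compat_whiskerLeft] at h
  rw [Move.compat_whiskerRight] at h'
  obtain ⟨hN, -, e⟩ := h
  obtain ⟨hM, -, e'⟩ := h'
  rw [← e] at hM
  rw [e'] at hN
  have el := D'.glueColoring_inl E (y₂ ∘ D'.inl E') (y₀ ∘ D.inr E)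
  have er := D'.glueColoring_inr E (y₂ ∘ D'.inl E') (y₀ ∘ D.inr E)
    fun j hj => (hM.bot j hj).symm
  refine ⟨D'.glueColoring E (y₂ ∘ D'.inl E') (y₀ ∘ D.inr E), ?_, ?_⟩
  · rw [Move.compat_whiskerRight, el, er]
    exact ⟨hM, hN.1, rfl⟩
  · rw [Move.compat_whiskerLeft, el, er]
    exact ⟨hN, hM.2.1, rfl⟩

/-- The converse of `exists_interchange`. -/
theorem exists_interchange' {K : Type*} {x₀ : (D.stack E).Point → K} {x₁ : (D'.stack E).Point → K}
    {x₂ : (D'.stack E').Point → K} (h : (M.whiskerRight E).Compat x₀ x₁)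
    (h' : (N.whiskerLeft D').Compat x₁ x₂) :
    ∃ y₁ : (D.stack E').Point → K, (N.whiskerLeft D).Compat x₀ y₁ ∧
      (M.whiskerRight E').Compat y₁ x₂ := by
  rw [Move.compat_whiskerRight] at h
  rw [Move.compat_whiskerLeft] at h'
  obtain ⟨hM, -, e⟩ := h
  obtain ⟨hN, -, e'⟩ := h'
  rw [e'] at hM
  rw [← e] at hN
  have el := D.glueColoring_inl E' (x₀ ∘ D.inl E) (x₂ ∘ D'.inr E')
  have er := D.glueColoring_inr E' (x₀ ∘ D.inl E) (x₂ ∘ D'.inr E')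
    fun j hj => hN.top j hj
  refine ⟨D.glueColoring E' (x₀ ∘ D.inl E) (x₂ ∘ D'.inr E'), ?_, ?_⟩
  · rw [Move.compat_whiskerLeft, el, er]
    exact ⟨hN, hM.1, rfl⟩
  · rw [Move.compat_whiskerRight, el, er]
    exact ⟨hM, hN.2.1, rfl⟩

/-- The components of each of the two surfaces, as a coloring of its boundary, extend to a coloring
of the other surface.  There are no closed components, since `M` does not move the points of `E` and
`N` does not move those of `D'`. -/
theorem homeomorphic_interchange :
    (Movie.surface (twoSteps (M.whiskerRight E) (N.whiskerLeft D'))).Homeomorphic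
      (Movie.surface (twoSteps (N.whiskerLeft D) (M.whiskerRight E'))) := by
  have hS₀ := compat_color₀₁ (M.whiskerRight E) (N.whiskerLeft D')
  have hS₁ := compat_color₁₂ (M.whiskerRight E) (N.whiskerLeft D')
  have hT₀ := compat_color₀₁ (N.whiskerLeft D) (M.whiskerRight E')
  have hT₁ := compat_color₁₂ (N.whiskerLeft D) (M.whiskerRight E')
  obtain ⟨y₁, hy₀, hy₁⟩ := exists_interchange' M N hS₀ hS₁
  obtain ⟨x₁, hx₀, hx₁⟩ := exists_interchange M N hT₀ hT₁
  refine Surface.Homeomorphic.of_perm (isColoring_extend₂ hx₀ hx₁) (isColoring_extend₂ hy₀ hy₁)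
    (fun _ => rfl) (fun _ => rfl) (fun _ => rfl) (fun _ => rfl)
    (component_boundary₂ _ _ fun p => ?_) (component_boundary₂ _ _ fun p => ?_) ?_
  · rw [Move.compat_whiskerRight] at hS₀
    rw [Move.compat_whiskerLeft] at hS₁
    rcases le_total p.1.1 D'.word.length with h | h
    · exact .inr ⟨_, congrFun hS₁.2.2 (D'.toLeft E p h)⟩
    · rw [← D'.inr_toRight E p h]
      exact .inl ⟨_, (congrFun hS₀.2.2 (D'.toRight E p h)).symm⟩
  · rw [Move.compat_whiskerLeft] at hT₀
    rw [Move.compat_whiskerRight] at hT₁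
    rcases le_total p.1.1 D.word.length with h | h
    · exact .inl ⟨_, (congrFun hT₀.2.2 (D.toLeft E' p h)).symm⟩
    · rw [← D.inr_toRight E' p h]
      exact .inr ⟨_, congrFun hT₁.2.2 (D.toRight E' p h)⟩
  · simp only [component_eq_extend₂]
    rw [marks_twoSteps, marks_twoSteps, Move.marks_whiskerLeft, Move.marks_whiskerLeft,
      Move.marks_whiskerRight, Move.marks_whiskerRight]
    rw [Move.compat_whiskerLeft] at hT₀ hx₁
    rw [Move.compat_whiskerRight] at hT₁ hx₀
    rw [hx₁.2.2, ← hx₀.2.2, ← hT₀.2.2, hT₁.2.2]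
    exact List.perm_append_comm

end Interchange

/-! ### The unit law for the turnbacks -/

/-- If the diagram `D'` can be folded onto `D` along a saddle `M` and the subsequent death `N` of
a circle, the saddle is cancelled by the disk. -/
theorem homeomorphic_nil_of_fold {m n : ℕ} {D D' : Tangle m n} (M : Move D D') (N : Move D' D)
    (fold : D'.Point → D.Point)
    (h_adj : ∀ p q, D'.Adj p q → D.Adj (fold p) (fold q) ∨ D.Adj (fold q) (fold p))
    (hM : ∀ p q, M.Track p q → fold q = p) (hN : ∀ q p, N.Track q p → fold q = p)
    (h_track : ∀ p, ∃ q, M.Track p q ∧ N.Track q p)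
    (h_bd : ∀ q, (∃ p, M.Track p q) ∨ ∃ p, N.Track q p)
    {p : D.Point} {q : D'.Point} (hpq : M.Track p q) (marks_M : M.surface.marks = [(.inl p, -1, 0)])
    (marks_N : N.surface.marks = [(.inl q, 1, 0)]) :
    (Movie.surface (twoSteps M N)).Homeomorphic (Movie.surface (.nil : Movie D D)) := by
  let x : D.Point → D.cylinder.Component := D.cylinder.component
  have hx : D.IsColoring x := D.cylinder.isColoring_component
  have hx' : D'.IsColoring (x ∘ fold) := fun p q hpq =>
    (h_adj p q hpq).elim (fun h => hx _ _ h) fun h => (hx _ _ h).symm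
  have cM : M.Compat x (x ∘ fold) := ⟨hx, hx', fun p q h => congrArg x (hM p q h).symm⟩
  have cN : N.Compat (x ∘ fold) x := ⟨hx', hx, fun p q h => congrArg x (hN p q h)⟩
  have c₀ := compat_color₀₁ M N
  have c₁ := compat_color₁₂ M N
  have hm : (Movie.surface (twoSteps M N)).marks.map
      (fun m => ((Movie.surface (twoSteps M N)).component m.1, m.2)) =
        [(color₀ M N p, -1, 0), (color₀ M N p, 1, 0)] := by
    simp only [component_eq_extend₂]
    rw [marks_twoSteps, marks_M, marks_N, c₀.2.2 _ _ hpq]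
    simp [c₀.2.2 _ _ hpq]
  refine Surface.Homeomorphic.of_isColoring (isColoring_extend₂ cM cN) (g := color₀ M N) c₀.1
    (fun _ => rfl) (fun _ => rfl) (fun _ => rfl) (fun p => ?_)
    (component_boundary₂ _ _ fun q => ?_) (fun p => .inl ⟨p, rfl⟩) (fun c => ?_) (fun c => ?_)
  · obtain ⟨q, h, h'⟩ := h_track p
    exact (c₀.2.2 _ _ h).trans (c₁.2.2 _ _ h')
  · rcases h_bd q with ⟨p, h⟩ | ⟨p, h⟩
    · exact .inl ⟨p, (c₀.2.2 _ _ h).symm⟩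
    · exact .inr ⟨p, c₁.2.2 _ _ h⟩
  · generalize (Movie.surface (twoSteps M N)).component c = d
    classical
    have := congrArg (fun l => (l.map fun m => if m.1 = d then m.2.1 else 0).sum) hm
    simp only [List.map_map] at this
    refine Eq.symm (Eq.trans this ?_)
    change _ = (0 : ℤ)
    by_cases h : color₀ M N p = d <;> simp [h]
  · generalize (Movie.surface (twoSteps M N)).component c = d
    classical
    have := congrArg (fun l => (l.map fun m => if m.1 = d then m.2.2 else 0).sum) hm
    simp only [List.map_map] at this
    refine Eq.symm (Eq.trans this ?_)
    change _ = 0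
    by_cases h : color₀ M N p = d <;> simp [h]

section Turnback

variable (n i : ℕ) (h₀ : 0 < i) (h : i < n)

/-- The saddle from the identity diagram to `e_i`. -/
def saddleMove : Move (Tangle.one n) (Tangle.turnback n i h₀ h) where
  u := .one n
  s := .one n
  t := .turnback n i h₀ h
  v := .one n
  loc := .saddle (i - 1) (by omega)
  src := rfl
  tgt := rfl

/-- The death of the circle in `e_i e_i`. -/
def mergeMove : Move ((Tangle.turnback n i h₀ h).stack (Tangle.turnback n i h₀ h))
    (Tangle.turnback n i h₀ h) where
  a := n - 2
  b := n - 2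
  u := ⟨[.join (i - 1)], n - 2, ⟨by omega, by omega⟩, rfl⟩
  s := .circle (n - 2) (i - 1) (by omega)
  t := .one (n - 2)
  v := ⟨[.create (i - 1)], n, ⟨by omega, by omega⟩, rfl⟩
  loc := .death (i - 1) (by omega)
  src := rfl
  tgt := rfl

/-- The saddle from `1 e_i` to `e_i e_i`. -/
abbrev saddleAbove : Move (Tangle.turnback n i h₀ h)
    ((Tangle.turnback n i h₀ h).stack (Tangle.turnback n i h₀ h)) :=
  (saddleMove n i h₀ h).whiskerRight (Tangle.turnback n i h₀ h)

/-- The saddle from `e_i 1` to `e_i e_i`. -/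
abbrev saddleBelow : Move (Tangle.turnback n i h₀ h)
    ((Tangle.turnback n i h₀ h).stack (Tangle.turnback n i h₀ h)) :=
  (saddleMove n i h₀ h).whiskerLeft (Tangle.turnback n i h₀ h)

theorem widthAt_turnback (t : ℕ) : widthAt n (Tangle.turnback n i h₀ h).word t =
    if t = 0 ∨ t = 2 then n else if t = 1 then n - 2 else 0 := by
  match t with
  | 0 => rfl
  | 1 => rfl
  | 2 => change n - 2 + 2 = n; omega
  | t + 3 => rw [if_neg (by omega), if_neg (by omega)]; rfl

theorem widthAt_turnback_stack_turnback (t : ℕ) :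
    widthAt n ((Tangle.turnback n i h₀ h).stack (Tangle.turnback n i h₀ h)).word t =
      if t = 0 ∨ t = 2 ∨ t = 4 then n else if t = 1 ∨ t = 3 then n - 2 else 0 := by
  match t with
  | 0 => rfl
  | 1 => rfl
  | 2 => change n - 2 + 2 = n; omega
  | 3 => rfl
  | 4 => change n - 2 + 2 = n; omega
  | t + 5 => rw [if_neg (by omega), if_neg (by omega)]; rfl

/-- The map from the points of `e_i e_i` to those of `e_i` which folds the part above the level `c`,
and moves the part below it up by two levels.  Here `c` is `1` or `2`. -/
def turnbackFold (c : ℕ) (hc : c = 1 ∨ c = 2)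
    (p : ((Tangle.turnback n i h₀ h).stack (Tangle.turnback n i h₀ h)).Point) :
    (Tangle.turnback n i h₀ h).Point :=
  ⟨(if p.1.1 ≤ c then p.1.1 else p.1.1 - 2, p.1.2), by
    have := p.2
    rw [widthAt_turnback_stack_turnback] at this
    rw [widthAt_turnback]
    split_ifs at this <;> split_ifs <;> grind⟩

theorem adj_turnbackFold (c : ℕ) (hc : c = 1 ∨ c = 2)
    (p q : ((Tangle.turnback n i h₀ h).stack (Tangle.turnback n i h₀ h)).Point)
    (hpq : ((Tangle.turnback n i h₀ h).stack (Tangle.turnback n i h₀ h)).Adj p q) :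
    (Tangle.turnback n i h₀ h).Adj (turnbackFold n i h₀ h c hc p) (turnbackFold n i h₀ h c hc q) ∨
      (Tangle.turnback n i h₀ h).Adj (turnbackFold n i h₀ h c hc q)
        (turnbackFold n i h₀ h c hc p) := by
  obtain ⟨t, l, hl, hpq⟩ := hpq
  obtain ⟨⟨p₁, p₂⟩, hp⟩ := p
  obtain ⟨⟨q₁, q₂⟩, hq⟩ := q
  change [Letter.join (i - 1), .create (i - 1), .join (i - 1), .create (i - 1)][t]? = some l at hl
  change Letter.Adj l t (p₁, p₂) (q₁, q₂) at hpq
  have h0 : (Tangle.turnback n i h₀ h).word[0]? = some (.join (i - 1)) := rfl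
  have h1 : (Tangle.turnback n i h₀ h).word[1]? = some (.create (i - 1)) := rfl
  match t, hl with
  | 0, hl =>
    obtain rfl : Letter.join (i - 1) = l := by simpa using hl
    refine .inl ⟨0, _, h0, ?_⟩
    rcases hc with rfl | rfl <;> cases hpq <;> constructor <;> assumption
  | 1, hl =>
    obtain rfl : Letter.create (i - 1) = l := by simpa using hl
    rcases hc with rfl | rfl
    · cases hpq
      · exact .inl ⟨0, _, h0, .join_arc _ _⟩
      · exact .inr ⟨0, _, h0, .join_left _ _ _ (by assumption)⟩
      · exact .inr ⟨0, _, h0, .join_right _ _ _ (by assumption)⟩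
    · refine .inl ⟨1, _, h1, ?_⟩
      cases hpq <;> constructor <;> assumption
  | 2, hl =>
    obtain rfl : Letter.join (i - 1) = l := by simpa using hl
    rcases hc with rfl | rfl
    · refine .inl ⟨0, _, h0, ?_⟩
      cases hpq <;> constructor <;> assumption
    · cases hpq
      · exact .inl ⟨1, _, h1, .create_arc _ _⟩
      · exact .inr ⟨1, _, h1, .create_left _ _ _ (by assumption)⟩
      · exact .inr ⟨1, _, h1, .create_right _ _ _ (by assumption)⟩
  | 3, hl =>
    obtain rfl : Letter.create (i - 1) = l := by simpa using hl
    refine .inl ⟨1, _, h1, ?_⟩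
    rcases hc with rfl | rfl <;> cases hpq <;> constructor <;> assumption
  | t + 4, hl => simp at hl

theorem track_mergeMove {c : ℕ} (hc : c = 1 ∨ c = 2)
    (p : ((Tangle.turnback n i h₀ h).stack (Tangle.turnback n i h₀ h)).Point)
    (q : (Tangle.turnback n i h₀ h).Point) (hpq : (mergeMove n i h₀ h).Track p q) :
    turnbackFold n i h₀ h c hc p = q := by
  refine Tangle.Point.ext ?_
  cases hpq with
  | above hp e =>
    change p.1.1 ≤ 1 at hp
    rw [e]
    exact Prod.ext (if_pos (by omega)) rfl
  | below k j hp hq =>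
    change p.1 = (1 + 2 + k, j) at hp
    change q.1 = (1 + k, j) at hq
    rw [hq]
    refine Prod.ext ((if_neg ?_).trans ?_) (congrArg Prod.snd hp : p.1.2 = _)
    · rw [hp]; simp only; omega
    · rw [hp]; simp only; omega

variable {n i} in
theorem Tangle.Point.lt_of_turnback (p : (Tangle.turnback n i h₀ h).Point) :
    p.1.1 ≤ 2 ∧ p.1.2 < n ∧ (p.1.1 = 1 → p.1.2 < n - 2) := by
  have := p.2
  rw [widthAt_turnback] at this
  split_ifs at this <;> omega

variable {n i} in
theorem Tangle.Point.lt_of_turnback_stack_turnback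
    (p : ((Tangle.turnback n i h₀ h).stack (Tangle.turnback n i h₀ h)).Point) :
    p.1.1 ≤ 4 ∧ p.1.2 < n ∧ (p.1.1 = 1 ∨ p.1.1 = 3 → p.1.2 < n - 2) := by
  have := p.2
  rw [widthAt_turnback_stack_turnback] at this
  split_ifs at this <;> omega

/-- The point of `e_i` at the level `t` and the position `j`. -/
def turnbackPoint (t j : ℕ) (ht : t ≤ 2) (hj : j < n) (hj' : t = 1 → j < n - 2) :
    (Tangle.turnback n i h₀ h).Point :=
  ⟨(t, j), by rw [widthAt_turnback]; simp only; split_ifs <;> omega⟩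

/-- The point of `e_i e_i` at the level `t` and the position `j`. -/
def turnbackPoint₂ (t j : ℕ) (ht : t ≤ 4) (hj : j < n) (hj' : t = 1 ∨ t = 3 → j < n - 2) :
    ((Tangle.turnback n i h₀ h).stack (Tangle.turnback n i h₀ h)).Point :=
  ⟨(t, j), by rw [widthAt_turnback_stack_turnback]; simp only; split_ifs <;> omega⟩

theorem homeomorphic_saddleAbove_mergeMove :
    (Movie.surface (twoSteps (saddleAbove n i h₀ h) (mergeMove n i h₀ h))).Homeomorphic
      (Movie.surface (.nil : Movie (Tangle.turnback n i h₀ h) _)) := by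
  refine homeomorphic_nil_of_fold _ _ (turnbackFold n i h₀ h 1 (.inl rfl))
    (adj_turnbackFold n i h₀ h _ _) (fun p q hpq => ?_) (track_mergeMove n i h₀ h _)
    (fun p => ?_) (fun q => ?_)
    (p := turnbackPoint n i h₀ h 0 (i - 1) (by omega) (by omega) (by omega))
    (q := turnbackPoint₂ n i h₀ h 2 (i - 1) (by omega) (by omega) (by omega))
    (.below _ _ 0 _ rfl rfl) rfl rfl
  · refine Tangle.Point.ext ?_
    cases hpq with
    | above hp e =>
      change p.1.1 ≤ 0 at hp
      exact Prod.ext ((if_pos (by rw [e]; omega)).trans (congrArg Prod.fst e))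
        (congrArg Prod.snd e : q.1.2 = _)
    | below k j hp hq =>
      change p.1 = (0 + 0 + k, j) at hp
      change q.1 = (0 + 2 + k, j) at hq
      rw [hp]
      refine Prod.ext ((if_neg ?_).trans ?_) (congrArg Prod.snd hq : q.1.2 = _)
      · rw [hq]; simp only; omega
      · rw [hq]; simp only; omega
  · obtain ⟨h₁, h₂, h₃⟩ := p.lt_of_turnback
    rcases Nat.eq_zero_or_pos p.1.1 with h₄ | h₄
    · refine ⟨turnbackPoint₂ n i h₀ h 0 p.1.2 (by omega) h₂ (by omega),
        .above _ _ h₄.le (Prod.ext h₄.symm rfl), .above _ _ (Nat.zero_le _) (Prod.ext h₄ rfl)⟩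
    · refine ⟨turnbackPoint₂ n i h₀ h (2 + p.1.1) p.1.2 (by omega) h₂ (by omega),
        .below _ _ p.1.1 p.1.2 (Prod.ext ?_ rfl) (Prod.ext ?_ rfl),
        .below _ _ (p.1.1 - 1) p.1.2 (Prod.ext ?_ rfl) (Prod.ext ?_ rfl)⟩
      · change p.1.1 = 0 + 0 + p.1.1; omega
      · change 2 + p.1.1 = 0 + 2 + p.1.1; omega
      · change 2 + p.1.1 = 1 + 2 + (p.1.1 - 1); omega
      · change p.1.1 = 1 + 0 + (p.1.1 - 1); omega
  · obtain ⟨h₁, h₂, h₃⟩ := q.lt_of_turnback_stack_turnback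
    rcases lt_trichotomy q.1.1 2 with h₄ | h₄ | h₄
    · exact .inr ⟨turnbackPoint n i h₀ h q.1.1 q.1.2 (by omega) h₂ (by omega),
        .above _ _ (Nat.lt_succ_iff.1 h₄) rfl⟩
    · exact .inl ⟨turnbackPoint n i h₀ h 0 q.1.2 (by omega) h₂ (by omega),
        .below _ _ 0 q.1.2 rfl (Prod.ext h₄ rfl)⟩
    · refine .inr ⟨turnbackPoint n i h₀ h (q.1.1 - 2) q.1.2 (by omega) h₂ (by omega),
        .below _ _ (q.1.1 - 3) q.1.2 (Prod.ext ?_ rfl) (Prod.ext ?_ rfl)⟩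
      · change q.1.1 = 1 + 2 + (q.1.1 - 3); omega
      · change q.1.1 - 2 = 1 + 0 + (q.1.1 - 3); omega

theorem homeomorphic_saddleBelow_mergeMove :
    (Movie.surface (twoSteps (saddleBelow n i h₀ h) (mergeMove n i h₀ h))).Homeomorphic
      (Movie.surface (.nil : Movie (Tangle.turnback n i h₀ h) _)) := by
  refine homeomorphic_nil_of_fold _ _ (turnbackFold n i h₀ h 2 (.inr rfl))
    (adj_turnbackFold n i h₀ h _ _) (fun p q hpq => ?_) (track_mergeMove n i h₀ h _)
    (fun p => ?_) (fun q => ?_)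
    (p := turnbackPoint n i h₀ h 2 (i - 1) (by omega) (by omega) (by omega))
    (q := turnbackPoint₂ n i h₀ h 2 (i - 1) (by omega) (by omega) (by omega))
    (.above _ _ le_rfl rfl) rfl rfl
  · refine Tangle.Point.ext ?_
    cases hpq with
    | above hp e =>
      change p.1.1 ≤ 2 at hp
      exact Prod.ext ((if_pos (by rw [e]; omega)).trans (congrArg Prod.fst e))
        (congrArg Prod.snd e : q.1.2 = _)
    | below k j hp hq =>
      change p.1 = (2 + 0 + k, j) at hp
      change q.1 = (2 + 2 + k, j) at hq
      rw [hp]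
      refine Prod.ext ((if_neg ?_).trans ?_) (congrArg Prod.snd hq : q.1.2 = _)
      · rw [hq]; simp only; omega
      · rw [hq]; simp only; omega
  · obtain ⟨h₁, h₂, h₃⟩ := p.lt_of_turnback
    rcases h₁.lt_or_eq with h₄ | h₄
    · exact ⟨turnbackPoint₂ n i h₀ h p.1.1 p.1.2 (by omega) h₂ (by omega),
        .above _ _ h₁ rfl, .above _ _ (Nat.lt_succ_iff.1 h₄) rfl⟩
    · exact ⟨turnbackPoint₂ n i h₀ h 4 p.1.2 (by omega) h₂ (by omega),
        .below _ _ 0 p.1.2 (Prod.ext h₄ rfl) rfl, .below _ _ 1 p.1.2 rfl (Prod.ext h₄ rfl)⟩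
  · obtain ⟨h₁, h₂, h₃⟩ := q.lt_of_turnback_stack_turnback
    rcases le_or_gt q.1.1 2 with h₄ | h₄
    · exact .inl ⟨turnbackPoint n i h₀ h q.1.1 q.1.2 h₄ h₂ (by omega), .above _ _ h₄ rfl⟩
    · refine .inr ⟨turnbackPoint n i h₀ h (q.1.1 - 2) q.1.2 (by omega) h₂ (by omega),
        .below _ _ (q.1.1 - 3) q.1.2 (Prod.ext ?_ rfl) (Prod.ext ?_ rfl)⟩
      · change q.1.1 = 1 + 2 + (q.1.1 - 3); omega
      · change q.1.1 - 2 = 1 + 0 + (q.1.1 - 3); omega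

end Turnback

/-! ### State sums over the colorings of a surface -/

/-- The field of values of the state sum.  In the field with `17` elements, `1 / 2 = 3 ^ 2` and
`- 1 / 2 = 5 ^ 2`. -/
abbrev StateField : Type := ZMod 17

instance : Fact (Nat.Prime 17) := ⟨by norm_num⟩

/-- A square root of the value `± 1 / 2` of the sphere with the color `b`. -/
def sphereRoot (b : Bool) : StateField := if b then 3 else 5

/-- The value `± 1` of a dot on a component with the color `b`. -/
def dotSign (b : Bool) : StateField := if b then 1 else -1

theorem sphereRoot_ne_zero (b : Bool) : sphereRoot b ≠ 0 := by revert b; decide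

/-- The contribution of a mark to the state sum. -/
def markWeight (b : Bool) (m : ℤ × ℕ) : StateField := sphereRoot b ^ m.1 * dotSign b ^ m.2

theorem markWeight_zero (b : Bool) : markWeight b (0, 0) = 1 := by simp [markWeight]

theorem markWeight_add (b : Bool) (χ χ' : ℤ) (d d' : ℕ) :
    markWeight b (χ + χ', d + d') = markWeight b (χ, d) * markWeight b (χ', d') := by
  simp only [markWeight, zpow_add₀ (sphereRoot_ne_zero b), pow_add]
  ring

open scoped Classical in
/-- The contributions of the marks, collected for each component separately. -/
theorem prod_markWeight {C : Type*} [Fintype C] (τ : C → Bool) (l : List (C × ℤ × ℕ)) :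
    (l.map fun m => markWeight (τ m.1) m.2).prod =
      ∏ c, markWeight (τ c) ((l.map fun m => if m.1 = c then m.2.1 else 0).sum,
        (l.map fun m => if m.1 = c then m.2.2 else 0).sum) := by
  induction l with
  | nil => simp [markWeight_zero]
  | cons m l ih =>
    simp only [List.map_cons, List.prod_cons, List.sum_cons, markWeight_add,
      Finset.prod_mul_distrib, ih]
    congr 1
    rw [Finset.prod_eq_single m.1 (fun c _ hc => ?_) (by simp)]
    · simp
    · simp [hc.symm, markWeight_zero]

namespace Surface

variable {X Y Z : Type}

/-- The colorings of a surface by two colors with given restrictions to the boundary. -/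
def Coloring (S : Surface X Y) (x : X → Bool) (y : Y → Bool) : Type :=
  {σ : S.V → Bool // S.IsColoring σ ∧ (∀ p, σ (S.src p) = x p) ∧ ∀ p, σ (S.tgt p) = y p}

noncomputable instance (S : Surface X Y) [Finite S.V] (x : X → Bool) (y : Y → Bool) :
    Fintype (S.Coloring x y) :=
  @Fintype.ofFinite _ (inferInstanceAs (Finite {_σ : S.V → Bool // _}))

/-- The state sum of a surface: the sum of the products of the contributions of its marks, over all
colorings which extend the given ones on the boundary. -/
noncomputable def stateSum (S : Surface X Y) [Finite S.V] (x : X → Bool) (y : Y → Bool) :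
    StateField :=
  ∑ σ : S.Coloring x y, (S.marks.map fun m => markWeight (σ.1 m.1) m.2).prod

instance (S : Surface X Y) (T : Surface Y Z) [Finite S.V] [Finite T.V] : Finite (S.glue T).V :=
  inferInstanceAs (Finite (S.V ⊕ T.V))

theorem stateSum_eq_zero (S : Surface X Y) [Finite S.V] {x : X → Bool} {y : Y → Bool}
    (h : S.Coloring x y → False) : S.stateSum x y = 0 :=
  Finset.sum_eq_zero fun σ _ => (h σ).elim

theorem stateSum_eq (S : Surface X Y) [Finite S.V] {x : X → Bool} {y : Y → Bool}
    (τ : S.Coloring x y) (h : ∀ σ : S.Coloring x y, σ = τ) :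
    S.stateSum x y = (S.marks.map fun m => markWeight (τ.1 m.1) m.2).prod :=
  Fintype.sum_eq_single τ fun σ hσ => (hσ (h σ)).elim

/-- A coloring of a union of two surfaces consists of two colorings which agree on the common
boundary. -/
def Coloring.glueEquiv (S : Surface X Y) (T : Surface Y Z) (x : X → Bool) (z : Z → Bool) :
    (Σ y, S.Coloring x y × T.Coloring y z) ≃ (S.glue T).Coloring x z where
  toFun σ := ⟨Sum.elim σ.2.1.1 σ.2.2.1, isColoring_glue.2
    ⟨σ.2.1.2.1, σ.2.2.2.1, fun y => (σ.2.1.2.2.2 y).trans (σ.2.2.2.2.1 y).symm⟩,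
    σ.2.1.2.2.1, σ.2.2.2.2.2⟩
  invFun σ := ⟨fun y => σ.1 (.inl (S.tgt y)),
    ⟨fun p => σ.1 (.inl p), fun p q h => σ.2.1 _ _ (.left h), σ.2.2.1, fun _ => rfl⟩,
    ⟨fun p => σ.1 (.inr p), fun p q h => σ.2.1 _ _ (.right h),
      fun y => (σ.2.1 _ _ (.glue y)).symm, σ.2.2.2⟩⟩
  left_inv := by
    rintro ⟨y, ⟨σ, hσ⟩, ⟨τ, hτ⟩⟩
    obtain rfl : (fun p => σ (S.tgt p)) = y := funext hσ.2.2
    rfl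
  right_inv σ := Subtype.ext (funext fun p => by cases p <;> rfl)

theorem stateSum_glue (S : Surface X Y) (T : Surface Y Z) [Finite S.V] [Finite T.V]
    [Fintype (Y → Bool)] (x : X → Bool) (z : Z → Bool) :
    (S.glue T).stateSum x z = ∑ y, S.stateSum x y * T.stateSum y z := by
  simp only [stateSum, Finset.sum_mul_sum, ← Fintype.sum_prod_type']
  rw [← Fintype.sum_sigma']
  refine (Fintype.sum_equiv (Coloring.glueEquiv S T x z) _ _ fun σ => ?_).symm
  have := congrArg (fun l => (l.map fun m => markWeight m.1 m.2).prod)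
    (marks_glue S T σ.2.1.1 σ.2.2.1)
  simp only [List.map_append, List.map_map, List.prod_append] at this
  exact this.symm

/-- A homeomorphism transports colorings. -/
def Coloring.map {S T : Surface X Y} (φ : S.Component → T.Component) {x : X → Bool} {y : Y → Bool}
    (h_src : ∀ x, φ (S.component (S.src x)) = T.component (T.src x))
    (h_tgt : ∀ y, φ (S.component (S.tgt y)) = T.component (T.tgt y)) (τ : T.Coloring x y) :
    S.Coloring x y :=
  ⟨fun p => τ.2.1.lift (φ (S.component p)),
    fun _ _ h => congrArg (τ.2.1.lift ∘ φ) (S.isColoring_component _ _ h),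
    fun p => (congrArg τ.2.1.lift (h_src p)).trans (τ.2.2.1 p),
    fun p => (congrArg τ.2.1.lift (h_tgt p)).trans (τ.2.2.2 p)⟩

theorem Coloring.lift_map {S T : Surface X Y} (φ : S.Component → T.Component) {x : X → Bool}
    {y : Y → Bool} (h_src : ∀ x, φ (S.component (S.src x)) = T.component (T.src x))
    (h_tgt : ∀ y, φ (S.component (S.tgt y)) = T.component (T.tgt y)) (τ : T.Coloring x y)
    (c : S.Component) : (Coloring.map φ h_src h_tgt τ).2.1.lift c = τ.2.1.lift (φ c) := by
  obtain ⟨p, rfl⟩ := Quot.exists_rep c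
  rfl

/-- The contribution of a coloring depends only on the Euler characteristics and the numbers of dots
of the components, by `prod_markWeight`. -/
theorem stateSum_homeomorphic {S T : Surface X Y} [Finite S.V] [Finite T.V]
    (h : S.Homeomorphic T) : S.stateSum = T.stateSum := by
  funext x y
  obtain ⟨φ, h_src, h_tgt, h_euler, h_dots⟩ := h
  have h_src' : ∀ x, φ.symm (T.component (T.src x)) = S.component (S.src x) :=
    fun x => φ.symm_apply_eq.2 (h_src x).symm
  have h_tgt' : ∀ x, φ.symm (T.component (T.tgt x)) = S.component (S.tgt x) :=
    fun x => φ.symm_apply_eq.2 (h_tgt x).symm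
  have : Finite S.Component := Quot.finite _
  have : Finite T.Component := Quot.finite _
  let _ := Fintype.ofFinite S.Component
  let _ := Fintype.ofFinite T.Component
  have key : ∀ {S : Surface X Y} [Fintype S.Component] (σ : S.V → Bool) (hσ : S.IsColoring σ),
      (S.marks.map fun m => markWeight (σ m.1) m.2).prod =
        ∏ c, markWeight (hσ.lift c) (S.euler c, S.dots c) := fun {S} _ σ hσ => by
    classical
    have := prod_markWeight hσ.lift (S.marks.map fun m => (S.component m.1, m.2))
    simp only [List.map_map] at this
    refine Eq.trans this (Finset.prod_congr rfl fun c _ => ?_)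
    congr 2
  let e : S.Coloring x y ≃ T.Coloring x y :=
    { toFun := Coloring.map φ.symm h_src' h_tgt'
      invFun := Coloring.map φ h_src h_tgt
      left_inv := fun σ => Subtype.ext (funext fun p =>
        (Coloring.lift_map φ.symm h_src' h_tgt' σ (φ (S.component p))).trans
          (congrArg σ.2.1.lift (φ.symm_apply_apply _)))
      right_inv := fun σ => Subtype.ext (funext fun p =>
        (Coloring.lift_map φ h_src h_tgt σ (φ.symm (T.component p))).trans
          (congrArg σ.2.1.lift (φ.apply_symm_apply _))) }
  refine Fintype.sum_equiv e _ _ fun σ => ?_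
  rw [key σ.1 σ.2.1, key (e σ).1 (e σ).2.1]
  refine Fintype.prod_equiv φ _ _ fun c => ?_
  rw [h_euler, h_dots]
  congr 1
  exact ((Coloring.lift_map φ.symm h_src' h_tgt' σ (φ c)).trans
    (congrArg σ.2.1.lift (φ.symm_apply_apply c))).symm

end Surface

/-! ### The state sums of cobordisms -/

section StateMatrix

open scoped Classical

noncomputable instance {m n : ℕ} (D : Tangle m n) : Fintype (D.Point → Bool) := Fintype.ofFinite _

instance {m n : ℕ} (D : Tangle m n) : Finite D.cylinder.V := inferInstanceAs (Finite D.Point)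

instance {m n : ℕ} {D E : Tangle m n} (M : Move D E) : Finite M.surface.V :=
  inferInstanceAs (Finite (D.Point ⊕ E.Point))

theorem Movie.finite_surface {m n : ℕ} {D E : Tangle m n} (p : Movie D E) :
    Finite (Movie.surface p).V := by
  induction p with
  | nil => exact inferInstanceAs (Finite D.cylinder.V)
  | cons p M ih => exact inferInstanceAs (Finite ((Movie.surface p).glue (Move.surface M)).V)

instance {m n : ℕ} {D E : Tangle m n} (p : Movie D E) : Finite (Movie.surface p).V :=
  p.finite_surface

variable {k m n : ℕ} {D E F : Tangle m n}

/-- The square matrices of state sums.  The rows and columns are indexed by all functions on the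
points of the two diagrams; those which are not colorings have no effect. -/
abbrev StateMatrix {m n : ℕ} (D E : Tangle m n) : Type :=
  Matrix (D.Point → Bool) (E.Point → Bool) StateField

/-- The state sums of a cobordism. -/
noncomputable def Movie.stateMatrix (p : Movie D E) : StateMatrix D E :=
  .of (Movie.surface p).stateSum

/-- The state sums of an elementary cobordism. -/
noncomputable def Move.stateMatrix (M : Move D E) : StateMatrix D E := .of M.surface.stateSum

theorem Movie.stateMatrix_nil (x y : D.Point → Bool) :
    Movie.stateMatrix (.nil : Movie D D) x y = if x = y ∧ D.IsColoring x then 1 else 0 := by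
  change D.cylinder.stateSum x y = _
  split_ifs with h
  · obtain ⟨rfl, h⟩ := h
    exact D.cylinder.stateSum_eq ⟨x, h, fun _ => rfl, fun _ => rfl⟩
      fun σ => Subtype.ext (funext σ.2.2.1)
  · refine D.cylinder.stateSum_eq_zero fun σ => h ?_
    have e : σ.1 = x := funext σ.2.2.1
    exact ⟨e.symm.trans (funext σ.2.2.2), e ▸ σ.2.1⟩

theorem Movie.stateMatrix_cons (p : Movie D E) (M : Move E F) :
    Movie.stateMatrix (p.cons M) = p.stateMatrix * M.stateMatrix := by
  funext x z
  exact Surface.stateSum_glue _ _ x z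

theorem Move.stateMatrix_apply (M : Move D E) (x : D.Point → Bool) (y : E.Point → Bool) :
    M.stateMatrix x y = if M.Compat x y then
      (M.surface.marks.map fun m => markWeight (Sum.elim x y m.1) m.2).prod else 0 := by
  change M.surface.stateSum x y = _
  split_ifs with h
  · refine M.surface.stateSum_eq ⟨Sum.elim x y, h.isColoring, fun _ => rfl, fun _ => rfl⟩
      fun σ => Subtype.ext (funext fun p => ?_)
    cases p with
    | inl p => exact σ.2.2.1 p
    | inr p => exact σ.2.2.2 p
  · refine M.surface.stateSum_eq_zero fun σ => h ((M.compat_iff x y).2 fun p q hpq => ?_)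
    have e : σ.1 = Sum.elim x y := funext fun p => by
      cases p with
      | inl p => exact σ.2.2.1 p
      | inr p => exact σ.2.2.2 p
    rw [← e]
    exact σ.2.1 _ _ hpq

theorem Move.compat_of_ne_zero {M : Move D E} {x : D.Point → Bool} {y : E.Point → Bool}
    (h : M.stateMatrix x y ≠ 0) : M.Compat x y := by
  rw [M.stateMatrix_apply] at h
  by_contra h'
  exact h (if_neg h')

/-- The state sums vanish unless the colors agree at the end points, which a cobordism does not
move. -/
theorem Movie.of_stateMatrix_ne_zero (p : Movie D E) {x : D.Point → Bool} {y : E.Point → Bool}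
    (h : p.stateMatrix x y ≠ 0) : E.IsColoring y ∧
      (∀ j hj, x (D.top j hj) = y (E.top j hj)) ∧ ∀ j hj, x (D.bot j hj) = y (E.bot j hj) := by
  induction p with
  | nil =>
    rw [stateMatrix_nil] at h
    obtain ⟨rfl, hx⟩ : x = y ∧ D.IsColoring x := by
      by_contra h'
      exact h (if_neg h')
    exact ⟨hx, fun _ _ => rfl, fun _ _ => rfl⟩
  | cons p M ih =>
    rw [stateMatrix_cons, Matrix.mul_apply] at h
    obtain ⟨z, -, hz⟩ := Finset.exists_ne_zero_of_sum_ne_zero h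
    obtain ⟨-, h₁, h₂⟩ := ih (left_ne_zero_of_mul hz)
    have c := Move.compat_of_ne_zero (right_ne_zero_of_mul hz)
    exact ⟨c.2.1, fun j hj => (h₁ j hj).trans (c.top j hj),
      fun j hj => (h₂ j hj).trans (c.bot j hj)⟩

/-- The state sums of the product with an interval are a projection, not the identity matrix, since
the indices need not be colorings. -/
theorem Movie.stateMatrix_mul_nil (p : Movie D E) :
    p.stateMatrix * Movie.stateMatrix (.nil : Movie E E) = p.stateMatrix := by
  funext x z
  rw [Matrix.mul_apply, Finset.sum_eq_single z (fun y _ hy => ?_) (by simp)]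
  · rw [stateMatrix_nil]
    by_cases h : p.stateMatrix x z = 0
    · rw [h, zero_mul]
    · rw [if_pos ⟨rfl, (p.of_stateMatrix_ne_zero h).1⟩, mul_one]
  · rw [stateMatrix_nil, if_neg (fun h => hy h.1), mul_zero]

theorem Movie.stateMatrix_comp (p : Movie D E) (q : Movie E F) :
    Movie.stateMatrix (p.comp q) = p.stateMatrix * q.stateMatrix := by
  induction q with
  | nil => exact p.stateMatrix_mul_nil.symm
  | cons q M ih =>
    rw [Quiver.Path.comp_cons, stateMatrix_cons, stateMatrix_cons, ih, Matrix.mul_assoc]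

theorem Move.stateMatrix_toPath (M : Move D E) :
    Movie.stateMatrix (Quiver.Hom.toPath (V := Tangle m n) M) = M.stateMatrix := by
  refine (Movie.stateMatrix_cons .nil M).trans ?_
  funext x z
  rw [Matrix.mul_apply, Finset.sum_eq_single x (fun y _ hy => ?_) (by simp)]
  · rw [Movie.stateMatrix_nil]
    by_cases h : M.stateMatrix x z = 0
    · rw [h, mul_zero]
    · rw [if_pos ⟨rfl, (Move.compat_of_ne_zero h).1⟩, one_mul]
  · rw [Movie.stateMatrix_nil, if_neg (fun h => hy h.1.symm), zero_mul]

/-! ### Stacking and state sums -/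

/-- Stacking a diagram, times an interval, on top of a cobordism. -/
def Movie.whiskerLeft (F : Tangle k m) : ∀ {E : Tangle m n}, Movie D E →
    Movie (F.stack D) (F.stack E)
  | _, .nil => .nil
  | _, .cons p M => (Movie.whiskerLeft F p).cons (Move.whiskerLeft F M)

/-- Stacking a diagram, times an interval, below a cobordism. -/
def Movie.whiskerRight (F : Tangle n k) : ∀ {E : Tangle m n}, Movie D E →
    Movie (D.stack F) (E.stack F)
  | _, .nil => .nil
  | _, .cons p M => (Movie.whiskerRight F p).cons (Move.whiskerRight M F)

theorem formalWhiskerLeft_map_formal (F : Tangle k m) (p : Movie D E) (r : Ground) :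
    (formalWhiskerLeft F n).map (formal p r) = formal (p.whiskerLeft F) r := by
  have h₁ : (formalWhiskerLeft F n).map (formal p r) = r • (Paths.lift
      { obj := fun D : Tangle m n => Formal.of (F.stack D)
        map := fun M => formal (Quiver.Hom.toPath (Move.whiskerLeft F M)) 1 }).map p :=
    Free.lift_map_single _ _ _ _
  have h₂ : formal (p.whiskerLeft F) r = r • formal (p.whiskerLeft F) 1 := by
    change _ = r • Finsupp.single _ _
    rw [Finsupp.smul_single, smul_eq_mul, mul_one]
    rfl
  rw [h₁, h₂]
  congr 1
  clear h₁ h₂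
  induction p with
  | nil => rfl
  | cons p M ih =>
    refine (Paths.lift_cons _ _ _).trans ?_
    rw [ih]
    refine (Free.single_comp_single _ _ _ _ _ _).trans ?_
    rw [mul_one]
    rfl

theorem formalWhiskerRight_map_formal (F : Tangle n k) (p : Movie D E) (r : Ground) :
    (formalWhiskerRight m F).map (formal p r) = formal (p.whiskerRight F) r := by
  have h₁ : (formalWhiskerRight m F).map (formal p r) = r • (Paths.lift
      { obj := fun D : Tangle m n => Formal.of (D.stack F)
        map := fun M => formal (Quiver.Hom.toPath (Move.whiskerRight M F)) 1 }).map p :=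
    Free.lift_map_single _ _ _ _
  have h₂ : formal (p.whiskerRight F) r = r • formal (p.whiskerRight F) 1 := by
    change _ = r • Finsupp.single _ _
    rw [Finsupp.smul_single, smul_eq_mul, mul_one]
    rfl
  rw [h₁, h₂]
  congr 1
  clear h₁ h₂
  induction p with
  | nil => rfl
  | cons p M ih =>
    refine (Paths.lift_cons _ _ _).trans ?_
    rw [ih]
    refine (Free.single_comp_single _ _ _ _ _ _).trans ?_
    rw [mul_one]
    rfl

/-- The effect on state sums of stacking `F` on top. -/
noncomputable def StateMatrix.whiskerLeft (F : Tangle k m) :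
    StateMatrix D E →+ StateMatrix (F.stack D) (F.stack E) where
  toFun A := .of fun x y => if F.IsColoring (x ∘ F.inl D) ∧ x ∘ F.inl D = y ∘ F.inl E then
    A (x ∘ F.inr D) (y ∘ F.inr E) else 0
  map_zero' := by ext; simp
  map_add' A B := by ext; simp only [Matrix.of_apply, Matrix.add_apply]; split_ifs <;> simp

/-- The effect on state sums of stacking `F` below. -/
noncomputable def StateMatrix.whiskerRight (F : Tangle n k) :
    StateMatrix D E →+ StateMatrix (D.stack F) (E.stack F) where
  toFun A := .of fun x y => if F.IsColoring (x ∘ D.inr F) ∧ x ∘ D.inr F = y ∘ E.inr F then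
    A (x ∘ D.inl F) (y ∘ E.inl F) else 0
  map_zero' := by ext; simp
  map_add' A B := by ext; simp only [Matrix.of_apply, Matrix.add_apply]; split_ifs <;> simp

theorem StateMatrix.whiskerLeft_apply (F : Tangle k m) (A : StateMatrix D E)
    (x : (F.stack D).Point → Bool) (y : (F.stack E).Point → Bool) :
    StateMatrix.whiskerLeft F A x y =
      if F.IsColoring (x ∘ F.inl D) ∧ x ∘ F.inl D = y ∘ F.inl E then
        A (x ∘ F.inr D) (y ∘ F.inr E) else 0 := rfl

theorem StateMatrix.whiskerRight_apply (F : Tangle n k) (A : StateMatrix D E)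
    (x : (D.stack F).Point → Bool) (y : (E.stack F).Point → Bool) :
    StateMatrix.whiskerRight F A x y =
      if F.IsColoring (x ∘ D.inr F) ∧ x ∘ D.inr F = y ∘ E.inr F then
        A (x ∘ D.inl F) (y ∘ E.inl F) else 0 := rfl

/-- Functions on the points of `F.stack E` with a given restriction to `F` are the same as functions
on the points of `E` with given values on the top. -/
theorem sum_stack_left (F : Tangle k m) (E : Tangle m n) (x : F.Point → Bool)
    (G : (E.Point → Bool) → StateField)
    (hG : ∀ w, G w ≠ 0 → ∀ j hj, x (F.bot j hj) = w (E.top j hj)) :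
    (∑ y : (F.stack E).Point → Bool, if x = y ∘ F.inl E then G (y ∘ F.inr E) else 0) =
      ∑ w, G w := by
  rw [← Finset.sum_filter,
    ← Finset.sum_filter_of_ne (p := fun w => ∀ j hj, x (F.bot j hj) = w (E.top j hj))
      fun w _ => hG w]
  refine Finset.sum_nbij' (fun y => y ∘ F.inr E) (fun w => F.glueColoring E x w) ?_ ?_ ?_ ?_ ?_
  · simp only [Finset.mem_filter, Finset.mem_univ, true_and]
    rintro y rfl j hj
    rfl
  · simp only [Finset.mem_filter, Finset.mem_univ, true_and]
    exact fun w _ => (F.glueColoring_inl E x w).symm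
  · simp only [Finset.mem_filter, Finset.mem_univ, true_and]
    rintro y rfl
    exact F.stack_ext E (F.glueColoring_inl ..) (F.glueColoring_inr _ _ _ fun _ _ => rfl)
  · simp only [Finset.mem_filter, Finset.mem_univ, true_and]
    exact fun w hw => F.glueColoring_inr E x w hw
  · exact fun _ _ => rfl

/-- Functions on the points of `D.stack F` with a given restriction to `F` are the same as functions
on the points of `D` with given values on the bottom. -/
theorem sum_stack_right (D : Tangle m n) (F : Tangle n k) (x : F.Point → Bool)
    (G : (D.Point → Bool) → StateField)
    (hG : ∀ w, G w ≠ 0 → ∀ j hj, w (D.bot j hj) = x (F.top j hj)) :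
    (∑ y : (D.stack F).Point → Bool, if x = y ∘ D.inr F then G (y ∘ D.inl F) else 0) =
      ∑ w, G w := by
  rw [← Finset.sum_filter,
    ← Finset.sum_filter_of_ne (p := fun w => ∀ j hj, w (D.bot j hj) = x (F.top j hj))
      fun w _ => hG w]
  refine Finset.sum_nbij' (fun y => y ∘ D.inl F) (fun w => D.glueColoring F w x) ?_ ?_ ?_ ?_ ?_
  · simp only [Finset.mem_filter, Finset.mem_univ, true_and]
    rintro y rfl j hj
    rfl
  · simp only [Finset.mem_filter, Finset.mem_univ, true_and]
    exact fun w hw => (D.glueColoring_inr F w x hw).symm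
  · simp only [Finset.mem_filter, Finset.mem_univ, true_and]
    rintro y rfl
    exact D.stack_ext F (D.glueColoring_inl ..) (D.glueColoring_inr _ _ _ fun _ _ => rfl)
  · simp only [Finset.mem_filter, Finset.mem_univ, true_and]
    exact fun w hw => D.glueColoring_inl F w x
  · exact fun _ _ => rfl

theorem Move.stateMatrix_whiskerLeft (F : Tangle k m) (M : Move D E) :
    (M.whiskerLeft F).stateMatrix = StateMatrix.whiskerLeft F M.stateMatrix := by
  funext x y
  change _ = if _ then _ else _
  rw [stateMatrix_apply, stateMatrix_apply, M.compat_whiskerLeft]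
  have := congrArg (fun l => (l.map fun m => markWeight m.1 m.2).prod) (M.marks_whiskerLeft F x y)
  simp only [List.map_map] at this
  by_cases h : M.Compat (x ∘ F.inr D) (y ∘ F.inr E)
  · by_cases h' : F.IsColoring (x ∘ F.inl D) ∧ x ∘ F.inl D = y ∘ F.inl E
    · exact (if_pos ⟨h, h'⟩).trans (this.trans ((if_pos h).symm.trans (if_pos h').symm))
    · exact (if_neg fun e => h' e.2).trans (if_neg h').symm
  · rw [if_neg fun e => h e.1, if_neg h, ite_self]

theorem Move.stateMatrix_whiskerRight (F : Tangle n k) (M : Move D E) :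
    (M.whiskerRight F).stateMatrix = StateMatrix.whiskerRight F M.stateMatrix := by
  funext x y
  change _ = if _ then _ else _
  rw [stateMatrix_apply, stateMatrix_apply, M.compat_whiskerRight]
  have := congrArg (fun l => (l.map fun m => markWeight m.1 m.2).prod) (M.marks_whiskerRight F x y)
  simp only [List.map_map] at this
  by_cases h : M.Compat (x ∘ D.inl F) (y ∘ E.inl F)
  · by_cases h' : F.IsColoring (x ∘ D.inr F) ∧ x ∘ D.inr F = y ∘ E.inr F
    · exact (if_pos ⟨h, h'⟩).trans (this.trans ((if_pos h).symm.trans (if_pos h').symm))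
    · exact (if_neg fun e => h' e.2).trans (if_neg h').symm
  · rw [if_neg fun e => h e.1, if_neg h, ite_self]

theorem Movie.stateMatrix_whiskerLeft (F : Tangle k m) (p : Movie D E) :
    (p.whiskerLeft F).stateMatrix = StateMatrix.whiskerLeft F p.stateMatrix := by
  induction p with
  | nil =>
    funext x y
    change _ = if _ then _ else _
    refine (stateMatrix_nil x y).trans ?_
    rw [stateMatrix_nil, Tangle.isColoring_stack]
    by_cases h : (F.IsColoring (x ∘ F.inl D) ∧ x ∘ F.inl D = y ∘ F.inl D) ∧
        x ∘ F.inr D = y ∘ F.inr D ∧ D.IsColoring (x ∘ F.inr D)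
    · rw [if_pos h.1, if_pos h.2, if_pos ⟨F.stack_ext D h.1.2 h.2.1, h.1.1, h.2.2⟩]
    · rw [if_neg]
      · split_ifs with h₁ h₂
        · exact (h ⟨h₁, h₂⟩).elim
        · rfl
        · rfl
      · rintro ⟨rfl, h₁, h₂⟩
        exact h ⟨⟨h₁, rfl⟩, rfl, h₂⟩
  | @cons E' E p M ih =>
    rw [stateMatrix_cons]
    change Movie.stateMatrix ((Movie.whiskerLeft F p).cons (Move.whiskerLeft F M)) = _
    rw [stateMatrix_cons, ih, Move.stateMatrix_whiskerLeft]
    funext x z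
    simp only [Matrix.mul_apply, StateMatrix.whiskerLeft_apply]
    by_cases h : F.IsColoring (x ∘ F.inl D) ∧ x ∘ F.inl D = z ∘ F.inl E
    · rw [if_pos h, ← sum_stack_left F E' (x ∘ F.inl D) _ fun w hw j hj =>
        (Movie.of_stateMatrix_ne_zero p (left_ne_zero_of_mul hw)).2.1 j hj]
      refine Finset.sum_congr rfl fun y _ => ?_
      by_cases h' : x ∘ F.inl D = y ∘ F.inl E'
      · rw [if_pos ⟨h.1, h'⟩, if_pos h', if_pos ⟨h' ▸ h.1, h'.symm.trans h.2⟩]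
      · rw [if_neg h', if_neg fun e => h' e.2, zero_mul]
    · rw [if_neg h]
      refine Finset.sum_eq_zero fun y _ => ?_
      by_cases h' : F.IsColoring (x ∘ F.inl D) ∧ x ∘ F.inl D = y ∘ F.inl E'
      · rw [if_neg (c := F.IsColoring (y ∘ F.inl E') ∧ _) fun e => h ⟨h'.1, h'.2.trans e.2⟩,
          mul_zero]
      · rw [if_neg h', zero_mul]

theorem Movie.stateMatrix_whiskerRight (F : Tangle n k) (p : Movie D E) :
    (p.whiskerRight F).stateMatrix = StateMatrix.whiskerRight F p.stateMatrix := by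
  induction p with
  | nil =>
    funext x y
    change _ = if _ then _ else _
    refine (stateMatrix_nil x y).trans ?_
    rw [stateMatrix_nil, Tangle.isColoring_stack]
    by_cases h : (F.IsColoring (x ∘ D.inr F) ∧ x ∘ D.inr F = y ∘ D.inr F) ∧
        x ∘ D.inl F = y ∘ D.inl F ∧ D.IsColoring (x ∘ D.inl F)
    · rw [if_pos h.1, if_pos h.2, if_pos ⟨D.stack_ext F h.2.1 h.1.2, h.2.2, h.1.1⟩]
    · rw [if_neg]
      · split_ifs with h₁ h₂
        · exact (h ⟨h₁, h₂⟩).elim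
        · rfl
        · rfl
      · rintro ⟨rfl, h₁, h₂⟩
        exact h ⟨⟨h₂, rfl⟩, rfl, h₁⟩
  | @cons E' E p M ih =>
    rw [stateMatrix_cons]
    change Movie.stateMatrix ((Movie.whiskerRight F p).cons (Move.whiskerRight M F)) = _
    rw [stateMatrix_cons, ih, Move.stateMatrix_whiskerRight]
    funext x z
    simp only [Matrix.mul_apply, StateMatrix.whiskerRight_apply]
    by_cases h : F.IsColoring (x ∘ D.inr F) ∧ x ∘ D.inr F = z ∘ E.inr F
    · rw [if_pos h, ← sum_stack_right E' F (x ∘ D.inr F) _ fun w hw j hj =>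
        ((Movie.of_stateMatrix_ne_zero p (left_ne_zero_of_mul hw)).2.2 j hj).symm]
      refine Finset.sum_congr rfl fun y _ => ?_
      by_cases h' : x ∘ D.inr F = y ∘ E'.inr F
      · rw [if_pos ⟨h.1, h'⟩, if_pos h', if_pos ⟨h' ▸ h.1, h'.symm.trans h.2⟩]
      · rw [if_neg h', if_neg fun e => h' e.2, zero_mul]
    · rw [if_neg h]
      refine Finset.sum_eq_zero fun y _ => ?_
      by_cases h' : F.IsColoring (x ∘ D.inr F) ∧ x ∘ D.inr F = y ∘ E'.inr F
      · rw [if_neg (c := F.IsColoring (y ∘ E'.inr F) ∧ _) fun e => h ⟨h'.1, h'.2.trans e.2⟩,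
          mul_zero]
      · rw [if_neg h', zero_mul]

end StateMatrix

/-! ### The state sums satisfy the local relations -/

section LocalRelations

open scoped Classical

section Circle

variable {a i : ℕ} {h : i ≤ a} {K : Type*}

theorem widthAt_circle (t : ℕ) : widthAt a (Tangle.circle a i h).word t =
    if t = 0 ∨ t = 2 then a else if t = 1 then a + 2 else 0 := by
  match t with
  | 0 => rfl
  | 1 => rfl
  | 2 => rfl
  | t + 3 => rw [if_neg (by omega), if_neg (by omega)]; rfl

variable (a i h) in
/-- A point of the diagram with one small circle. -/
def circlePoint (t j : ℕ) (ht : t ≤ 2) (hj : j < if t = 1 then a + 2 else a) :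
    (Tangle.circle a i h).Point :=
  ⟨(t, j), by rw [widthAt_circle]; simp only; split_ifs at * <;> omega⟩

variable (a i h) in
/-- A point of the small circle. -/
def circleMid : (Tangle.circle a i h).Point :=
  circlePoint a i h 1 i (by omega) (by rw [if_pos rfl]; omega)

variable (a i h) in
/-- The coloring of the diagram with one small circle which has the color `c j` on the `j`-th
strand and the color `ε` on the circle. -/
def circleColoring (c : ℕ → K) (ε : K) (p : (Tangle.circle a i h).Point) : K :=
  if p.1.1 = 1 then if p.1.2 < i then c p.1.2 else if p.1.2 < i + 2 then ε else c (p.1.2 - 2)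
  else c p.1.2

theorem isColoring_circleColoring (c : ℕ → K) (ε : K) :
    (Tangle.circle a i h).IsColoring (circleColoring a i h c ε) := by
  rintro ⟨⟨p₁, p₂⟩, hp⟩ ⟨⟨q₁, q₂⟩, hq⟩ ⟨t, l, hl, hpq⟩
  change [Letter.create i, .join i][t]? = some l at hl
  change Letter.Adj l t (p₁, p₂) (q₁, q₂) at hpq
  match t, hl with
  | 0, hl =>
    obtain rfl : Letter.create i = l := by simpa using hl
    cases hpq with
    | create_arc => simp [circleColoring]
    | create_left _ _ _ hj => simp [circleColoring, hj]
    | create_right _ _ _ hj => simp [circleColoring, hj, show ¬ (p₂ + 2 < i) by omega]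
  | 1, hl =>
    obtain rfl : Letter.join i = l := by simpa using hl
    cases hpq with
    | join_arc => simp [circleColoring]
    | join_left _ _ _ hj => simp [circleColoring, hj]
    | join_right _ _ _ hj => simp [circleColoring, hj, show ¬ (q₂ + 2 < i) by omega]
  | t + 2, hl => simp at hl

theorem eq_circleColoring {z : (Tangle.circle a i h).Point → K}
    (hz : (Tangle.circle a i h).IsColoring z) {c : ℕ → K}
    (hc : ∀ j hj, z ((Tangle.circle a i h).top j hj) = c j) :
    z = circleColoring a i h c (z (circleMid a i h)) := by
  have w₀ : (Tangle.circle a i h).word[0]? = some (.create i) := rfl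
  have w₁ : (Tangle.circle a i h).word[1]? = some (.join i) := rfl
  have left₁ : ∀ j (hj : j < i), c j =
      z (circlePoint a i h 1 j (by omega) (by rw [if_pos rfl]; omega)) :=
    fun j hj => (hc j (by omega)).symm.trans (hz _ _ ⟨0, _, w₀, .create_left _ _ _ hj⟩)
  have right₁ : ∀ j (hj : i ≤ j) (hj' : j < a), c j =
      z (circlePoint a i h 1 (j + 2) (by omega) (by rw [if_pos rfl]; omega)) :=
    fun j hj hj' => (hc j hj').symm.trans (hz _ _ ⟨0, _, w₀, .create_right _ _ _ hj⟩)
  have left₂ : ∀ j (hj : j < i),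
      z (circlePoint a i h 1 j (by omega) (by rw [if_pos rfl]; omega)) =
      z (circlePoint a i h 2 j (by omega) (by rw [if_neg (by omega)]; omega)) :=
    fun j hj => hz _ _ ⟨1, _, w₁, .join_left _ _ _ hj⟩
  have right₂ : ∀ j (hj : i ≤ j) (hj' : j < a),
      z (circlePoint a i h 1 (j + 2) (by omega) (by rw [if_pos rfl]; omega)) =
      z (circlePoint a i h 2 j (by omega) (by rw [if_neg (by omega)]; omega)) :=
    fun j hj _ => hz _ _ ⟨1, _, w₁, .join_right _ _ _ hj⟩
  have mid : z (circleMid a i h) =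
      z (circlePoint a i h 1 (i + 1) (by omega) (by rw [if_pos rfl]; omega)) :=
    hz _ _ ⟨0, _, w₀, .create_arc _ _⟩
  funext ⟨⟨t, j⟩, hp⟩
  have hp' := hp
  rw [widthAt_circle] at hp'
  simp only at hp'
  obtain rfl | rfl | rfl : t = 0 ∨ t = 1 ∨ t = 2 := by
    split_ifs at hp' <;> omega
  · exact hc j (by simpa using hp')
  · simp only [circleColoring, if_true]
    split_ifs with e e'
    · exact (left₁ j e).symm
    · obtain rfl | rfl : j = i ∨ j = i + 1 := by omega
      · rfl
      · exact mid.symm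
    · obtain ⟨k, rfl⟩ : ∃ k, j = k + 2 := ⟨j - 2, by omega⟩
      simp at hp'
      exact (right₁ k (by omega) hp').symm
  · simp at hp'
    change _ = c j
    rcases lt_or_ge j i with hj | hj
    · exact ((left₁ j hj).trans (left₂ j hj)).symm
    · exact ((right₁ j hj hp').trans (right₂ j hj hp')).symm

/-- A function with the same colors as `z` at the end points on the top. -/
theorem exists_top_eq {b : ℕ} {D : Tangle a b} (z : D.Point → Bool) :
    ∃ c : ℕ → Bool, ∀ j hj, z (D.top j hj) = c j :=
  ⟨fun j => if hj : j < a then z (D.top j hj) else true, fun j hj => by simp [hj]⟩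

theorem Tangle.IsColoring.circle_bot {z : (Tangle.circle a i h).Point → Bool}
    (hz : (Tangle.circle a i h).IsColoring z) (j : ℕ) (hj : j < a) :
    z ((Tangle.circle a i h).bot j hj) = z ((Tangle.circle a i h).top j hj) := by
  obtain ⟨c, hc⟩ := exists_top_eq z
  rw [eq_circleColoring hz hc]
  rfl

end Circle

section

variable {m n a : ℕ} (u : Tangle m a) (v : Tangle a n) (i : ℕ) (h : i ≤ a)

/-- The restriction of a coloring to the complement of a small circle. -/
def forgetCircle (y : (u.stack ((Tangle.circle a i h).stack v)).Point → Bool) :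
    (u.stack v).Point → Bool :=
  u.glueColoring v (y ∘ u.inl _) ((y ∘ u.inr _) ∘ (Tangle.circle a i h).inr v)

/-- The color of a small circle. -/
def circleColor (y : (u.stack ((Tangle.circle a i h).stack v)).Point → Bool) : Bool :=
  y (u.inr _ ((Tangle.circle a i h).inl v (circleMid a i h)))

variable {u v i h}

theorem forgetCircle_inl (y : (u.stack ((Tangle.circle a i h).stack v)).Point → Bool) :
    forgetCircle u v i h y ∘ u.inl v = y ∘ u.inl _ := u.glueColoring_inl v _ _

variable {y y' : (u.stack ((Tangle.circle a i h).stack v)).Point → Bool}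

theorem forgetCircle_inr (hy : (u.stack ((Tangle.circle a i h).stack v)).IsColoring y) :
    forgetCircle u v i h y ∘ u.inr v = (y ∘ u.inr _) ∘ (Tangle.circle a i h).inr v := by
  rw [Tangle.isColoring_stack, Tangle.isColoring_stack] at hy
  exact u.glueColoring_inr v _ _ fun j hj => (hy.2.1.circle_bot j hj).symm

theorem isColoring_forgetCircle (hy : (u.stack ((Tangle.circle a i h).stack v)).IsColoring y) :
    (u.stack v).IsColoring (forgetCircle u v i h y) := by
  rw [Tangle.isColoring_stack, forgetCircle_inl, forgetCircle_inr hy]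
  rw [Tangle.isColoring_stack, Tangle.isColoring_stack] at hy
  exact ⟨hy.1, hy.2.2⟩

theorem eq_of_forgetCircle_eq (hy : (u.stack ((Tangle.circle a i h).stack v)).IsColoring y)
    (hy' : (u.stack ((Tangle.circle a i h).stack v)).IsColoring y')
    (e : forgetCircle u v i h y = forgetCircle u v i h y')
    (e' : circleColor u v i h y = circleColor u v i h y') : y = y' := by
  have el : y ∘ u.inl _ = y' ∘ u.inl _ := by
    rw [← forgetCircle_inl, e, forgetCircle_inl]
  have er : (y ∘ u.inr _) ∘ (Tangle.circle a i h).inr v =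
      (y' ∘ u.inr _) ∘ (Tangle.circle a i h).inr v := by
    rw [← forgetCircle_inr hy, e, forgetCircle_inr hy']
  rw [Tangle.isColoring_stack, Tangle.isColoring_stack] at hy hy'
  refine u.stack_ext _ el ((Tangle.circle a i h).stack_ext v ?_ er)
  obtain ⟨c, hc⟩ := exists_top_eq ((y ∘ u.inr _) ∘ (Tangle.circle a i h).inl v)
  have hc' : ∀ j hj, ((y' ∘ u.inr _) ∘ (Tangle.circle a i h).inl v)
      ((Tangle.circle a i h).top j hj) = c j := fun j hj =>
    (congrFun el (u.bot j hj)).symm.trans (hc j hj)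
  rw [eq_circleColoring hy.2.1 hc, eq_circleColoring hy'.2.1 hc']
  exact congrArg _ e'

theorem exists_forgetCircle_eq {x : (u.stack v).Point → Bool} (hx : (u.stack v).IsColoring x)
    (ε : Bool) : ∃ y, (u.stack ((Tangle.circle a i h).stack v)).IsColoring y ∧
      forgetCircle u v i h y = x ∧ circleColor u v i h y = ε := by
  obtain ⟨c, hc⟩ := exists_top_eq (x ∘ u.inr v)
  let z := circleColoring a i h c ε
  have b₁ : ∀ j hj, z ((Tangle.circle a i h).bot j hj) = (x ∘ u.inr v) (v.top j hj) :=
    fun j hj => (hc j hj).symm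
  let w := (Tangle.circle a i h).glueColoring v z (x ∘ u.inr v)
  have wl : w ∘ (Tangle.circle a i h).inl v = z := Tangle.glueColoring_inl _ _ _ _
  have wr : w ∘ (Tangle.circle a i h).inr v = x ∘ u.inr v := Tangle.glueColoring_inr _ _ _ _ b₁
  have b₂ : ∀ j hj, (x ∘ u.inl v) (u.bot j hj) =
      w (((Tangle.circle a i h).stack v).top j hj) := fun j hj => by
    refine Eq.trans (hc j hj) ?_
    change z ((Tangle.circle a i h).top j hj) = _
    rw [← wl]
    rfl
  let y := u.glueColoring _ (x ∘ u.inl v) w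
  have yl : y ∘ u.inl _ = x ∘ u.inl v := Tangle.glueColoring_inl _ _ _ _
  have yr : y ∘ u.inr _ = w := Tangle.glueColoring_inr _ _ _ _ b₂
  have hy : (u.stack ((Tangle.circle a i h).stack v)).IsColoring y := by
    rw [Tangle.isColoring_stack, Tangle.isColoring_stack, yl, yr, wl, wr]
    rw [Tangle.isColoring_stack] at hx
    exact ⟨hx.1, isColoring_circleColoring c ε, hx.2⟩
  refine ⟨y, hy, u.stack_ext v ?_ ?_, ?_⟩
  · rw [forgetCircle_inl, yl]
  · rw [forgetCircle_inr hy, yr, wr]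
  · change (y ∘ u.inr _) _ = _
    rw [yr]
    change (w ∘ (Tangle.circle a i h).inl v) _ = _
    rw [wl]
    simp [z, circleColoring, circleMid, circlePoint]

variable (u v i h)

/-- The elementary cobordism `birth u v i h`. -/
abbrev birthMove : Move (u.stack v) (u.stack ((Tangle.circle a i h).stack v)) :=
  { u := u, s := .one a, t := .circle a i h, v := v, loc := .birth i h, src := rfl, tgt := rfl }

/-- The elementary cobordism `death u v i h`. -/
abbrev deathMove : Move (u.stack ((Tangle.circle a i h).stack v)) (u.stack v) :=
  { u := u, s := .circle a i h, t := .one a, v := v, loc := .death i h, src := rfl, tgt := rfl }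

/-- The elementary cobordism `dot u v i h`. -/
abbrev dotMove : Move (u.stack ((Tangle.circle a i h).stack v))
    (u.stack ((Tangle.circle a i h).stack v)) :=
  { u := u.stack (.createArc a i h), s := .one _, t := .one _, v := (Tangle.joinArc a i h).stack v
    loc := .dot i (by omega)
    src := Tangle.ext (by simp [Tangle.stack, Tangle.circle, Tangle.one])
    tgt := Tangle.ext (by simp [Tangle.stack, Tangle.circle, Tangle.one]) }

variable {u v i h}

theorem compat_birthMove_iff {x : (u.stack v).Point → Bool} : (birthMove u v i h).Compat x y ↔
    (u.stack ((Tangle.circle a i h).stack v)).IsColoring y ∧ x = forgetCircle u v i h y := by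
  constructor
  · rintro ⟨hx, hy, e⟩
    refine ⟨hy, u.stack_ext v ?_ ?_⟩
    · rw [forgetCircle_inl]
      exact funext fun p => e _ _ (.above _ _ p.level_le rfl)
    · rw [forgetCircle_inr hy]
      refine funext fun p => e _ _ (.below _ _ p.1.1 p.1.2 (Prod.ext ?_ rfl) (Prod.ext ?_ rfl))
      · rfl
      · change u.word.length + (2 + p.1.1) = u.word.length + 2 + p.1.1
        omega
  · rintro ⟨hy, rfl⟩
    refine ⟨isColoring_forgetCircle hy, hy, fun p q hpq => ?_⟩
    cases hpq with
    | above hp e =>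
      exact (congrFun (forgetCircle_inl y) (u.toLeft v p hp)).trans
        (congrArg y (Tangle.Point.ext e.symm))
    | below k j hp hq =>
      change p.1 = (u.word.length + 0 + k, j) at hp
      change q.1 = (u.word.length + 2 + k, j) at hq
      have e := u.inr_toRight v p (by rw [hp]; simp only; omega)
      rw [← e]
      refine (congrFun (forgetCircle_inr hy) _).trans (congrArg y (Tangle.Point.ext ?_))
      rw [hq]
      refine Prod.ext ?_ (congrArg Prod.snd hp : p.1.2 = _)
      change u.word.length + (2 + (p.1.1 - u.word.length)) = _
      rw [hp]
      simp only
      omega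

theorem track_deathMove_iff (p : (u.stack v).Point)
    (q : (u.stack ((Tangle.circle a i h).stack v)).Point) :
    (deathMove u v i h).Track q p ↔ (birthMove u v i h).Track p q := by
  constructor
  · rintro (⟨h, e⟩ | ⟨k, j, hp, hq⟩)
    · exact .above _ _ (e ▸ h) e.symm
    · exact .below _ _ k j hq hp
  · rintro (⟨h, e⟩ | ⟨k, j, hp, hq⟩)
    · exact .above _ _ (e ▸ h) e.symm
    · exact .below _ _ k j hq hp

theorem compat_deathMove_iff {x : (u.stack v).Point → Bool} : (deathMove u v i h).Compat y x ↔
    (u.stack ((Tangle.circle a i h).stack v)).IsColoring y ∧ x = forgetCircle u v i h y := by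
  rw [← compat_birthMove_iff]
  exact ⟨fun ⟨hy, hx, e⟩ => ⟨hx, hy, fun p q t => (e q p ((track_deathMove_iff p q).2 t)).symm⟩,
    fun ⟨hx, hy, e⟩ => ⟨hy, hx, fun q p t => (e p q ((track_deathMove_iff p q).1 t)).symm⟩⟩

theorem compat_dotMove_iff : (dotMove u v i h).Compat y y' ↔
    (u.stack ((Tangle.circle a i h).stack v)).IsColoring y ∧ y = y' := by
  constructor
  · rintro ⟨hy, -, e⟩
    refine ⟨hy, funext fun p => ?_⟩
    rcases le_total p.1.1 (dotMove u v i h).u.word.length with hp | hp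
    · exact e _ _ (.above _ _ hp rfl)
    · exact e _ _ (.below _ _ (p.1.1 - (dotMove u v i h).u.word.length) p.1.2
        (Prod.ext (Nat.add_sub_of_le hp).symm rfl) (Prod.ext (Nat.add_sub_of_le hp).symm rfl))
  · rintro ⟨hy, rfl⟩
    refine ⟨hy, hy, fun p q hpq => congrArg y (Tangle.Point.ext ?_)⟩
    cases hpq with
    | above hp e => exact e.symm
    | below k j hp hq => exact hp.trans hq.symm

end

end LocalRelations

section Relations

open scoped Classical

section

variable {m n a : ℕ} (u : Tangle m a) (v : Tangle a n) (i : ℕ) (h : i ≤ a)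

/-- A multiple of the state sums of a birth, where the factor `φ ε` depends on the color `ε` of
the circle. -/
noncomputable def birthMatrix (φ : Bool → StateField) :
    StateMatrix (u.stack v) (u.stack ((Tangle.circle a i h).stack v)) :=
  .of fun x y => if (u.stack ((Tangle.circle a i h).stack v)).IsColoring y ∧
    x = forgetCircle u v i h y then φ (circleColor u v i h y) else 0

/-- A multiple of the state sums of a death, where the factor `φ ε` depends on the color `ε` of
the circle. -/
noncomputable def deathMatrix (φ : Bool → StateField) :
    StateMatrix (u.stack ((Tangle.circle a i h).stack v)) (u.stack v) :=
  .of fun y x => if (u.stack ((Tangle.circle a i h).stack v)).IsColoring y ∧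
    x = forgetCircle u v i h y then φ (circleColor u v i h y) else 0

/-- A diagonal matrix whose entries depend on the color of the circle. -/
noncomputable def dotMatrix (φ : Bool → StateField) :
    StateMatrix (u.stack ((Tangle.circle a i h).stack v))
      (u.stack ((Tangle.circle a i h).stack v)) :=
  .of fun y y' => if (u.stack ((Tangle.circle a i h).stack v)).IsColoring y ∧ y = y' then
    φ (circleColor u v i h y) else 0

theorem stateMatrix_birth : Movie.stateMatrix (birth u v i h) = birthMatrix u v i h sphereRoot := by
  refine (Move.stateMatrix_toPath (birthMove u v i h)).trans ?_
  funext x y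
  rw [Move.stateMatrix_apply]
  refine if_congr compat_birthMove_iff ?_ rfl
  change markWeight (y ((birthMove u v i h).tgtMid i h rfl)) (1, 0) * 1 = _
  simp [markWeight]
  rfl

theorem stateMatrix_death : Movie.stateMatrix (death u v i h) = deathMatrix u v i h sphereRoot := by
  refine (Move.stateMatrix_toPath (deathMove u v i h)).trans ?_
  funext y x
  rw [Move.stateMatrix_apply]
  refine if_congr compat_deathMove_iff ?_ rfl
  change markWeight (y ((deathMove u v i h).srcMid i h rfl)) (1, 0) * 1 = _
  simp [markWeight]
  rfl

theorem stateMatrix_dot : Movie.stateMatrix (dot u v i h) = dotMatrix u v i h dotSign := by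
  refine (Move.stateMatrix_toPath (dotMove u v i h)).trans ?_
  funext y y'
  rw [Move.stateMatrix_apply]
  refine if_congr compat_dotMove_iff ?_ rfl
  change markWeight (y ((dotMove u v i h).srcTop i _)) (0, 1) * 1 = _
  simp [markWeight]
  refine congrArg dotSign (congrArg y (Tangle.Point.ext (Prod.ext ?_ rfl)))
  exact Tangle.length_stack _ _

variable {u v i h} (φ ψ : Bool → StateField)

theorem birthMatrix_mul_dotMatrix :
    birthMatrix u v i h φ * dotMatrix u v i h ψ = birthMatrix u v i h fun b => φ b * ψ b := by
  funext x y
  rw [Matrix.mul_apply, Finset.sum_eq_single y (fun y' _ hy => ?_) (by simp)]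
  · simp only [birthMatrix, dotMatrix, Matrix.of_apply]
    split_ifs with h₁ h₂ h₂
    · rfl
    · exact (h₂ ⟨h₁.1, trivial⟩).elim
    · exact zero_mul _
    · exact zero_mul _
  · simp only [dotMatrix, Matrix.of_apply]
    rw [if_neg fun e => hy e.2, mul_zero]

theorem dotMatrix_mul_deathMatrix :
    dotMatrix u v i h φ * deathMatrix u v i h ψ = deathMatrix u v i h fun b => φ b * ψ b := by
  funext y x
  rw [Matrix.mul_apply, Finset.sum_eq_single y (fun y' _ hy => ?_) (by simp)]
  · simp only [deathMatrix, dotMatrix, Matrix.of_apply]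
    split_ifs with h₁ h₂ h₂
    · rfl
    · exact mul_zero _
    · exact (h₁ ⟨h₂.1, trivial⟩).elim
    · exact zero_mul _
  · simp only [dotMatrix, Matrix.of_apply]
    rw [if_neg fun e => hy e.2.symm, zero_mul]

theorem birthMatrix_mul_deathMatrix :
    birthMatrix u v i h φ * deathMatrix u v i h ψ =
      (∑ b, φ b * ψ b) • Movie.stateMatrix (.nil : Movie (u.stack v) _) := by
  funext x z
  rw [Matrix.smul_apply, Movie.stateMatrix_nil, Matrix.mul_apply]
  simp only [birthMatrix, deathMatrix, Matrix.of_apply]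
  by_cases hx : x = z ∧ (u.stack v).IsColoring x
  · obtain ⟨rfl, hx⟩ := hx
    rw [if_pos ⟨rfl, hx⟩, smul_eq_mul, mul_one]
    simp only [ite_mul_ite, mul_zero]
    rw [← Finset.sum_filter]
    choose y hy e e' using exists_forgetCircle_eq (i := i) (h := h) hx
    refine Finset.sum_nbij' (circleColor u v i h) y (fun _ _ => Finset.mem_univ _)
      (fun b _ => ?_) (fun y' hy' => ?_) (fun b _ => e' b) (fun _ _ => rfl)
    · exact Finset.mem_filter.2 ⟨Finset.mem_univ _, hy b, (e b).symm⟩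
    · obtain ⟨-, h₁, h₂⟩ := Finset.mem_filter.1 hy'
      exact eq_of_forgetCircle_eq (hy _) h₁ ((e _).trans h₂) (e' _)
  · rw [if_neg hx, smul_zero]
    refine Finset.sum_eq_zero fun y _ => ?_
    split_ifs with h₁ h₂
    · exact (hx ⟨h₁.2.trans h₂.2.symm, h₁.2 ▸ isColoring_forgetCircle h₁.1⟩).elim
    · exact mul_zero _
    · exact zero_mul _
    · exact zero_mul _

theorem deathMatrix_mul_birthMatrix
    (y y' : (u.stack ((Tangle.circle a i h).stack v)).Point → Bool) :
    (deathMatrix u v i h φ * birthMatrix u v i h ψ) y y' =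
      if (u.stack ((Tangle.circle a i h).stack v)).IsColoring y ∧
        (u.stack ((Tangle.circle a i h).stack v)).IsColoring y' ∧
          forgetCircle u v i h y = forgetCircle u v i h y' then
        φ (circleColor u v i h y) * ψ (circleColor u v i h y') else 0 := by
  rw [Matrix.mul_apply, Finset.sum_eq_single (forgetCircle u v i h y) (fun x _ hx => ?_) (by simp)]
  · simp only [birthMatrix, deathMatrix, Matrix.of_apply, and_true]
    by_cases h₁ : (u.stack ((Tangle.circle a i h).stack v)).IsColoring y
    · simp [h₁]
    · simp [h₁]
  · simp only [deathMatrix, Matrix.of_apply]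
    rw [if_neg fun e => hx e.2, zero_mul]

/-- For two colorings which agree outside of a small circle, the sum of the values of the two
cobordisms with a cut neck is `1` if the circle has the same color in both, and otherwise `0`. -/
theorem neck_stateMatrix :
    Movie.stateMatrix (.nil : Movie (u.stack ((Tangle.circle a i h).stack v)) _) =
      Movie.stateMatrix (((dot u v i h).comp (death u v i h)).comp (birth u v i h)) +
        Movie.stateMatrix (((death u v i h).comp (birth u v i h)).comp (dot u v i h)) := by
  rw [Movie.stateMatrix_comp, Movie.stateMatrix_comp, Movie.stateMatrix_comp,
    Movie.stateMatrix_comp, stateMatrix_birth, stateMatrix_death, stateMatrix_dot,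
    dotMatrix_mul_deathMatrix, Matrix.mul_assoc, birthMatrix_mul_dotMatrix]
  funext y y'
  rw [Movie.stateMatrix_nil, Matrix.add_apply, deathMatrix_mul_birthMatrix,
    deathMatrix_mul_birthMatrix]
  have key : ∀ b b', (dotSign b * sphereRoot b) * sphereRoot b' +
      sphereRoot b * (sphereRoot b' * dotSign b') = if b = b' then 1 else 0 := by decide
  by_cases hc : (u.stack ((Tangle.circle a i h).stack v)).IsColoring y ∧
      (u.stack ((Tangle.circle a i h).stack v)).IsColoring y' ∧
        forgetCircle u v i h y = forgetCircle u v i h y'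
  · rw [if_pos hc, if_pos hc, key]
    refine if_congr ⟨fun e => by rw [e.1], fun e => ?_⟩ rfl rfl
    exact ⟨eq_of_forgetCircle_eq hc.1 hc.2.1 hc.2.2 e, hc.1⟩
  · rw [if_neg hc, if_neg hc, if_neg, add_zero]
    rintro ⟨rfl, hy⟩
    exact hc ⟨hy, hy, rfl⟩

end

/-! ### The state sums of linear combinations of cobordisms -/

/-- The homomorphism from the ground ring with `α ↦ 1`. -/
noncomputable def evalGround : Ground →+* StateField :=
  Polynomial.eval₂RingHom (Int.castRingHom _) 1

theorem evalGround_α : evalGround α = 1 := by simp [evalGround]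

variable {m n : ℕ}

section

variable {D E F : Tangle m n}

/-- The state sums of a linear combination of cobordisms. -/
noncomputable def formalStateMatrix : (Formal.of D ⟶ Formal.of E) →+ StateMatrix D E :=
  Finsupp.liftAddHom fun p => ((AddMonoidHom.flip (smulAddHom StateField (StateMatrix _ _)))
    (Movie.stateMatrix p)).comp evalGround.toAddMonoidHom

theorem formalStateMatrix_formal (p : Movie D E) (r : Ground) :
    formalStateMatrix (formal p r) = evalGround r • p.stateMatrix :=
  Finsupp.liftAddHom_apply_single _ _ _

theorem formal_induction {P : (Formal.of D ⟶ Formal.of E) → Prop} (f : Formal.of D ⟶ Formal.of E)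
    (zero : P 0) (add : ∀ f g, P f → P g → P (f + g)) (of : ∀ (p : Movie D E) r, P (formal p r)) :
    P f :=
  Finsupp.induction_linear f zero (fun f g hf hg => add f g hf hg) of

theorem smul_formal (r s : Ground) (p : Movie D E) : r • formal p s = formal p (r * s) :=
  Finsupp.smul_single _ _ _

theorem formalStateMatrix_smul (r : Ground) (f : Formal.of D ⟶ Formal.of E) :
    formalStateMatrix (r • f) = evalGround r • formalStateMatrix f := by
  induction f using formal_induction with
  | zero => rw [smul_zero, map_zero, smul_zero]
  | add f g hf hg => rw [smul_add, map_add, hf, hg, map_add, smul_add]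
  | of p s =>
    rw [smul_formal, formalStateMatrix_formal, formalStateMatrix_formal, map_mul, smul_smul]

theorem formal_comp_formal (p : Movie D E) (q : Movie E F) (r s : Ground) :
    formal p r ≫ formal q s = formal (Quiver.Path.comp p q) (r * s) :=
  Free.single_comp_single _ _ _ _ _ _

theorem formalStateMatrix_comp (f : Formal.of D ⟶ Formal.of E) (g : Formal.of E ⟶ Formal.of F) :
    formalStateMatrix (f ≫ g) = formalStateMatrix f * formalStateMatrix g := by
  induction f using formal_induction with
  | zero => rw [Limits.zero_comp, map_zero, map_zero, Matrix.zero_mul]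
  | add f f' hf hf' => rw [Preadditive.add_comp, map_add, hf, hf', map_add, Matrix.add_mul]
  | of p r =>
    induction g using formal_induction with
    | zero => rw [Limits.comp_zero, map_zero, map_zero, Matrix.mul_zero]
    | add f f' hf hf' => rw [Preadditive.comp_add, map_add, hf, hf', map_add, Matrix.mul_add]
    | of q s =>
      rw [formal_comp_formal, formalStateMatrix_formal, formalStateMatrix_formal,
        formalStateMatrix_formal, Movie.stateMatrix_comp, map_mul, Matrix.smul_mul,
        Matrix.mul_smul, smul_smul]

theorem formalStateMatrix_whiskerLeft {k : ℕ} (F : Tangle k m) (f : Formal.of D ⟶ Formal.of E) :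
    formalStateMatrix (D := F.stack D) (E := F.stack E) ((formalWhiskerLeft F n).map f) =
      StateMatrix.whiskerLeft F (formalStateMatrix f) := by
  induction f using formal_induction with
  | zero =>
    refine (congrArg formalStateMatrix (Functor.map_zero (formalWhiskerLeft F n) _ _)).trans ?_
    exact (map_zero (formalStateMatrix (D := F.stack D) (E := F.stack E))).trans
      ((congrArg (StateMatrix.whiskerLeft F) (map_zero formalStateMatrix)).trans
        (map_zero _)).symm
  | add f f' hf hf' =>
    refine (congrArg formalStateMatrix
      (Functor.map_add (formalWhiskerLeft F n) (f := f) (g := f'))).trans ?_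
    refine (map_add (formalStateMatrix (D := F.stack D) (E := F.stack E)) _ _).trans ?_
    refine (congrArg₂ (· + ·) hf hf').trans ?_
    rw [map_add, map_add]
  | of p r =>
    refine (congrArg formalStateMatrix (formalWhiskerLeft_map_formal F p r)).trans ?_
    refine (formalStateMatrix_formal (D := F.stack D) (E := F.stack E) _ _).trans ?_
    rw [formalStateMatrix_formal, Movie.stateMatrix_whiskerLeft]
    funext x y
    rw [Matrix.smul_apply, StateMatrix.whiskerLeft_apply, StateMatrix.whiskerLeft_apply, smul_ite,
      smul_zero, Matrix.smul_apply]

theorem formalStateMatrix_whiskerRight {k : ℕ} (F : Tangle n k) (f : Formal.of D ⟶ Formal.of E) :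
    formalStateMatrix (D := D.stack F) (E := E.stack F) ((formalWhiskerRight m F).map f) =
      StateMatrix.whiskerRight F (formalStateMatrix f) := by
  induction f using formal_induction with
  | zero =>
    refine (congrArg formalStateMatrix (Functor.map_zero (formalWhiskerRight m F) _ _)).trans ?_
    exact (map_zero (formalStateMatrix (D := D.stack F) (E := E.stack F))).trans
      ((congrArg (StateMatrix.whiskerRight F) (map_zero formalStateMatrix)).trans
        (map_zero _)).symm
  | add f f' hf hf' =>
    refine (congrArg formalStateMatrix
      (Functor.map_add (formalWhiskerRight m F) (f := f) (g := f'))).trans ?_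
    refine (map_add (formalStateMatrix (D := D.stack F) (E := E.stack F)) _ _).trans ?_
    refine (congrArg₂ (· + ·) hf hf').trans ?_
    rw [map_add, map_add]
  | of p r =>
    refine (congrArg formalStateMatrix (formalWhiskerRight_map_formal F p r)).trans ?_
    refine (formalStateMatrix_formal (D := D.stack F) (E := E.stack F) _ _).trans ?_
    rw [formalStateMatrix_formal, Movie.stateMatrix_whiskerRight]
    funext x y
    rw [Matrix.smul_apply, StateMatrix.whiskerRight_apply, StateMatrix.whiskerRight_apply,
      smul_ite, smul_zero, Matrix.smul_apply]

end

/-- The state sums are invariants of cobordisms modulo the local relations. -/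
theorem Rel.formalStateMatrix_eq {D E : Formal m n} {f g : D ⟶ E} (h : Rel f g) :
    formalStateMatrix (D := D) (E := E) f = formalStateMatrix (D := D) (E := E) g := by
  induction h with
  | homeo p q h =>
    rw [formalStateMatrix_formal, formalStateMatrix_formal]
    exact congrArg (fun A => evalGround 1 • Matrix.of A) (Surface.stateSum_homeomorphic h)
  | sphere u v i h =>
    rw [formalStateMatrix_formal, Movie.stateMatrix_comp, stateMatrix_birth, stateMatrix_death,
      birthMatrix_mul_deathMatrix, map_zero,
      show (∑ b, sphereRoot b * sphereRoot b) = 0 by decide, zero_smul, smul_zero]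
  | sphere_dot u v i h =>
    rw [formalStateMatrix_formal, formalStateMatrix_formal, Movie.stateMatrix_comp,
      Movie.stateMatrix_comp, stateMatrix_birth, stateMatrix_death, stateMatrix_dot,
      birthMatrix_mul_dotMatrix, birthMatrix_mul_deathMatrix,
      show (∑ b, sphereRoot b * dotSign b * sphereRoot b) = 1 by decide, one_smul]
  | sphere_dot_dot u v i h =>
    rw [formalStateMatrix_formal, Movie.stateMatrix_comp, Movie.stateMatrix_comp,
      Movie.stateMatrix_comp, stateMatrix_birth, stateMatrix_death, stateMatrix_dot,
      birthMatrix_mul_dotMatrix, birthMatrix_mul_dotMatrix, birthMatrix_mul_deathMatrix, map_zero,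
      show (∑ b, sphereRoot b * dotSign b * dotSign b * sphereRoot b) = 0 by decide, zero_smul,
      smul_zero]
  | sphere_dot_dot_dot u v i h =>
    rw [formalStateMatrix_formal, formalStateMatrix_formal, Movie.stateMatrix_comp,
      Movie.stateMatrix_comp, Movie.stateMatrix_comp, Movie.stateMatrix_comp, stateMatrix_birth,
      stateMatrix_death, stateMatrix_dot, birthMatrix_mul_dotMatrix, birthMatrix_mul_dotMatrix,
      birthMatrix_mul_dotMatrix, birthMatrix_mul_deathMatrix,
      show (∑ b, sphereRoot b * dotSign b * dotSign b * dotSign b * sphereRoot b) = 1 by decide,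
      one_smul, evalGround_α, map_one]
  | neck u v i h =>
    rw [map_add, formalStateMatrix_formal, formalStateMatrix_formal, formalStateMatrix_formal,
      ← smul_add, ← neck_stateMatrix]
  | refl f => rfl
  | symm _ ih => exact ih.symm
  | trans _ _ ih ih' => exact ih.trans ih'
  | add _ _ ih ih' =>
    refine (map_add formalStateMatrix _ _).trans (Eq.trans ?_ (map_add formalStateMatrix _ _).symm)
    exact congrArg₂ _ ih ih'
  | smul r _ ih =>
    refine (formalStateMatrix_smul r _).trans (Eq.trans ?_ (formalStateMatrix_smul r _).symm)
    exact congrArg _ ih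
  | comp _ _ ih ih' =>
    refine (formalStateMatrix_comp _ _).trans (Eq.trans ?_ (formalStateMatrix_comp _ _).symm)
    exact congrArg₂ _ ih ih'
  | whiskerLeft F _ ih =>
    refine (formalStateMatrix_whiskerLeft F _).trans
      (Eq.trans ?_ (formalStateMatrix_whiskerLeft F _).symm)
    exact congrArg _ ih
  | whiskerRight F _ ih =>
    refine (formalStateMatrix_whiskerRight F _).trans
      (Eq.trans ?_ (formalStateMatrix_whiskerRight F _).symm)
    exact congrArg _ ih

end Relations

/-! ### Naturality of elementary cobordisms -/

section Natural

variable {k l m n : ℕ}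

theorem Rel.comp_formal {D E F : Tangle m n} {p p' : Movie D E} {q q' : Movie E F}
    (h : Rel (formal p 1) (formal p' 1)) (h' : Rel (formal q 1) (formal q' 1)) :
    Rel (formal (Quiver.Path.comp p q) 1) (formal (Quiver.Path.comp p' q') 1) := by
  have e : ∀ (p : Movie D E) (q : Movie E F),
      formal p 1 ≫ formal q 1 = formal (Quiver.Path.comp p q) 1 := fun p q => by
    rw [formal_comp_formal, mul_one]
  have := Rel.comp h h'
  rwa [e, e] at this

/-- An elementary cobordism `A ⟶ B` above and a cobordism `D ⟶ E` below it may be exchanged in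
time. -/
theorem Rel.interchange {A B : Tangle k m} {D E : Tangle m n} (M : Move A B) (p : Movie D E) :
    Rel (formal (Quiver.Path.comp (p.whiskerLeft A) (Quiver.Hom.toPath (M.whiskerRight E))) 1)
      (formal (Quiver.Path.comp (Quiver.Hom.toPath (M.whiskerRight D)) (p.whiskerLeft B)) 1) := by
  induction p with
  | nil =>
    have e : Quiver.Path.comp (Movie.whiskerLeft A (.nil : Movie D D))
        (Quiver.Hom.toPath (M.whiskerRight D)) = Quiver.Hom.toPath (M.whiskerRight D) :=
      Quiver.Path.nil_comp _
    rw [e]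
    exact Rel.refl _
  | @cons E E' p N ih =>
    have h₁ : Rel (formal (twoSteps (N.whiskerLeft A) (M.whiskerRight E')) 1)
        (formal (twoSteps (M.whiskerRight E) (N.whiskerLeft B)) 1) :=
      (Rel.homeo _ _ (homeomorphic_interchange M N)).symm
    have h₂ := Rel.comp_formal (Rel.refl (formal (Movie.whiskerLeft A p) 1)) h₁
    have h₃ := Rel.comp_formal ih (Rel.refl (formal (Quiver.Hom.toPath (N.whiskerLeft B)) 1))
    exact h₂.trans h₃

/-- A diagram as an object of the category of cobordisms modulo the local relations. -/
noncomputable abbrev Tangle.toCob (D : Tangle m n) : UngradedCob m n :=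
  (Quotient.functor (rel m n)).obj (Formal.of D)

/-- A multiple of a cobordism modulo the local relations. -/
noncomputable def Movie.cob {D E : Tangle m n} (p : Movie D E) (r : Ground) : D.toCob ⟶ E.toCob :=
  (Quotient.functor (rel m n)).map (formal p r)

theorem Movie.cob_eq {D E : Tangle m n} {p q : Movie D E} (h : Rel (formal p 1) (formal q 1))
    (r : Ground) : p.cob r = q.cob r := by
  have e : ∀ p : Movie D E, formal p r = r • formal p 1 := fun p => by rw [smul_formal, mul_one]
  rw [cob, cob, e, e]
  exact CategoryTheory.Quotient.sound _ (Rel.smul r h)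

theorem Movie.cob_comp {D E F : Tangle m n} (p : Movie D E) (q : Movie E F) (r s : Ground) :
    p.cob r ≫ q.cob s = Movie.cob (Quiver.Path.comp p q) (r * s) := by
  rw [cob, cob, cob, ← Functor.map_comp, formal_comp_formal]

theorem Movie.cob_nil (D : Tangle m n) : Movie.cob (.nil : Movie D D) 1 = 𝟙 _ :=
  (Quotient.functor (rel m n)).map_id _

/-- The morphisms are sums of multiples of cobordisms. -/
theorem cob_induction {D E : Tangle m n} {P : (D.toCob ⟶ E.toCob) → Prop} (f : D.toCob ⟶ E.toCob)
    (zero : P 0) (add : ∀ f g, P f → P g → P (f + g))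
    (of : ∀ (p : Movie D E) r, P (p.cob r)) : P f := by
  obtain ⟨f, rfl⟩ := (Quotient.functor (rel m n)).map_surjective f
  induction f using formal_induction with
  | zero => rw [Functor.map_zero]; exact zero
  | add f g hf hg => rw [Functor.map_add]; exact add _ _ hf hg
  | of p r => exact of p r

/-- Stacking `F` on top of cobordisms modulo the local relations. -/
noncomputable def whiskerLeft (F : Tangle k m) {D E : Tangle m n} :
    (D.toCob ⟶ E.toCob) →+ ((F.stack D).toCob ⟶ (F.stack E).toCob) :=
  (ungradedWhiskerLeft F n).mapAddHom

/-- Stacking `F` below cobordisms modulo the local relations. -/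
noncomputable def whiskerRight (F : Tangle n k) {D E : Tangle m n} :
    (D.toCob ⟶ E.toCob) →+ ((D.stack F).toCob ⟶ (E.stack F).toCob) :=
  (ungradedWhiskerRight m F).mapAddHom

theorem whiskerLeft_cob (F : Tangle k m) {D E : Tangle m n} (p : Movie D E) (r : Ground) :
    whiskerLeft F (p.cob r) = Movie.cob (Movie.whiskerLeft F p) r :=
  congrArg (Quotient.functor (rel k n)).map (formalWhiskerLeft_map_formal F p r)

theorem whiskerRight_cob (F : Tangle n k) {D E : Tangle m n} (p : Movie D E) (r : Ground) :
    whiskerRight F (p.cob r) = Movie.cob (Movie.whiskerRight F p) r :=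
  congrArg (Quotient.functor (rel m k)).map (formalWhiskerRight_map_formal F p r)

theorem whiskerLeft_id (F : Tangle k m) (D : Tangle m n) : whiskerLeft F (𝟙 D.toCob) = 𝟙 _ :=
  (ungradedWhiskerLeft F n).map_id _

theorem whiskerRight_id (F : Tangle n k) (D : Tangle m n) : whiskerRight F (𝟙 D.toCob) = 𝟙 _ :=
  (ungradedWhiskerRight m F).map_id _

theorem whiskerLeft_comp (F : Tangle k m) {D E G : Tangle m n} (f : D.toCob ⟶ E.toCob)
    (g : E.toCob ⟶ G.toCob) : whiskerLeft F (f ≫ g) = whiskerLeft F f ≫ whiskerLeft F g :=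
  (ungradedWhiskerLeft F n).map_comp _ _

theorem whiskerRight_comp (F : Tangle n k) {D E G : Tangle m n} (f : D.toCob ⟶ E.toCob)
    (g : E.toCob ⟶ G.toCob) : whiskerRight F (f ≫ g) = whiskerRight F f ≫ whiskerRight F g :=
  (ungradedWhiskerRight m F).map_comp _ _

/-- An elementary cobordism modulo the local relations. -/
noncomputable def Move.cob {D E : Tangle m n} (M : Move D E) : D.toCob ⟶ E.toCob :=
  Movie.cob (Quiver.Hom.toPath M) 1

theorem whiskerLeft_move (F : Tangle k m) {D E : Tangle m n} (M : Move D E) :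
    whiskerLeft F M.cob = (M.whiskerLeft F).cob :=
  whiskerLeft_cob _ _ _

theorem whiskerRight_move (F : Tangle n k) {D E : Tangle m n} (M : Move D E) :
    whiskerRight F M.cob = (M.whiskerRight F).cob :=
  whiskerRight_cob _ _ _

theorem Move.cob_comp {D E F : Tangle m n} (M : Move D E) (N : Move E F) :
    M.cob ≫ N.cob = Movie.cob (twoSteps M N) 1 := by
  rw [cob, cob, Movie.cob_comp, mul_one]
  rfl

/-- An elementary cobordism `A ⟶ B` is natural in the diagram below it. -/
theorem interchange {A B : Tangle k m} {D E : Tangle m n} (M : Move A B) (f : D.toCob ⟶ E.toCob) :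
    whiskerLeft A f ≫ (M.whiskerRight E).cob = (M.whiskerRight D).cob ≫ whiskerLeft B f := by
  induction f using cob_induction with
  | zero => rw [map_zero, map_zero, Limits.zero_comp, Limits.comp_zero]
  | add f g hf hg =>
    rw [map_add, map_add, Preadditive.add_comp, Preadditive.comp_add, hf, hg]
  | of p r =>
    rw [whiskerLeft_cob, whiskerLeft_cob, Move.cob, Move.cob, Movie.cob_comp, Movie.cob_comp,
      mul_one, one_mul]
    exact Movie.cob_eq (Rel.interchange M p) r

/-! ### The algebra structure of the turnbacks -/

/-- The diagrams `(Tangle.one m).stack D` and `D` agree by definition, as the word of `Tangle.one m`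
is empty. -/
theorem Movie.whiskerLeft_one {D E : Tangle m n} (p : Movie D E) :
    Movie.whiskerLeft (Tangle.one m) p = p := by
  induction p with
  | nil => rfl
  | cons p M ih => exact congrArg (fun q => Quiver.Path.cons q M) ih

theorem whiskerLeft_one {D E : Tangle m n} (f : D.toCob ⟶ E.toCob) :
    whiskerLeft (Tangle.one m) f = f := by
  induction f using cob_induction with
  | zero => exact map_zero (whiskerLeft (Tangle.one m) (D := D) (E := E))
  | add f g hf hg =>
    exact (map_add (whiskerLeft (Tangle.one m)) f g).trans (congrArg₂ (· + ·) hf hg)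
  | of p r =>
    exact (whiskerLeft_cob _ p r).trans (congrArg (fun q : Movie D E => q.cob r) p.whiskerLeft_one)

variable (i : ℕ) (h₀ : 0 < i) (h : i < k)

/-- Stacking a turnback on top is associative by definition, since its word is explicit. -/
theorem Movie.whiskerLeft_turnback_stack (F : Tangle k m) {D E : Tangle m n} (p : Movie D E) :
    Movie.whiskerLeft ((Tangle.turnback k i h₀ h).stack F) p =
      Movie.whiskerLeft (Tangle.turnback k i h₀ h) (Movie.whiskerLeft F p) := by
  induction p with
  | nil => rfl
  | cons p M ih => exact congrArg (fun q => Quiver.Path.cons q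
      ((M.whiskerLeft F).whiskerLeft (Tangle.turnback k i h₀ h))) ih

theorem whiskerLeft_turnback_stack (F : Tangle k m) {D E : Tangle m n} (f : D.toCob ⟶ E.toCob) :
    whiskerLeft ((Tangle.turnback k i h₀ h).stack F) f =
      whiskerLeft (Tangle.turnback k i h₀ h) (whiskerLeft F f) := by
  induction f using cob_induction with
  | zero =>
    rw [map_zero, map_zero]
    exact (map_zero (whiskerLeft (Tangle.turnback k i h₀ h) (D := F.stack D) (E := F.stack E))).symm
  | add f g hf hg =>
    rw [map_add, map_add]
    exact (congrArg₂ (· + ·) hf hg).trans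
      (map_add (whiskerLeft (Tangle.turnback k i h₀ h)) _ _).symm
  | of p r =>
    rw [whiskerLeft_cob, whiskerLeft_cob, whiskerLeft_cob, Movie.whiskerLeft_turnback_stack]
    rfl

theorem Movie.whiskerLeft_turnback_whiskerRight {D E : Tangle k m} (F : Tangle m n)
    (p : Movie D E) :
    Movie.whiskerRight F (Movie.whiskerLeft (Tangle.turnback k i h₀ h) p) =
      Movie.whiskerLeft (Tangle.turnback k i h₀ h) (Movie.whiskerRight F p) := by
  induction p with
  | nil => rfl
  | cons p M ih => exact congrArg (fun q => Quiver.Path.cons q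
      ((M.whiskerRight F).whiskerLeft (Tangle.turnback k i h₀ h))) ih

theorem whiskerLeft_turnback_whiskerRight {D E : Tangle k m} (F : Tangle m n)
    (f : D.toCob ⟶ E.toCob) :
    whiskerRight F (whiskerLeft (Tangle.turnback k i h₀ h) f) =
      whiskerLeft (Tangle.turnback k i h₀ h) (whiskerRight F f) := by
  induction f using cob_induction with
  | zero =>
    rw [map_zero, map_zero, map_zero]
    exact (map_zero (whiskerLeft (Tangle.turnback k i h₀ h) (D := D.stack F) (E := E.stack F))).symm
  | add f g hf hg =>
    rw [map_add, map_add, map_add]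
    exact (congrArg₂ (· + ·) hf hg).trans
      (map_add (whiskerLeft (Tangle.turnback k i h₀ h)) _ _).symm
  | of p r =>
    rw [whiskerLeft_cob, whiskerRight_cob, whiskerRight_cob, whiskerLeft_cob,
      Movie.whiskerLeft_turnback_whiskerRight]
    rfl

/-- The unit of `e_i`, stacked on top of a diagram. -/
noncomputable def saddleCob (D : Tangle k m) :
    D.toCob ⟶ ((Tangle.turnback k i h₀ h).stack D).toCob :=
  ((saddleMove k i h₀ h).whiskerRight D).cob

/-- The multiplication of `e_i`, stacked on top of a diagram. -/
noncomputable def mergeCob (D : Tangle k m) :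
    ((Tangle.turnback k i h₀ h).stack ((Tangle.turnback k i h₀ h).stack D)).toCob ⟶
      ((Tangle.turnback k i h₀ h).stack D).toCob :=
  ((mergeMove k i h₀ h).whiskerRight D).cob

theorem saddleCob_naturality {D E : Tangle k m} (f : D.toCob ⟶ E.toCob) :
    f ≫ saddleCob i h₀ h E = saddleCob i h₀ h D ≫ whiskerLeft (Tangle.turnback k i h₀ h) f :=
  Eq.trans (congrArg (· ≫ saddleCob i h₀ h E) (whiskerLeft_one f).symm)
    (interchange (saddleMove k i h₀ h) f)

theorem mergeCob_naturality {D E : Tangle k m} (f : D.toCob ⟶ E.toCob) :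
    whiskerLeft (Tangle.turnback k i h₀ h) (whiskerLeft (Tangle.turnback k i h₀ h) f) ≫
      mergeCob i h₀ h E = mergeCob i h₀ h D ≫ whiskerLeft (Tangle.turnback k i h₀ h) f :=
  Eq.trans (congrArg (· ≫ mergeCob i h₀ h E) (whiskerLeft_turnback_stack i h₀ h _ f).symm)
    (interchange (mergeMove k i h₀ h) f)

/-- One of the unit laws of `e_i`: the saddle is inserted below `e_i`. -/
theorem whiskerLeft_saddleCob_comp_mergeCob (D : Tangle k m) :
    whiskerLeft (Tangle.turnback k i h₀ h) (saddleCob i h₀ h D) ≫ mergeCob i h₀ h D = 𝟙 _ := by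
  have e : (saddleBelow k i h₀ h).cob ≫ (mergeMove k i h₀ h).cob = 𝟙 _ := by
    rw [Move.cob_comp, ← Movie.cob_nil]
    exact Movie.cob_eq (Rel.homeo _ _ (homeomorphic_saddleBelow_mergeMove k i h₀ h)) 1
  have e' := congrArg (whiskerRight D) e
  rw [whiskerRight_comp, whiskerRight_move, whiskerRight_move, whiskerRight_id] at e'
  exact Eq.trans (congrArg (· ≫ mergeCob i h₀ h D)
    (whiskerLeft_move (Tangle.turnback k i h₀ h) _)) e'

/-- The other one of the unit laws of `e_i`: the saddle is inserted above `e_i`. -/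
theorem saddleCob_comp_mergeCob :
    saddleCob i h₀ h (Tangle.turnback k i h₀ h) ≫ mergeCob i h₀ h (Tangle.one k) = 𝟙 _ := by
  have e : (saddleAbove k i h₀ h).cob ≫ (mergeMove k i h₀ h).cob = 𝟙 _ := by
    rw [Move.cob_comp, ← Movie.cob_nil]
    exact Movie.cob_eq (Rel.homeo _ _ (homeomorphic_saddleAbove_mergeMove k i h₀ h)) 1
  exact e

theorem whiskerRight_saddleCob (D : Tangle k m) (F : Tangle m n) :
    whiskerRight F (saddleCob i h₀ h D) = saddleCob i h₀ h (D.stack F) :=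
  whiskerRight_move _ _

end Natural

/-! ### Sums of endofunctors on formal direct sums -/

section Mat

universe v u

variable {C : Type u} [Category.{v} C]

/-- The entries of the image of a matrix under a direct sum of functors. -/
def sumMap [Preadditive C] {I : Type} [DecidableEq I] (F : I → C ⥤ C) {X Y : C} (f : X ⟶ Y)
    (i i' : I) : (F i).obj X ⟶ (F i').obj Y :=
  if h : i = i' then (F i).map f ≫ eqToHom (by rw [h]) else 0

variable [Preadditive C]

section

variable {I : Type} [DecidableEq I] (F : I → C ⥤ C)

theorem sumMap_self {X Y : C} (f : X ⟶ Y) (i : I) : sumMap F f i i = (F i).map f := by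
  simp [sumMap]

theorem sumMap_of_ne {X Y : C} (f : X ⟶ Y) {i i' : I} (h : i ≠ i') : sumMap F f i i' = 0 := by
  simp [sumMap, h]

end

theorem sum_id_comp {X : Mat_ C} {Z : C} (j : X.ι) (g : ∀ k, X.X k ⟶ Z) :
    ∑ k, (𝟙 X : Mat_.Hom X X) j k ≫ g k = g j := by
  classical
  rw [Finset.sum_eq_single j, Mat_.id_apply_self, Category.id_comp]
  · intro k _ h
    rw [Mat_.id_apply_of_ne _ _ _ h.symm, Limits.zero_comp]
  · simp

theorem sum_comp_id {X : Mat_ C} {Z : C} (j : X.ι) (g : ∀ k, Z ⟶ X.X k) :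
    ∑ k, g k ≫ (𝟙 X : Mat_.Hom X X) k j = g j := by
  classical
  rw [Finset.sum_eq_single j, Mat_.id_apply_self, Category.comp_id]
  · intro k _ h
    rw [Mat_.id_apply_of_ne _ _ _ h, Limits.comp_zero]
  · simp

theorem map_id_apply (G : C ⥤ C) [G.Additive] (X : Mat_ C) (j j' : X.ι) :
    G.map ((𝟙 X : Mat_.Hom X X) j j') =
      (𝟙 (G.mapMat_.obj X) : Mat_.Hom (G.mapMat_.obj X) (G.mapMat_.obj X)) j j' :=
  congrFun (congrFun (G.mapMat_.map_id X) j) j'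

variable {I : Type} [DecidableEq I] (F : I → C ⥤ C) [Fintype I] [∀ i, (F i).Additive]

/-- The direct sum of the functors `F i` on the objects. -/
abbrev sumObj {I : Type} [Fintype I] (F : I → C ⥤ C) (X : Mat_ C) : Mat_ C :=
  ⟨I × X.ι, fun p => (F p.1).obj (X.X p.2)⟩

/-- The direct sum of the functors `F i`, on formal direct sums of objects. -/
noncomputable def sumMat : Mat_ C ⥤ Mat_ C where
  obj := sumObj F
  map f p q := sumMap F (f p.2 q.2) p.1 q.1
  map_id X := by
    refine Mat_.hom_ext _ _ ?_
    rintro ⟨i, j⟩ ⟨i', j'⟩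
    rcases eq_or_ne i i' with rfl | h
    · refine (sumMap_self F _ i).trans ?_
      rcases eq_or_ne j j' with rfl | h'
      · exact (congrArg (F i).map (Mat_.id_apply_self X j)).trans
          (((F i).map_id _).trans (Mat_.id_apply_self (sumObj F X) (i, j)).symm)
      · exact (congrArg (F i).map (Mat_.id_apply_of_ne X j j' h')).trans
          (((F i).map_zero _ _).trans (Mat_.id_apply_of_ne (sumObj F X) (i, j) (i, j')
            (by simpa using h')).symm)
    · refine (sumMap_of_ne F _ h).trans ?_
      rw [Mat_.id_apply_of_ne _ _ _ (by simp [h])]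
  map_comp {X Y Z} f g := by
    refine Mat_.hom_ext _ _ ?_
    rintro ⟨i, j⟩ ⟨i', j'⟩
    change sumMap F (∑ k, (f : Mat_.Hom X Y) j k ≫ (g : Mat_.Hom Y Z) k j') i i' =
      ∑ q : I × Y.ι, sumMap F ((f : Mat_.Hom X Y) j q.2) i q.1 ≫
        sumMap F ((g : Mat_.Hom Y Z) q.2 j') q.1 i'
    rw [Fintype.sum_prod_type, Finset.sum_eq_single i]
    · rcases eq_or_ne i i' with rfl | h
      · simp only [sumMap_self, Functor.map_sum, Functor.map_comp]
      · simp only [sumMap_of_ne F _ h, Limits.comp_zero, Finset.sum_const_zero]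
    · intro i'' _ h
      simp only [sumMap_of_ne F _ h.symm, Limits.zero_comp, Finset.sum_const_zero]
    · simp

instance : (sumMat F).Additive where
  map_add {X Y f g} := by
    refine Mat_.hom_ext _ _ ?_
    rintro ⟨i, j⟩ ⟨i', j'⟩
    change sumMap F ((f : Mat_.Hom X Y) j j' + (g : Mat_.Hom X Y) j j') i i' =
      sumMap F ((f : Mat_.Hom X Y) j j') i i' + sumMap F ((g : Mat_.Hom X Y) j j') i i'
    rcases eq_or_ne i i' with rfl | h
    · rw [sumMap_self, sumMap_self, sumMap_self, Functor.map_add]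
    · rw [sumMap_of_ne F _ h, sumMap_of_ne F _ h, sumMap_of_ne F _ h, add_zero]

variable {F}

/-- The map from the identity to the direct sum of the functors `F i` with given components. -/
noncomputable def Pointing.sumMat (θ : ∀ i, Pointing (F i)) : Pointing (sumMat F) where
  app X j q := (𝟙 X : Mat_.Hom X X) j q.2 ≫ (θ q.1).app (X.X q.2)
  naturality {X Y} f := by
    refine Mat_.hom_ext _ _ ?_
    rintro j ⟨i, j'⟩
    change ∑ k, (f : Mat_.Hom X Y) j k ≫ (𝟙 Y : Mat_.Hom Y Y) k j' ≫ (θ i).app (Y.X j') =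
      ∑ q : I × X.ι, ((𝟙 X : Mat_.Hom X X) j q.2 ≫ (θ q.1).app (X.X q.2)) ≫
        sumMap F ((f : Mat_.Hom X Y) q.2 j') q.1 i
    simp only [← Category.assoc]
    rw [← Preadditive.sum_comp, sum_comp_id, Fintype.sum_prod_type, Finset.sum_eq_single i]
    · simp only [sumMap_self, Category.assoc, ← (θ i).naturality]
      rw [sum_id_comp (g := fun k => (f : Mat_.Hom X Y) k j' ≫ (θ i).app (Y.X j'))]
    · intro i' _ h
      simp only [sumMap_of_ne F _ h, Limits.comp_zero, Finset.sum_const_zero]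
    · simp

variable (F) in
/-- The projection from the direct sum of the functors `F i` to one of them. -/
noncomputable def sumProj (i : I) (X : Mat_ C) : (sumMat F).obj X ⟶ (F i).mapMat_.obj X :=
  fun (q : I × X.ι) j' => sumMap F ((𝟙 X : Mat_.Hom X X) q.2 j') q.1 i

variable (F) in
theorem sumProj_naturality (i : I) {X Y : Mat_ C} (f : X ⟶ Y) :
    (sumMat F).map f ≫ sumProj F i Y = sumProj F i X ≫ (F i).mapMat_.map f := by
  refine Mat_.hom_ext _ _ ?_
  rintro ⟨i', j⟩ (j' : Y.ι)
  change ∑ q : I × Y.ι, sumMap F ((f : Mat_.Hom X Y) j q.2) i' q.1 ≫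
      sumMap F ((𝟙 Y : Mat_.Hom Y Y) q.2 j') q.1 i =
    ∑ k, sumMap F ((𝟙 X : Mat_.Hom X X) j k) i' i ≫ (F i).map ((f : Mat_.Hom X Y) k j')
  rw [Fintype.sum_prod_type, Finset.sum_eq_single i']
  · rcases eq_or_ne i' i with rfl | h
    · simp only [sumMap_self, ← Functor.map_comp]
      rw [← Functor.map_sum, ← Functor.map_sum, sum_id_comp, sum_comp_id]
    · simp only [sumMap_of_ne F _ h, Limits.comp_zero, Limits.zero_comp, Finset.sum_const_zero]
  · intro i'' _ h
    simp only [sumMap_of_ne F _ h.symm, Limits.zero_comp, Finset.sum_const_zero]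
  · simp

theorem Pointing.sumMat_app_comp_sumProj (θ : ∀ i, Pointing (F i)) (i : I) (X : Mat_ C) :
    (Pointing.sumMat θ).app X ≫ sumProj F i X =
      fun j j' => (𝟙 X : Mat_.Hom X X) j j' ≫ (θ i).app (X.X j') := by
  refine Mat_.hom_ext _ _ fun j j' => ?_
  change ∑ q : I × X.ι, ((𝟙 X : Mat_.Hom X X) j q.2 ≫ (θ q.1).app (X.X q.2)) ≫
      sumMap F ((𝟙 X : Mat_.Hom X X) q.2 j') q.1 i = _
  rw [Fintype.sum_prod_type, Finset.sum_eq_single i]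
  · simp only [sumMap_self, Category.assoc, ← (θ i).naturality]
    rw [sum_id_comp (g := fun k => (𝟙 X : Mat_.Hom X X) k j' ≫ (θ i).app (X.X j'))]
  · intro i' _ h
    simp only [sumMap_of_ne F _ h, Limits.comp_zero, Finset.sum_const_zero]
  · simp

/-- If `G (F i)` retracts to `G` by the natural transformation `m` for one `i`, then so does the
image under `G` of the direct sum of all the `F i`, and the image under `G` of the complex of
iterates of this sum is contractible. -/
theorem Pointing.sumMat_contractible_of_retraction [Limits.HasZeroObject (Mat_ C)]
    (θ : ∀ i, Pointing (F i)) (X : Mat_ C) (G : C ⥤ C) [G.Additive] [G.mapMat_.Additive] (i : I)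
    (m : ∀ Y, G.obj ((F i).obj Y) ⟶ G.obj Y)
    (m_nat : ∀ {Y Z : C} (f : Y ⟶ Z), G.map ((F i).map f) ≫ m Z = m Y ≫ G.map f)
    (hm : ∀ Y, G.map ((θ i).app Y) ≫ m Y = 𝟙 _) :
    Nonempty (HomotopyEquiv ((G.mapMat_.mapHomologicalComplex _).obj
      ((Pointing.sumMat θ).iterComplex X)) 0) := by
  let m' : ∀ Y : Mat_ C, G.mapMat_.obj ((F i).mapMat_.obj Y) ⟶ G.mapMat_.obj Y := fun Y j j' =>
    m (Y.X j) ≫ G.map ((𝟙 Y : Mat_.Hom Y Y) j j')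
  have m'_nat : ∀ {Y Z : Mat_ C} (f : Y ⟶ Z),
      G.mapMat_.map ((F i).mapMat_.map f) ≫ m' Z = m' Y ≫ G.mapMat_.map f := fun {Y Z} f => by
    refine Mat_.hom_ext _ _ fun (j : Y.ι) (j' : Z.ι) => ?_
    change ∑ k, G.map ((F i).map ((f : Mat_.Hom Y Z) j k)) ≫ m (Z.X k) ≫
      G.map ((𝟙 Z : Mat_.Hom Z Z) k j') = ∑ k, (m (Y.X j) ≫ G.map ((𝟙 Y : Mat_.Hom Y Y) j k)) ≫
        G.map ((f : Mat_.Hom Y Z) k j')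
    simp only [Category.assoc, reassoc_of% m_nat, ← Functor.map_comp]
    rw [← Preadditive.comp_sum, ← Preadditive.comp_sum, ← Functor.map_sum, ← Functor.map_sum,
      sum_id_comp, sum_comp_id]
  refine Pointing.nonempty_homotopyEquiv_zero_of_retraction _ X G.mapMat_
    (fun Y => G.mapMat_.map (sumProj F i Y) ≫ m' Y) (fun f => ?_) fun Y => ?_
  · rw [← Functor.map_comp_assoc, sumProj_naturality, Functor.map_comp_assoc, m'_nat,
      Category.assoc]
  · rw [← Functor.map_comp_assoc, sumMat_app_comp_sumProj]
    refine Mat_.hom_ext _ _ fun (j : Y.ι) (j' : Y.ι) => ?_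
    change ∑ k, G.map ((𝟙 Y : Mat_.Hom Y Y) j k ≫ (θ i).app (Y.X k)) ≫ m (Y.X k) ≫
      G.map ((𝟙 Y : Mat_.Hom Y Y) k j') = _
    simp only [Functor.map_comp, Category.assoc, reassoc_of% hm]
    rw [← map_id_apply]
    simp only [← Functor.map_comp]
    rw [← Functor.map_sum, sum_id_comp]

end Mat

/-! ### The Amitsur complex of the turnbacks -/

section Complex

variable {n : ℕ}

/-- The cobordism modulo the local relations that underlies a morphism of `Cob n`. -/
noncomputable def Cob.toHom {X Y : Cob n} (f : X ⟶ Y) : X.diagram.toCob ⟶ Y.diagram.toCob :=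
  f.hom

/-- A cobordism modulo the local relations as a morphism of `Cob n`. -/
noncomputable def Cob.ofHom {X Y : Cob n} (f : X.diagram.toCob ⟶ Y.diagram.toCob) : X ⟶ Y :=
  InducedCategory.homMk f

theorem Cob.hom_ext {X Y : Cob n} {f g : X ⟶ Y} (h : toHom f = toHom g) : f = g :=
  InducedCategory.hom_ext h

/-- `Cob.toHom` as a homomorphism of groups. -/
noncomputable def Cob.toHomHom {X Y : Cob n} : (X ⟶ Y) →+ (X.diagram.toCob ⟶ Y.diagram.toCob) where
  toFun := toHom
  map_zero' := rfl
  map_add' _ _ := rfl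

/-- The indices `0 < i < n` of the generators of the Temperley-Lieb algebra. -/
abbrev Idx (n : ℕ) : Type := {i : Fin n // 0 < i.1}

/-- The generator `e_i` of the Temperley-Lieb algebra. -/
abbrev gen (i : Idx n) : Tangle n n := Tangle.turnback n i.1.1 i.2 i.1.2

/-- The functor `q e_i ⊗ -`. -/
noncomputable def shiftedTensorLeft (i : Idx n) : Cob n ⥤ Cob n where
  obj X := Cob.of (X.shift + 1) ((gen i).stack X.diagram)
  map {X Y} f := Cob.ofHom (X := Cob.of (X.shift + 1) ((gen i).stack X.diagram))
    (Y := Cob.of (Y.shift + 1) ((gen i).stack Y.diagram)) (whiskerLeft (gen i) (Cob.toHom f))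
  map_id X := Cob.hom_ext (whiskerLeft_id (gen i) X.diagram)
  map_comp f g := Cob.hom_ext (whiskerLeft_comp (gen i) (Cob.toHom f) (Cob.toHom g))

instance (i : Idx n) : (shiftedTensorLeft i).Additive where
  map_add {X Y f g} := Cob.hom_ext (map_add (whiskerLeft (gen i) (D := X.diagram) (E := Y.diagram))
    (Cob.toHom f) (Cob.toHom g))

/-- The unit `1 ⟶ q e_i`, a saddle. -/
noncomputable def saddlePointing (i : Idx n) : Pointing (shiftedTensorLeft i) where
  app X := Cob.ofHom (X := X) (Y := Cob.of (X.shift + 1) ((gen i).stack X.diagram))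
    (saddleCob i.1.1 i.2 i.1.2 X.diagram)
  naturality f := Cob.hom_ext (saddleCob_naturality i.1.1 i.2 i.1.2 (Cob.toHom f))

/-- The direct sum of the unit maps `1 ⟶ q e_i`. -/
noncomputable def unit (n : ℕ) : Pointing (sumMat (shiftedTensorLeft (n := n))) :=
  Pointing.sumMat saddlePointing

/-- The complex `1 ⟶ T ⟶ T ⊗ T ⟶ …`, where `T` is the direct sum of the diagrams `q e_i`. -/
noncomputable def projectorComplex (n : ℕ) : CochainComplex (Mat_ (Cob n)) ℤ :=
  (unit n).iterComplex (identityDiagram n)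

theorem projectorComplex_tensorLeft (i : Idx n) : IsContractible
    (((Cob.tensorLeft (gen i)).mapMat_.mapHomologicalComplex _).obj (projectorComplex n)) :=
  Pointing.sumMat_contractible_of_retraction saddlePointing (identityDiagram n)
    (Cob.tensorLeft (gen i)) i
    (fun Y => Cob.ofHom
      (X := Cob.of (Y.shift + 1) ((gen i).stack ((gen i).stack Y.diagram)))
      (Y := Cob.of Y.shift ((gen i).stack Y.diagram))
      (mergeCob i.1.1 i.2 i.1.2 Y.diagram))
    (fun f => Cob.hom_ext (mergeCob_naturality i.1.1 i.2 i.1.2 (Cob.toHom f)))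
    (fun Y => Cob.hom_ext (whiskerLeft_saddleCob_comp_mergeCob i.1.1 i.2 i.1.2 Y.diagram))

theorem tensorRight_map_shiftedTensorLeft_map (D : Tangle n n) (i : Idx n) {X Y : Cob n}
    (f : X ⟶ Y) : (Cob.tensorRight D).map ((shiftedTensorLeft i).map f) =
      (shiftedTensorLeft i).map ((Cob.tensorRight D).map f) :=
  Cob.hom_ext (whiskerLeft_turnback_whiskerRight i.1.1 i.2 i.1.2 D (Cob.toHom f))

theorem tensorRight_map_saddlePointing (D : Tangle n n) (i : Idx n) (X : Cob n) :
    (Cob.tensorRight D).map ((saddlePointing i).app X) =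
      (saddlePointing i).app ((Cob.tensorRight D).obj X) :=
  Cob.hom_ext (whiskerRight_saddleCob i.1.1 i.2 i.1.2 X.diagram D)

theorem tensorRight_map_sumMap (D : Tangle n n) {X Y : Cob n} (f : X ⟶ Y) (i i' : Idx n) :
    (Cob.tensorRight D).map (sumMap shiftedTensorLeft f i i') =
      sumMap shiftedTensorLeft ((Cob.tensorRight D).map f) i i' := by
  rcases eq_or_ne i i' with rfl | h
  · rw [sumMap_self]
    exact (tensorRight_map_shiftedTensorLeft_map D i f).trans (sumMap_self _ _ _).symm
  · rw [sumMap_of_ne _ _ h]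
    exact ((Cob.tensorRight D).map_zero _ _).trans
      (sumMap_of_ne shiftedTensorLeft ((Cob.tensorRight D).map f) h).symm

/-- The functors `T ⊗ -` and `- ⊗ D` commute.  The words of the diagrams on both sides agree by
definition, since those of the turnbacks are explicit. -/
noncomputable def tensorRightSumMat (D : Tangle n n) (Y : Mat_ (Cob n)) :
    (Cob.tensorRight D).mapMat_.obj ((sumMat shiftedTensorLeft).obj Y) ≅
      (sumMat shiftedTensorLeft).obj ((Cob.tensorRight D).mapMat_.obj Y) :=
  Iso.refl ((Cob.tensorRight D).mapMat_.obj ((sumMat shiftedTensorLeft).obj Y))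

/-- The multiplication `e_i ⊗ e_i ⟶ e_i` as a retraction of the unit `e_i ⟶ T ⊗ e_i`. -/
noncomputable def unitRetraction (i : Idx n) :
    (sumMat shiftedTensorLeft).obj ((Cob.tensorRight (gen i)).mapMat_.obj (identityDiagram n)) ⟶
      (Cob.tensorRight (gen i)).mapMat_.obj (identityDiagram n) :=
  sumProj shiftedTensorLeft i _ ≫ fun _ _ => Cob.ofHom
    (X := Cob.of (0 + 1) ((gen i).stack (gen i))) (Y := Cob.of 0 (gen i))
    (mergeCob i.1.1 i.2 i.1.2 (Tangle.one n))

theorem projectorComplex_tensorRight (i : Idx n) : IsContractible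
    (((Cob.tensorRight (gen i)).mapMat_.mapHomologicalComplex _).obj (projectorComplex n)) := by
  refine (unit n).nonempty_homotopyEquiv_zero_of_commute (identityDiagram n)
    (Cob.tensorRight (gen i)).mapMat_ (tensorRightSumMat (gen i)) (fun {Y Z} f => ?_) (fun Y => ?_)
    (unitRetraction i) ?_
  · refine (Category.comp_id _).trans (Eq.trans ?_ (Category.id_comp _).symm)
    exact Mat_.hom_ext _ _ fun _ _ => tensorRight_map_sumMap _ _ _ _
  · refine (Category.comp_id _).trans ?_
    refine Mat_.hom_ext _ _ fun (j : Y.ι) (q : Idx n × Y.ι) => ?_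
    refine ((Cob.tensorRight (gen i)).map_comp _ _).trans ?_
    exact congrArg₂ (· ≫ ·) (map_id_apply _ Y j q.2) (tensorRight_map_saddlePointing (gen i) q.1 _)
  · refine (Category.assoc _ _ _).symm.trans
      ((congrArg (· ≫ _) (Pointing.sumMat_app_comp_sumProj saddlePointing i _)).trans ?_)
    refine Mat_.hom_ext _ _ fun (j : PUnit) (j' : PUnit) => ?_
    let X := (Cob.tensorRight (gen i)).mapMat_.obj (identityDiagram n)
    let m : ∀ k : X.ι, (shiftedTensorLeft i).obj (X.X k) ⟶ X.X j' := fun _ => Cob.ofHom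
      (X := Cob.of (0 + 1) ((gen i).stack (gen i))) (Y := Cob.of 0 (gen i))
      (mergeCob i.1.1 i.2 i.1.2 (Tangle.one n))
    have e : ∑ k : X.ι, ((𝟙 X : Mat_.Hom X X) j k ≫ (saddlePointing i).app (X.X k)) ≫ m k =
        (saddlePointing i).app (X.X j) ≫ m j := by
      simp only [Category.assoc]
      exact sum_id_comp (X := X) j fun k => (saddlePointing i).app (X.X k) ≫ m k
    refine Eq.trans e (Eq.trans ?_ (Mat_.id_apply_self X j).symm)
    exact Cob.hom_ext (saddleCob_comp_mergeCob i.1.1 i.2 i.1.2)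

end Complex

/-! ### Degrees -/

section Degree

variable {k m n : ℕ} {D E E' : Tangle m n}

theorem Movie.degree_cons (p : Movie D E) (M : Move E E') :
    Movie.degree (p.cons M) = p.degree +
      (M.surface.marks.map fun x => x.2.1 - 2 * (x.2.2 : ℤ)).sum := by
  change (((Movie.surface p).glue M.surface).marks.map fun x => x.2.1 - 2 * (x.2.2 : ℤ)).sum = _
  simp only [Surface.glue, List.map_append, List.map_map, List.sum_append]
  rfl

theorem Movie.degree_whiskerLeft (F : Tangle k m) (p : Movie D E) :
    (p.whiskerLeft F).degree = p.degree := by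
  induction p with
  | nil => rfl
  | cons p M ih =>
    refine (Movie.degree_cons (Movie.whiskerLeft F p) (M.whiskerLeft F)).trans ?_
    rw [ih, Movie.degree_cons]
    have e := congrArg (fun l => (l.map fun x => x.2.1 - 2 * (x.2.2 : ℤ)).sum)
      (M.marks_whiskerLeft F (fun _ => ()) fun _ => ())
    simp only [List.map_map] at e
    exact congrArg (_ + ·) e

namespace Cob

theorem IsHomogeneous.zero {X Y : Cob n} (d : ℤ) : IsHomogeneous d (0 : X ⟶ Y) :=
  AddSubgroup.zero_mem _

theorem IsHomogeneous.sub {X Y : Cob n} {d : ℤ} {f g : X ⟶ Y} (hf : IsHomogeneous d f)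
    (hg : IsHomogeneous d g) : IsHomogeneous d (f - g) :=
  AddSubgroup.sub_mem _ hf hg

theorem isHomogeneous_ofMovie {X Y : Cob n} {d : ℤ} (p : Movie X.diagram Y.diagram)
    (h : p.degree + (Y.shift - X.shift) = d) : IsHomogeneous d (ofMovie (X := X) (Y := Y) p 1) :=
  AddSubgroup.subset_closure ⟨p, 0, by simpa using h, by rw [pow_zero]⟩

theorem isHomogeneous_id (X : Cob n) : IsHomogeneous 0 (𝟙 X) :=
  isHomogeneous_ofMovie (X := X) (Y := X) .nil (by simp; rfl)

theorem IsHomogeneous.shiftedTensorLeft_map (i : Idx n) {X Y : Cob n} {d : ℤ} {f : X ⟶ Y}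
    (hf : IsHomogeneous d f) : IsHomogeneous d ((shiftedTensorLeft i).map f) := by
  refine (AddSubgroup.closure_le (K := (AddSubgroup.closure _).comap
    (shiftedTensorLeft i).mapAddHom)).2 ?_ hf
  rintro _ ⟨p, k, h, rfl⟩
  refine AddSubgroup.subset_closure ⟨Movie.whiskerLeft (gen i) p, k, ?_, ?_⟩
  · refine Eq.trans (congrArg (· + _ - _) (Movie.degree_whiskerLeft (gen i) p)) (Eq.trans ?_ h)
    change _ + ((Y.shift + 1) - (X.shift + 1)) - _ = _ + (Y.shift - X.shift) - _
    ring
  · exact hom_ext (whiskerLeft_cob (gen i) p (α ^ k))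

theorem isHomogeneous_saddlePointing (i : Idx n) (X : Cob n) :
    IsHomogeneous 0 ((saddlePointing i).app X) := by
  refine isHomogeneous_ofMovie (X := X) (Y := (shiftedTensorLeft i).obj X)
    (Quiver.Hom.toPath ((saddleMove n i.1.1 i.2 i.1.2).whiskerRight X.diagram)) ?_
  change _ + ((X.shift + 1) - X.shift) = 0
  refine (congrArg (· + _) (Movie.degree_cons .nil _)).trans ?_
  change (0 + (-1 - 2 * ((0 : ℕ) : ℤ) + 0)) + (X.shift + 1 - X.shift) = 0
  push_cast
  ring

end Cob

theorem isDegreeZero_id (X : Mat_ (Cob n)) : IsDegreeZero (𝟙 X) := fun j j' => by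
  rcases eq_or_ne j j' with rfl | h
  · rw [Mat_.id_apply_self]
    exact Cob.isHomogeneous_id _
  · rw [Mat_.id_apply_of_ne _ _ _ h]
    exact Cob.IsHomogeneous.zero 0

theorem isDegreeZero_unit_app (X : Mat_ (Cob n)) : IsDegreeZero ((unit n).app X) := by
  rintro j ⟨i, j'⟩
  change Cob.IsHomogeneous 0 ((𝟙 X : Mat_.Hom X X) j j' ≫ (saddlePointing i).app (X.X j'))
  rcases eq_or_ne j j' with rfl | h
  · rw [Mat_.id_apply_self, Category.id_comp]
    exact Cob.isHomogeneous_saddlePointing i _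
  · rw [Mat_.id_apply_of_ne _ _ _ h, Limits.zero_comp]
    exact Cob.IsHomogeneous.zero 0

theorem IsDegreeZero.sumMat_map {X Y : Mat_ (Cob n)} {f : X ⟶ Y} (hf : IsDegreeZero f) :
    IsDegreeZero ((sumMat shiftedTensorLeft).map f) := by
  rintro ⟨i, j⟩ ⟨i', j'⟩
  change Cob.IsHomogeneous 0 (sumMap shiftedTensorLeft ((f : Mat_.Hom X Y) j j') i i')
  rcases eq_or_ne i i' with rfl | h
  · rw [sumMap_self]
    exact (hf j j').shiftedTensorLeft_map i
  · rw [sumMap_of_ne _ _ h]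
    exact Cob.IsHomogeneous.zero 0

theorem isDegreeZero_iterD (X : Mat_ (Cob n)) : ∀ k, IsDegreeZero ((unit n).iterD X k)
  | 0 => isDegreeZero_unit_app X
  | k + 1 => fun i j => (isDegreeZero_unit_app _ i j).sub
    ((isDegreeZero_iterD X k).sumMat_map i j)

theorem isDegreeZero_projectorComplex_d (k : ℤ) :
    IsDegreeZero ((projectorComplex n).d k (k + 1)) := by
  rw [projectorComplex, Pointing.iterComplex_d]
  match k with
  | .ofNat k => exact isDegreeZero_iterD _ k
  | .negSucc k => exact fun i j => Cob.IsHomogeneous.zero 0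

/-- All summands of `T ^ k` have the `q`-grading `k`. -/
theorem shift_iterObj (k : ℕ) : ∀ j,
    ((iterObj (sumMat shiftedTensorLeft) (identityDiagram n) k).X j).shift = k := by
  induction k with
  | zero => exact fun _ => rfl
  | succ k ih =>
    rintro ⟨i, j⟩
    exact (congrArg (· + 1) (ih j)).trans (Nat.cast_succ k).symm

end Degree

/-! ### The identity diagram does not split off -/

section NotIso

variable {m n : ℕ}

theorem of_formalStateMatrix_ne_zero {D E : Tangle m n} (f : Formal.of D ⟶ Formal.of E)
    {x : D.Point → Bool} {y : E.Point → Bool} (h : formalStateMatrix f x y ≠ 0) :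
    E.IsColoring y ∧ ∀ j hj, x (D.top j hj) = y (E.top j hj) := by
  by_contra hc
  refine h ?_
  induction f using formal_induction with
  | zero => rw [map_zero]; rfl
  | add f g hf hg =>
    rw [map_add, Matrix.add_apply]
    rw [show formalStateMatrix f x y = 0 by by_contra h'; exact h' (hf h'),
      show formalStateMatrix g x y = 0 by by_contra h'; exact h' (hg h'), add_zero]
  | of p r =>
    rw [formalStateMatrix_formal, Matrix.smul_apply]
    by_contra h'
    have := p.of_stateMatrix_ne_zero (right_ne_zero_of_smul h')
    exact hc ⟨this.1, this.2.1⟩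

/-- The coloring of the vertical strands by alternating colors.  It takes different values at any
two neighboring end points. -/
def alternating (n : ℕ) (p : (Tangle.one n).Point) : Bool := p.1.2.bodd

theorem isColoring_alternating (n : ℕ) : (Tangle.one n).IsColoring (alternating n) := by
  rintro p q ⟨t, l, h, -⟩
  cases h

theorem top_eq_top_of_isColoring {i : ℕ} {h₀ : 0 < i} {h : i < m} {E : Tangle m n}
    {y : ((Tangle.turnback m i h₀ h).stack E).Point → Bool}
    (hy : ((Tangle.turnback m i h₀ h).stack E).IsColoring y) :
    y (Tangle.top _ (i - 1) (by omega)) = y (Tangle.top _ (i - 1 + 1) (by omega)) :=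
  hy _ _ ⟨0, .join (i - 1), rfl, .join_arc (i - 1) 0⟩

/-- A sum of cobordisms that factor through diagrams with a turnback on the top is not the identity
cobordism: the state sums vanish if neighboring strands have different colors. -/
theorem sum_comp_ne_id {ι : Type*} [Fintype ι] (i : ι → Idx n) (E : ι → Tangle n n)
    (a : ∀ q, (Tangle.one n).toCob ⟶ ((gen (i q)).stack (E q)).toCob)
    (b : ∀ q, ((gen (i q)).stack (E q)).toCob ⟶ (Tangle.one n).toCob) :
    ∑ q, a q ≫ b q ≠ 𝟙 (Tangle.one n).toCob := by
  choose a' ha' using fun q => (Quotient.functor (rel n n)).map_surjective (a q)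
  choose b' hb' using fun q => (Quotient.functor (rel n n)).map_surjective (b q)
  intro h
  have e : (Quotient.functor (rel n n)).map (∑ q, a' q ≫ b' q) =
      (Quotient.functor (rel n n)).map (𝟙 (Formal.of (Tangle.one n))) := by
    rw [Functor.map_sum]
    refine Eq.trans (Eq.trans (Finset.sum_congr rfl fun q _ => ?_) h)
      ((Quotient.functor (rel n n)).map_id _).symm
    rw [Functor.map_comp, ha', hb']
  have r : Rel (∑ q, a' q ≫ b' q) (𝟙 (Formal.of (Tangle.one n))) :=
    (CategoryTheory.Quotient.functor_map_eq_iff (rel n n) _ _).1 e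
  have key := congrFun (congrFun r.formalStateMatrix_eq (alternating n)) (alternating n)
  have h₁ : formalStateMatrix (𝟙 (Formal.of (Tangle.one n))) (alternating n) (alternating n) =
      1 := by
    refine (congrFun (congrFun (formalStateMatrix_formal (D := Tangle.one n) .nil 1) _) _).trans ?_
    rw [map_one, one_smul, Movie.stateMatrix_nil, if_pos ⟨rfl, isColoring_alternating n⟩]
  rw [h₁, map_sum, Matrix.sum_apply, Finset.sum_eq_zero] at key
  · exact zero_ne_one key
  · intro q _
    refine (congrFun (congrFun (formalStateMatrix_comp (a' q) (b' q)) _) _).trans ?_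
    rw [Matrix.mul_apply]
    refine Finset.sum_eq_zero fun y _ => ?_
    by_contra h'
    obtain ⟨hy, ht⟩ := of_formalStateMatrix_ne_zero _ (left_ne_zero_of_mul h')
    have e₁ := top_eq_top_of_isColoring hy
    rw [← ht, ← ht] at e₁
    simp [alternating, Tangle.top, Nat.bodd_succ] at e₁

theorem isEmpty_iterObj_iso (k : ℕ) (D : Mat_ (Cob n)) :
    IsEmpty (iterObj (sumMat shiftedTensorLeft) (identityDiagram n) (k + 1) ≅
      identityDiagram n ⊞ D) := by
  refine ⟨fun φ => ?_⟩
  let X := iterObj (sumMat shiftedTensorLeft) (identityDiagram n) k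
  let a : identityDiagram n ⟶ sumObj shiftedTensorLeft X := Limits.biprod.inl ≫ φ.inv
  let b : sumObj shiftedTensorLeft X ⟶ identityDiagram n := φ.hom ≫ Limits.biprod.fst
  have h : a ≫ b = 𝟙 _ := by
    have : (Limits.biprod.inl ≫ φ.inv) ≫ φ.hom ≫ Limits.biprod.fst = 𝟙 (identityDiagram n) := by
      simp
    exact this
  have h' := congrFun (congrFun h PUnit.unit) PUnit.unit
  refine sum_comp_ne_id (ι := Idx n × X.ι) (fun q => q.1) (fun q => (X.X q.2).diagram)
    (fun q => Cob.toHom ((a : Mat_.Hom _ _) PUnit.unit q))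
    (fun q => Cob.toHom ((b : Mat_.Hom _ _) q PUnit.unit)) ?_
  have e := congrArg Cob.toHom (h'.trans (Mat_.id_apply_self (identityDiagram n) PUnit.unit))
  refine Eq.trans ?_ e
  have e' : (a ≫ b : Mat_.Hom _ _) PUnit.unit PUnit.unit = ∑ q : Idx n × X.ι,
      (a : Mat_.Hom (identityDiagram n) (sumObj shiftedTensorLeft X)) PUnit.unit q ≫
        (b : Mat_.Hom (sumObj shiftedTensorLeft X) (identityDiagram n)) q PUnit.unit := rfl
  refine Eq.trans ?_ (congrArg Cob.toHom e').symm
  exact (map_sum Cob.toHomHom (fun q : Idx n × X.ι =>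
      (a : Mat_.Hom (identityDiagram n) (sumObj shiftedTensorLeft X)) PUnit.unit q ≫
        (b : Mat_.Hom (sumObj shiftedTensorLeft X) (identityDiagram n)) q PUnit.unit) _).symm

end NotIso

theorem isZero_projectorComplex_X (n : ℕ) (k : ℤ) (hk : k < 0) :
    Limits.IsZero ((projectorComplex n).X k) := by
  match k, hk with
  | .negSucc k, _ => exact Limits.isZero_zero _

/-- The projector as an object of the category of bounded below complexes. -/
noncomputable def projector (n : ℕ) : Kom n :=
  ⟨projectorComplex n, 0, (CochainComplex.isStrictlyGE_iff _ _).2 (isZero_projectorComplex_X n)⟩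

theorem isUniversalProjector_projector (n : ℕ) : IsUniversalProjector (projector n) where
  isZero := isZero_projectorComplex_X n
  shift_nonneg k hk j := by
    match k, hk with
    | .ofNat k, _ => exact (Int.natCast_nonneg k).trans (shift_iterObj k j).ge
  d_degree := isDegreeZero_projectorComplex_d
  zero_iso := ⟨Iso.refl _, isDegreeZero_id _, isDegreeZero_id _⟩
  not_iso k hk D := by
    match k, hk with
    | .ofNat (k + 1), _ => exact isEmpty_iterObj_iso k D
  turnback_right i h₀ h := projectorComplex_tensorRight ⟨⟨i, h⟩, h₀⟩
  turnback_left i h₀ h := projectorComplex_tensorLeft ⟨⟨i, h⟩, h₀⟩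

end BarNatan

theorem theorem3p2 (n : ℕ) (hn : 0 < n) :
    ∃ C : BarNatan.Kom n, BarNatan.IsUniversalProjector C :=
  ⟨BarNatan.projector n, BarNatan.isUniversalProjector_projector n⟩
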